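/- Let $u_0:\mathbb R^3\to\mathbb R^3$ be smooth, bounded and divergence-free, and let $(u,p)$ be a bounded classical solution on $\mathbb R^3\times[-1,0]$ of the Cauchy problem for the Stokes equations $$u_t=-\nabla p+\Delta u,\qquad \operatorname{div}u=0,\qquad u(\cdot,-1)=u_0 ,$$ that is, $u$ is bounded and continuous on $\mathbb R^3\times[-1,0]$, $u$ and $p$ are smooth on $\mathbb R^3\times(-1,0)$ and satisfy the equations there, and the pressure is normalized as usual by $p(x,t)=o(|x|)$ as $|x|\to\infty$ for each $t\in(-1,0)$. Define the velocity $\hat u$ in Leray's blow-up variables by $$u(x,t)=\frac1{\sqrt{-t}}\,\hat u(y,\tau),\qquad y=\frac{x}{\sqrt{-t}},\qquad \tau=-\ln(-t)\ge 0 .$$ For a multi-index $\beta\in\mathbb N^3$ let $\psi^*_\beta(y)=(\beta!)^{-1/2}\prod_{i=1}^3 He_{\beta_i}(y_i/\sqrt2)$ ($He_n$ are the probabilists' Hermite polynomials), let $\Phi_k^*=\operatorname{span}\{\psi_\beta^*:|\beta|=k\}$, and let $\mathcal S_k^*=\{v\in(\Phi_k^*)^3:\operatorname{div}v=0\}$ be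 the space of solenoidal Hermite polynomials of degree $k$. For every $k\ge0$ fix a (finite) basis of $\mathcal S_k^*$; denote all these basis elements by $v_\beta^*$ and write $|\beta|=k$ if $v_\beta^*\in\mathcal S_k^*$. Let $\rho^*(y)=e^{-|y|^2/4}$. Then: 1. For every $\tau\ge0$ there are unique coefficients $c_\beta(\tau)$ such that $$\hat u(\cdot,\tau)=\sum_{\beta}c_\beta(\tau)\,v_\beta^*\quad\text{in } L^2_{\rho^*}(\mathbb R^3)^3,$$ where the series is understood as the limit of the partial sums over $|\beta|<n$ as $n\to\infty$. For every $\tau>0$ these partial sums also converge uniformly on compact sets. 2. For every $\beta$ and all $\tau\ge0$, $$\dot c_\beta=\Big(-\frac{|\beta|}2-\frac12\Big)c_\beta,\qquad c_\beta(\tau)=c_\beta(0)\,e^{-\frac{(1+|\beta|)\tau}{2}}$$ (the derivative being one-sided at $\tau=0$). Put $w_k=\sum_{|\beta|=k}c_\beta(0)\,v^*_\beta\in\mathcal S_k^*$. 3. If $u(0,0)=0$, then either $u\equiv0$ on $\mathbb R^3\times[-1,0]$, or there is $k\ge1$ with $w_k\ne0$, $w_l=0$ for all $l<k$, and $$e^{\frac{(1+k)\tau}2}\,\hat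 u(y,\tau)\to w_k(y)\quad\text{as }\tau\to+\infty,\ \text{uniformly on compact sets in } y.$$ 4. For every component $i\in\{1,2,3\}$ with $u^i(0,0)=0$, either $u^i\equiv0$ on $\mathbb R^3\times[-1,0]$, or there is $k\ge1$ such that the $i$-th component $w_k^i$ of $w_k$ is not the zero polynomial, $w_l^i=0$ for all $l<k$, $$e^{\frac{(1+k)\tau}2}\,\hat u^i(y,\tau)\to w_k^i(y)\quad\text{as }\tau\to+\infty,\ \text{uniformly on compact sets in } y,$$ and the nodal sets $Z(\tau)=\{y:\hat u^i(y,\tau)=0\}$ converge to the zero set $Z'=\{y:w_k^i(y)=0\}$ as $\tau\to+\infty$ (i.e. $t\to0^-$), locally in the Hausdorff sense: for every compact $K\subset\mathbb R^3$ and every $\varepsilon>0$, for all sufficiently large $\tau$, the set $Z(\tau)\cap K$ lies in the $\varepsilon$-neighbourhood of $Z'$, and $Z'\cap K$ lies in the $\varepsilon$-neighbourhood of $Z(\tau)$. -/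

import Mathlib

open Filter Topology MeasureTheory
open scoped ContDiff

noncomputable section

namespace StokesNodal

/-- Euclidean space `ℝ³`. -/
abbrev E3 : Type := EuclideanSpace ℝ (Fin 3)

/-! ### The Stokes equations -/

/-- Divergence of a vector field on `ℝ³`, `∑ i, ∂ᵢ vᵢ`. -/
def divergence (v : E3 → E3) (x : E3) : ℝ :=
  ∑ i : Fin 3, (fderiv ℝ v x (EuclideanSpace.single i 1)) i

/-- `u` (velocity) and `p` (pressure) form a bounded classical solution on `[-1,0] × ℝ³` of the
Cauchy problem `u_t = -∇p + Δu`, `div u = 0`, `u(·,-1) = u₀` for smooth, bounded,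
divergence-free data `u₀`. -/
structure IsBoundedStokesSolution (u₀ : E3 → E3) (u : ℝ → E3 → E3) (p : ℝ → E3 → ℝ) : Prop where
  data_smooth : ContDiff ℝ ∞ u₀
  data_bounded : ∃ M : ℝ, ∀ x, ‖u₀ x‖ ≤ M
  data_div : ∀ x, divergence u₀ x = 0
  initial : ∀ x, u (-1) x = u₀ x
  continuous_velocity :
    ContinuousOn (fun z : ℝ × E3 => u z.1 z.2) (Set.Icc (-1) 0 ×ˢ Set.univ)
  smooth_velocity :
    ContDiffOn ℝ ∞ (fun z : ℝ × E3 => u z.1 z.2) (Set.Ioo (-1) 0 ×ˢ Set.univ)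
  smooth_pressure :
    ContDiffOn ℝ ∞ (fun z : ℝ × E3 => p z.1 z.2) (Set.Ioo (-1) 0 ×ˢ Set.univ)
  bounded : ∃ M : ℝ, ∀ t ∈ Set.Icc (-1 : ℝ) 0, ∀ x, ‖u t x‖ ≤ M
  momentum : ∀ t ∈ Set.Ioo (-1 : ℝ) 0, ∀ x,
    deriv (fun s => u s x) t = -gradient (p t) x + Laplacian.laplacian (u t) x
  incompressible : ∀ t ∈ Set.Ioo (-1 : ℝ) 0, ∀ x, divergence (u t) x = 0
  /-- The usual normalization of the pressure in the Cauchy problem, `p(x,t) = o(|x|)` as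
  `|x| → ∞`. It only excludes flows driven by a pressure gradient imposed at infinity, such as
  `u = b(t)`, `p = -b'(t) · x`. -/
  pressure_sublinear : ∀ t ∈ Set.Ioo (-1 : ℝ) 0,
    Asymptotics.IsLittleO (Bornology.cobounded E3) (p t) (fun x => ‖x‖)

/-- The velocity in Leray's blow-up variables: `u(x,t) = (-t)^{-1/2} û(y,τ)`,
`y = x / √(-t)`, `τ = -ln(-t)`; that is, `û(y,τ) = √(-t) u(√(-t) y, t)` with
`t = -e^{-τ}`. -/
def leray (u : ℝ → E3 → E3) (τ : ℝ) (y : E3) : E3 :=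
  Real.sqrt (Real.exp (-τ)) • u (-Real.exp (-τ)) (Real.sqrt (Real.exp (-τ)) • y)

/-! ### Solenoidal Hermite polynomials -/

/-- The separable Hermite polynomial `ψ_β^*(y) = (β!)^{-1/2} ∏ᵢ He_{βᵢ}(yᵢ / √2)`, where `He` are
the probabilists' Hermite polynomials. These are the eigenfunctions, with eigenvalue `-|β|/2`, of
`Δ - (1/2) y · ∇`, and they are orthonormal with respect to `(4π)^{-3/2} exp(-|y|²/4) dy`. -/
def hermitePoly (β : Fin 3 → ℕ) : MvPolynomial (Fin 3) ℝ :=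
  ∏ i : Fin 3, MvPolynomial.C (1 / Real.sqrt (Nat.factorial (β i))) *
    Polynomial.aeval (MvPolynomial.C (1 / Real.sqrt 2) * MvPolynomial.X i)
      (Polynomial.hermite (β i))

/-- The scalar eigenspace `Φ_k^* = span {ψ_β^* : |β| = k}`. -/
def hermiteSpace (k : ℕ) : Submodule ℝ (MvPolynomial (Fin 3) ℝ) :=
  Submodule.span ℝ (hermitePoly '' {β | ∑ i, β i = k})

/-- Divergence of a polynomial vector field. -/
def polyDiv : (Fin 3 → MvPolynomial (Fin 3) ℝ) →ₗ[ℝ] MvPolynomial (Fin 3) ℝ :=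
  ∑ i : Fin 3, (MvPolynomial.pderiv i).toLinearMap ∘ₗ LinearMap.proj i

/-- The solenoidal eigenspace `S_k^*`: polynomial vector fields with components in `Φ_k^*` and
zero divergence. -/
def solenoidalSpace (k : ℕ) : Submodule ℝ (Fin 3 → MvPolynomial (Fin 3) ℝ) :=
  Submodule.pi Set.univ (fun _ => hermiteSpace k) ⊓ LinearMap.ker polyDiv

/-- The vector field on `ℝ³` given by a polynomial vector field. -/
def polyField (v : Fin 3 → MvPolynomial (Fin 3) ℝ) (y : E3) : E3 :=
  WithLp.toLp 2 (fun i => MvPolynomial.eval (fun j => y j) (v i))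

/-! ### Expansions in solenoidal Hermite polynomials -/

/-- The measure `ρ^*(y) dy` with `ρ^*(y) = exp(-|y|²/4)`. -/
def rhoMeasure : Measure E3 :=
  volume.withDensity (fun y => ENNReal.ofReal (Real.exp (-‖y‖ ^ 2 / 4)))

/-- The degree `k` part `∑_{|β| = k} d_β v_β^*` of the expansion with coefficients `d`, for the
basis `b k` of `S_k^*`; an index `β` is a pair of its degree `k = |β|` and an index into `b k`. -/
def levelPart {ι : ℕ → Type*} [∀ k, Fintype (ι k)]
    (b : ∀ k, Module.Basis (ι k) ℝ (solenoidalSpace k)) (d : (Σ k, ι k) → ℝ) (k : ℕ) :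
    Fin 3 → MvPolynomial (Fin 3) ℝ :=
  ∑ j : ι k, d ⟨k, j⟩ • (b k j : Fin 3 → MvPolynomial (Fin 3) ℝ)

/-- The partial sum `∑_{|β| < n} d_β v_β^*(y)`. -/
def partialSum {ι : ℕ → Type*} [∀ k, Fintype (ι k)]
    (b : ∀ k, Module.Basis (ι k) ℝ (solenoidalSpace k)) (d : (Σ k, ι k) → ℝ) (n : ℕ) (y : E3) :
    E3 :=
  ∑ k ∈ Finset.range n, polyField (levelPart b d k) y

/-- `v = ∑_β d_β v_β^*`, with convergence in `L²_{ρ^*}(ℝ³)³`. -/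
def IsHermiteExpansion {ι : ℕ → Type*} [∀ k, Fintype (ι k)]
    (b : ∀ k, Module.Basis (ι k) ℝ (solenoidalSpace k)) (v : E3 → E3) (d : (Σ k, ι k) → ℝ) :
    Prop :=
  MemLp v 2 rhoMeasure ∧
    Tendsto (fun n => eLpNorm (fun y => v y - partialSum b d n y) 2 rhoMeasure) atTop (𝓝 0)

/-! ### Nodal sets -/

/-- The nodal set of a scalar function. -/
def nodalSet (f : E3 → ℝ) : Set E3 := {y | f y = 0}

/-- `Z τ → Z'` as `τ → ∞`, locally in the Hausdorff sense: inside every compact set, and for every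
`ε > 0`, each of `Z τ` and `Z'` eventually lies in the `ε`-neighbourhood of the other. -/
def LocallyHausdorffTendsto (Z : ℝ → Set E3) (Z' : Set E3) : Prop :=
  ∀ K : Set E3, IsCompact K → ∀ ε : ℝ, 0 < ε → ∀ᶠ τ in atTop,
    Z τ ∩ K ⊆ Metric.thickening ε Z' ∧ Z' ∩ K ⊆ Metric.thickening ε (Z τ)

end StokesNodal

end

/-!
The pressure of a bounded solution is harmonic, and of sublinear growth by normalization, so it is
constant in space (`IsBoundedStokesSolution.pressure_harmonic`, `const_of_harmonic_of_isLittleO`).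
Hence every component of the velocity solves the heat equation (`IsBoundedStokesSolution.heat`).
Written in the variables `y`, `τ` it becomes a solution `f` of `∂_τ f = (Δ - ½ y · ∇) f`
(`deriv_selfSimilar`), and the rescaled velocity is `e^{-τ/2} f`.

The operator `Δ - ½ y · ∇` is symmetric for the weight `ρ^*`, with the Hermite polynomials as
eigenfunctions: it is `-∑ᵢ ∂ᵢ* ∂ᵢ` for the adjoints `∂ᵢ* = yᵢ/2 - ∂ᵢ`, and `∂ᵢ`, `∂ᵢ*` act on the
`ψ_β^*` as lowering and raising operators. Testing the equation against `ψ_β^*` shows that the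
moments of `f` of order `k` are multiples of `e^{-kτ/2}`. Only `f` itself is controlled, not its
derivatives, so the test function is first cut off at a large radius and all derivatives are moved
onto it (`hermite_moment_conservation`). No representation by the heat kernel is needed, and
continuity up to `τ = 0` brings the initial time in. The same lemma yields the Liouville theorem
used for the pressure: a harmonic function is a stationary solution of the heat equation, and
sublinear growth makes its moments of positive order vanish as `τ → -∞`.

The Hermite polynomials form an orthonormal basis of `L²_{ρ^*}` up to normalization
(`hermiteBasis`): if `f` is orthogonal to all polynomials, then expanding the exponential shows that
the characteristic functions of the measures with densities `f⁺` and `f⁻` agree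
(`ae_eq_zero_of_orthogonal_polynomials`). So the rescaled velocity is the sum of its level
projections (`tendsto_eLpNorm_sub_levelPoly`), these are solenoidal because the velocity is
(`IsBoundedStokesSolution.initialLevel_mem`), and the coefficients in the chosen bases are unique
(`isHermiteExpansion_iff`). On a fixed ball `ψ_β^*` is at most of order `A^{|β|}` for every `A > 1`
(`exists_hermitePoly_bound`), while the coefficients at time `τ > 0` carry the factor
`e^{-(1+|β|)τ/2}`. This gives uniform convergence on compact sets (`hasSum_levelPoly`) and makes the
lowest nonzero level dominate as `τ → ∞` (`tendstoUniformlyOn_leading`). Level `0` is the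
constant `u(0,0)` (`IsBoundedStokesSolution.initialLevel_zero`).

Nodal sets of locally uniformly convergent functions converge to that of the limit as soon as the
limit changes sign near each of its zeros (`locallyHausdorffTendsto_nodalSet`, by connectedness of
balls). For a Hermite polynomial `q ≠ 0` with `q(a) = 0`, the eigenvalue equation shows that the
lowest homogeneous part `h` of `q` at `a` is harmonic (`laplacian_homogeneousComponent`). Its degree
is positive, so Euler's identity gives it zero Gaussian mean (`integral_harmonic_homogeneous`).
Therefore `h`, and with it `q` near `a`, takes both signs (`exists_pos_near_zero`).
-/

namespace StokesNodal

/-! ### The Gaussian measure -/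

/-- The Gaussian weight `ρ^*(y) = exp(-|y|²/4)`. -/
noncomputable def rho (y : E3) : ℝ := Real.exp (-‖y‖ ^ 2 / 4)

lemma rho_pos (y : E3) : 0 < rho y := Real.exp_pos _

lemma contDiff_rho : ContDiff ℝ ∞ rho :=
  Real.contDiff_exp.comp ((contDiff_norm_sq ℝ).neg.div_const 4)

lemma continuous_rho : Continuous rho := contDiff_rho.continuous

lemma integral_rhoMeasure (g : E3 → ℝ) : ∫ y, g y ∂rhoMeasure = ∫ y, rho y * g y := by
  have := integral_withDensity_eq_integral_toReal_smul (μ := (volume : Measure E3))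
    (f := fun y => ENNReal.ofReal (rho y)) (by
      exact (continuous_rho.measurable).ennreal_ofReal) (by simp) g
  simpa [rhoMeasure, rho, ENNReal.toReal_ofReal, Real.exp_nonneg] using this

lemma integrable_rhoMeasure_iff (g : E3 → ℝ) :
    Integrable g rhoMeasure ↔ Integrable (fun y => rho y * g y) := by
  have := integrable_withDensity_iff_integrable_smul' (μ := (volume : Measure E3))
    (f := fun y => ENNReal.ofReal (rho y)) (continuous_rho.measurable.ennreal_ofReal)
    (by simp) (g := g)
  simpa [rhoMeasure, rho, ENNReal.toReal_ofReal, Real.exp_nonneg] using this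

lemma integrable_exp_neg_sq_norm {b : ℝ} (hb : 0 < b) :
    Integrable (fun y : E3 => Real.exp (-b * ‖y‖ ^ 2)) := by
  have h := GaussianFourier.integrable_cexp_neg_mul_sq_norm_add (V := E3) (b := (b : ℂ))
    (by simpa using hb) 0 0
  have h2 := h.norm
  refine h2.congr (ae_of_all _ fun y => ?_)
  simp only [zero_mul, add_zero, Complex.norm_exp]
  congr 1
  rw [show (-(b : ℂ) * (‖y‖ : ℂ) ^ 2) = ((-b * ‖y‖ ^ 2 : ℝ) : ℂ) by push_cast; ring,
    Complex.ofReal_re]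

/-- Exponentials `exp(c|y|)` are integrable for the Gaussian weight, because
`c|y| ≤ |y|²/8 + 2c²`. -/
lemma integrable_exp_norm (c : ℝ) : Integrable (fun y : E3 => Real.exp (c * ‖y‖)) rhoMeasure := by
  rw [integrable_rhoMeasure_iff]
  refine ((integrable_exp_neg_sq_norm (b := 1 / 8) (by norm_num)).const_mul
    (Real.exp (2 * c ^ 2))).mono' (by
      have := continuous_rho
      exact Continuous.aestronglyMeasurable (by fun_prop)) (ae_of_all _ fun y => ?_)
  rw [Real.norm_eq_abs, abs_of_pos (mul_pos (rho_pos y) (Real.exp_pos _)), rho, ← Real.exp_add,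
    ← Real.exp_add, Real.exp_le_exp]
  nlinarith [sq_nonneg (‖y‖ - 4 * c)]

instance : IsFiniteMeasure rhoMeasure := by
  have h := integrable_exp_norm 0
  simp only [zero_mul, Real.exp_zero] at h
  rwa [integrable_const_iff_isFiniteMeasure one_ne_zero] at h

instance : Measure.IsOpenPosMeasure rhoMeasure := by
  have h : (volume : Measure E3) ≪ rhoMeasure :=
    withDensity_absolutelyContinuous'
      (continuous_rho.measurable.ennreal_ofReal.aemeasurable)
      (ae_of_all _ fun y => (ENNReal.ofReal_pos.2 (rho_pos y)).ne')
  exact h.isOpenPosMeasure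

/-- At most exponential growth in `|y|`; a continuous function with this property is in every
`L^p` of the Gaussian measure, and the class is closed under products. -/
def ExpGrowth (g : E3 → ℝ) : Prop := ∃ C c : ℝ, ∀ y, |g y| ≤ C * Real.exp (c * ‖y‖)

lemma ExpGrowth.const (a : ℝ) : ExpGrowth (fun _ => a) := ⟨|a|, 0, by simp⟩

lemma ExpGrowth.of_bound {g : E3 → ℝ} {C : ℝ} (h : ∀ y, |g y| ≤ C * (1 + ‖y‖)) :
    ExpGrowth g := by
  refine ⟨C, 1, fun y => (h y).trans ?_⟩
  have hC : 0 ≤ C := by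
    have := (abs_nonneg _).trans (h 0)
    simpa using this
  refine mul_le_mul_of_nonneg_left ?_ hC
  have := Real.add_one_le_exp ‖y‖
  rw [one_mul]; linarith

lemma ExpGrowth.mul {f g : E3 → ℝ} (hf : ExpGrowth f) (hg : ExpGrowth g) :
    ExpGrowth (fun y => f y * g y) := by
  obtain ⟨C, c, h⟩ := hf
  obtain ⟨D, d, h'⟩ := hg
  refine ⟨C * D, c + d, fun y => ?_⟩
  rw [abs_mul, add_mul, Real.exp_add]
  calc |f y| * |g y| ≤ (C * Real.exp (c * ‖y‖)) * (D * Real.exp (d * ‖y‖)) :=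
        mul_le_mul (h y) (h' y) (abs_nonneg _) ((abs_nonneg _).trans (h y))
    _ = _ := by ring

lemma ExpGrowth.add {f g : E3 → ℝ} (hf : ExpGrowth f) (hg : ExpGrowth g) :
    ExpGrowth (fun y => f y + g y) := by
  obtain ⟨C, c, h⟩ := hf
  obtain ⟨D, d, h'⟩ := hg
  refine ⟨|C| + |D|, max c d, fun y => ?_⟩
  have h1 : Real.exp (c * ‖y‖) ≤ Real.exp (max c d * ‖y‖) :=
    Real.exp_le_exp.2 (mul_le_mul_of_nonneg_right (le_max_left _ _) (norm_nonneg _))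
  have h2 : Real.exp (d * ‖y‖) ≤ Real.exp (max c d * ‖y‖) :=
    Real.exp_le_exp.2 (mul_le_mul_of_nonneg_right (le_max_right _ _) (norm_nonneg _))
  calc |f y + g y| ≤ |f y| + |g y| := abs_add_le _ _
    _ ≤ C * Real.exp (c * ‖y‖) + D * Real.exp (d * ‖y‖) := add_le_add (h y) (h' y)
    _ ≤ |C| * Real.exp (c * ‖y‖) + |D| * Real.exp (d * ‖y‖) := by
        gcongr <;> exact le_abs_self _
    _ ≤ |C| * Real.exp (max c d * ‖y‖) + |D| * Real.exp (max c d * ‖y‖) := by gcongr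
    _ = _ := by ring

lemma ExpGrowth.integrable {g : E3 → ℝ} (h : ExpGrowth g) (hg : AEStronglyMeasurable g rhoMeasure) :
    Integrable g rhoMeasure := by
  obtain ⟨C, c, h⟩ := h
  exact ((integrable_exp_norm c).const_mul C).mono' hg (ae_of_all _ h)

lemma ExpGrowth.memLp {g : E3 → ℝ} (h : ExpGrowth g) (hg : Continuous g) :
    MemLp g 2 rhoMeasure := by
  rw [memLp_two_iff_integrable_sq hg.aestronglyMeasurable]
  have := (h.mul h).integrable (hg.mul hg).aestronglyMeasurable
  simpa [pow_two] using this

/-! ### Polynomials as functions -/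

/-- The function on `ℝ³` given by a polynomial. -/
noncomputable def ev (p : MvPolynomial (Fin 3) ℝ) (y : E3) : ℝ := MvPolynomial.eval (fun j => y j) p

/-- The partial derivative `∂ᵢ f`. -/
noncomputable def pd (i : Fin 3) (f : E3 → ℝ) (y : E3) : ℝ :=
  fderiv ℝ f y (EuclideanSpace.single i 1)

/-- The adjoint `yᵢ/2 - ∂ᵢ` of `∂ᵢ` with respect to the Gaussian weight. -/
noncomputable def dstar (i : Fin 3) (f : E3 → ℝ) (y : E3) : ℝ := y i / 2 * f y - pd i f y

/-- The operator `yᵢ/2 - ∂ᵢ` on polynomials. -/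
noncomputable def dstarP (i : Fin 3) (p : MvPolynomial (Fin 3) ℝ) : MvPolynomial (Fin 3) ℝ :=
  MvPolynomial.C (1 / 2) * MvPolynomial.X i * p - MvPolynomial.pderiv i p

lemma ev_add (p q : MvPolynomial (Fin 3) ℝ) (y : E3) : ev (p + q) y = ev p y + ev q y := by
  simp [ev]
lemma ev_mul (p q : MvPolynomial (Fin 3) ℝ) (y : E3) : ev (p * q) y = ev p y * ev q y := by
  simp [ev]
lemma ev_C (a : ℝ) (y : E3) : ev (MvPolynomial.C a) y = a := by simp [ev]
lemma ev_X (i : Fin 3) (y : E3) : ev (MvPolynomial.X i) y = y i := by simp [ev]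
lemma ev_smul (a : ℝ) (p : MvPolynomial (Fin 3) ℝ) (y : E3) : ev (a • p) y = a * ev p y := by
  simp [ev]
lemma ev_sum {κ : Type*} (s : Finset κ) (p : κ → MvPolynomial (Fin 3) ℝ) (y : E3) :
    ev (∑ i ∈ s, p i) y = ∑ i ∈ s, ev (p i) y := by simp [ev]
lemma ev_zero (y : E3) : ev 0 y = 0 := by simp [ev]

lemma ev_injective : Function.Injective ev := by
  intro p q h
  refine MvPolynomial.funext fun x => ?_
  have := congrFun h (WithLp.toLp 2 x)
  simpa [ev] using this

lemma contDiff_ev (p : MvPolynomial (Fin 3) ℝ) : ContDiff ℝ ∞ (ev p) := by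
  induction p using MvPolynomial.induction_on with
  | C a =>
    have : ev (MvPolynomial.C a) = fun _ => a := by ext y; simp [ev]
    rw [this]; exact contDiff_const
  | add p q hp hq =>
    have : ev (p + q) = fun y => ev p y + ev q y := by ext y; simp [ev]
    rw [this]; exact hp.add hq
  | mul_X p i hp =>
    have : ev (p * MvPolynomial.X i) = fun y => ev p y * y i := by ext y; simp [ev]
    rw [this]; exact hp.mul (by fun_prop)

lemma differentiable_ev (p : MvPolynomial (Fin 3) ℝ) : Differentiable ℝ (ev p) :=
  (contDiff_ev p).differentiable (by simp)

lemma continuous_ev (p : MvPolynomial (Fin 3) ℝ) : Continuous (ev p) := (contDiff_ev p).continuous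

lemma expGrowth_ev (p : MvPolynomial (Fin 3) ℝ) : ExpGrowth (ev p) := by
  induction p using MvPolynomial.induction_on with
  | C a =>
    have : ev (MvPolynomial.C a) = fun _ => a := by ext y; simp [ev]
    rw [this]; exact .const a
  | add p q hp hq =>
    have : ev (p + q) = fun y => ev p y + ev q y := by ext y; simp [ev]
    rw [this]; exact hp.add hq
  | mul_X p i hp =>
    have : ev (p * MvPolynomial.X i) = fun y => ev p y * y i := by ext y; simp [ev]
    rw [this]
    refine hp.mul (.of_bound (C := 1) fun y => ?_)
    have := PiLp.norm_apply_le y i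
    rw [Real.norm_eq_abs] at this
    linarith

lemma pd_add {i : Fin 3} {f g : E3 → ℝ} {y : E3} (hf : DifferentiableAt ℝ f y)
    (hg : DifferentiableAt ℝ g y) : pd i (fun y => f y + g y) y = pd i f y + pd i g y := by
  unfold pd
  rw [fderiv_fun_add hf hg]; rfl

lemma pd_mul {i : Fin 3} {f g : E3 → ℝ} {y : E3} (hf : DifferentiableAt ℝ f y)
    (hg : DifferentiableAt ℝ g y) :
    pd i (fun y => f y * g y) y = f y * pd i g y + g y * pd i f y := by
  unfold pd
  rw [fderiv_fun_mul hf hg]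
  simp

lemma pd_const (i : Fin 3) (a : ℝ) (y : E3) : pd i (fun _ => a) y = 0 := by simp [pd]

lemma pd_coord (i j : Fin 3) (y : E3) : pd i (fun y => y j) y = if i = j then 1 else 0 := by
  have : HasFDerivAt (fun y : E3 => y j) (EuclideanSpace.proj j : E3 →L[ℝ] ℝ) y :=
    (EuclideanSpace.proj j : E3 →L[ℝ] ℝ).hasFDerivAt
  rw [pd, this.fderiv]
  simp [eq_comm]

lemma pd_ev (i : Fin 3) (p : MvPolynomial (Fin 3) ℝ) :
    pd i (ev p) = ev (MvPolynomial.pderiv i p) := by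
  ext y
  induction p using MvPolynomial.induction_on with
  | C a =>
    have : ev (MvPolynomial.C a) = fun _ => a := by ext y; simp [ev]
    rw [this, pd_const]; simp [ev]
  | add p q hp hq =>
    have : ev (p + q) = fun y => ev p y + ev q y := by ext y; simp [ev]
    rw [this, pd_add (differentiable_ev p y) (differentiable_ev q y), hp, hq, map_add, ev_add]
  | mul_X p j hp =>
    have : ev (p * MvPolynomial.X j) = fun y => ev p y * y j := by ext y; simp [ev]
    rw [this, pd_mul (differentiable_ev p y) (by fun_prop), hp, pd_coord, Derivation.leibniz,
      MvPolynomial.pderiv_X]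
    by_cases h : i = j
    · subst h; simp [ev]
    · simp [ev, h, Ne.symm h]

lemma dstar_ev (i : Fin 3) (p : MvPolynomial (Fin 3) ℝ) : dstar i (ev p) = ev (dstarP i p) := by
  ext y
  rw [dstar, pd_ev]
  simp only [ev, dstarP, map_sub, map_mul, MvPolynomial.eval_C, MvPolynomial.eval_X]
  ring

lemma continuous_pd {f : E3 → ℝ} (hf : ContDiff ℝ 1 f) (i : Fin 3) : Continuous (pd i f) :=
  (hf.continuous_fderiv (by simp)).clm_apply continuous_const

lemma contDiff_pd {f : E3 → ℝ} {n : WithTop ℕ∞} (hf : ContDiff ℝ (n + 1) f) (i : Fin 3) :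
    ContDiff ℝ n (pd i f) :=
  (hf.fderiv_right le_rfl).clm_apply contDiff_const

lemma contDiff_dstar {f : E3 → ℝ} {n : WithTop ℕ∞} (hf : ContDiff ℝ (n + 1) f) (i : Fin 3) :
    ContDiff ℝ n (dstar i f) := by
  have h1 : ContDiff ℝ n (fun y : E3 => y i / 2) := by fun_prop
  exact (h1.mul (hf.of_le le_self_add)).sub (contDiff_pd hf i)

/-! ### Integration by parts -/

lemma pd_rho (i : Fin 3) (y : E3) : pd i rho y = -(y i / 2) * rho y := by
  have h := ((hasStrictFDerivAt_norm_sq y).hasFDerivAt.neg.mul_const (1 / 4 : ℝ)).exp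
  have h2 : rho = fun y : E3 => Real.exp (-‖y‖ ^ 2 * (1 / 4)) := by
    ext y; simp only [rho]; congr 1; ring
  rw [pd, h2]
  erw [h.fderiv]
  simp [EuclideanSpace.inner_single_right]
  ring

/-- Integration by parts against the Gaussian measure. -/
lemma integral_pd_mul {i : Fin 3} {f g : E3 → ℝ} (hf : Differentiable ℝ f)
    (hg : Differentiable ℝ g) (h1 : Integrable (fun y => pd i f y * g y) rhoMeasure)
    (h2 : Integrable (fun y => f y * dstar i g y) rhoMeasure)
    (h3 : Integrable (fun y => f y * g y) rhoMeasure) :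
    ∫ y, pd i f y * g y ∂rhoMeasure = ∫ y, f y * dstar i g y ∂rhoMeasure := by
  rw [integrable_rhoMeasure_iff] at h1 h2 h3
  rw [integral_rhoMeasure, integral_rhoMeasure]
  have hr : Differentiable ℝ rho := contDiff_rho.differentiable (by simp)
  have hd : ∀ y, fderiv ℝ (fun y => rho y * g y) y (EuclideanSpace.single i 1)
      = - (rho y * dstar i g y) := by
    intro y
    have := pd_mul (i := i) (hr y) (hg y)
    rw [pd_rho] at this
    unfold pd at this
    rw [this, dstar, pd]; ring
  have := integral_mul_fderiv_eq_neg_fderiv_mul_of_integrable (μ := (volume : Measure E3))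
    (f := f) (g := fun y => rho y * g y) (v := EuclideanSpace.single i 1)
    (h1.congr (ae_of_all _ fun y => by simp only [pd]; ring))
    ((h2.neg).congr (ae_of_all _ fun y => by simp only [Pi.neg_apply]; rw [hd]; ring))
    (h3.congr (ae_of_all _ fun y => by ring))
    (fun x _ => hf x) (fun x _ => (hr x).mul (hg x))
  simp only [hd] at this
  have e1 : ∫ y, rho y * (pd i f y * g y) = ∫ y, fderiv ℝ f y (EuclideanSpace.single i 1) *
      (rho y * g y) := by
    congr 1; ext y; rw [pd]; ring
  have e2 : ∫ y, rho y * (f y * dstar i g y) = - ∫ y, f y * -(rho y * dstar i g y) := by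
    rw [← integral_neg]; congr 1; ext y; ring
  rw [e1, e2, this, neg_neg]

lemma integrable_ev (p : MvPolynomial (Fin 3) ℝ) : Integrable (ev p) rhoMeasure :=
  (expGrowth_ev p).integrable (continuous_ev p).aestronglyMeasurable

/-- `dstarP i` is the adjoint of `∂ᵢ` on polynomials. -/
lemma integral_pderiv_mul (i : Fin 3) (p q : MvPolynomial (Fin 3) ℝ) :
    ∫ y, ev (MvPolynomial.pderiv i p) y * ev q y ∂rhoMeasure
      = ∫ y, ev p y * ev (dstarP i q) y ∂rhoMeasure := by
  have := integral_pd_mul (i := i) (differentiable_ev p) (differentiable_ev q)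
    (by rw [pd_ev]; simpa only [← ev_mul] using integrable_ev _)
    (by rw [dstar_ev]; simpa only [← ev_mul] using integrable_ev _)
    (by simpa only [← ev_mul] using integrable_ev _)
  rwa [pd_ev, dstar_ev] at this

lemma hasCompactSupport_pd {g : E3 → ℝ} (h : HasCompactSupport g) (i : Fin 3) :
    HasCompactSupport (pd i g) := h.fderiv_apply (𝕜 := ℝ) _

lemma hasCompactSupport_dstar {g : E3 → ℝ} (h : HasCompactSupport g) (i : Fin 3) :
    HasCompactSupport (dstar i g) := by
  have e : dstar i g = (fun y : E3 => y i / 2) * g - pd i g := rfl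
  rw [e]
  exact h.mul_left.sub (hasCompactSupport_pd h i)

/-- The adjointness of `pd i` and `dstar i` for a compactly supported test function; no growth
condition on `f` is needed. -/
lemma integral_pd_mul_of_hasCompactSupport {i : Fin 3} {f g : E3 → ℝ} (hf : ContDiff ℝ 1 f)
    (hg : ContDiff ℝ 1 g) (hc : HasCompactSupport g) :
    ∫ y, pd i f y * g y ∂rhoMeasure = ∫ y, f y * dstar i g y ∂rhoMeasure := by
  refine integral_pd_mul (hf.differentiable (by simp)) (hg.differentiable (by simp)) ?_ ?_ ?_
  · exact ((continuous_pd hf i).mul hg.continuous).integrable_of_hasCompactSupport hc.mul_left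
  · exact (hf.continuous.mul (contDiff_dstar (n := 0) (by simpa using hg) i).continuous
      ).integrable_of_hasCompactSupport (hasCompactSupport_dstar hc i).mul_left
  · exact (hf.continuous.mul hg.continuous).integrable_of_hasCompactSupport hc.mul_left

lemma integral_dstar_mul_of_hasCompactSupport {i : Fin 3} {f g : E3 → ℝ} (hf : ContDiff ℝ 1 f)
    (hg : ContDiff ℝ 1 g) (hc : HasCompactSupport g) :
    ∫ y, dstar i f y * g y ∂rhoMeasure = ∫ y, f y * pd i g y ∂rhoMeasure := by
  have h := integral_pd_mul (i := i) (hg.differentiable (by simp)) (hf.differentiable (by simp))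
    ((hf.continuous.mul (continuous_pd hg i)).integrable_of_hasCompactSupport
      (hasCompactSupport_pd hc i).mul_left |>.congr (ae_of_all _ fun y => mul_comm _ _))
    (((contDiff_dstar (n := 0) (by simpa using hf) i).continuous.mul
      hg.continuous).integrable_of_hasCompactSupport hc.mul_left |>.congr
      (ae_of_all _ fun y => mul_comm _ _))
    ((hf.continuous.mul hg.continuous).integrable_of_hasCompactSupport hc.mul_left |>.congr
      (ae_of_all _ fun y => mul_comm _ _))
  simp only [mul_comm] at h ⊢
  exact h.symm

end StokesNodal

namespace StokesNodal

/-! ### Hermite polynomials: ladder operators and growth -/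

/-- The Appell property `∂ He_{n+1} = (n+1) He_n`. -/
lemma derivative_hermite_succ (n : ℕ) :
    Polynomial.derivative (Polynomial.hermite (n + 1)) = ((n : Polynomial ℤ) + 1) *
      Polynomial.hermite n := by
  induction n with
  | zero => simp
  | succ n ih =>
    rw [Polynomial.hermite_succ (n + 1), Polynomial.derivative_sub, Polynomial.derivative_mul, ih,
      Polynomial.derivative_mul, Polynomial.hermite_succ n]
    simp
    ring

/-- The one-variable factor `(n!)^{-1/2} He_n(yᵢ/√2)` of a Hermite polynomial. -/
noncomputable def hermiteFactor (i : Fin 3) (n : ℕ) : MvPolynomial (Fin 3) ℝ :=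
  MvPolynomial.C (1 / Real.sqrt (Nat.factorial n)) *
    Polynomial.aeval (MvPolynomial.C (1 / Real.sqrt 2) * MvPolynomial.X i) (Polynomial.hermite n)

lemma pderiv_aeval_self (i : Fin 3) (q : Polynomial ℤ) :
    MvPolynomial.pderiv i
      (Polynomial.aeval (MvPolynomial.C (1 / Real.sqrt 2) * MvPolynomial.X i) q) =
    MvPolynomial.C (1 / Real.sqrt 2) * Polynomial.aeval
      (MvPolynomial.C (1 / Real.sqrt 2) * MvPolynomial.X i) (Polynomial.derivative q) := by
  have := ((MvPolynomial.pderiv i : Derivation ℝ (MvPolynomial (Fin 3) ℝ) _).restrictScalars ℤ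
    ).map_aeval q (MvPolynomial.C (1 / Real.sqrt 2) * MvPolynomial.X i)
  simp only [Derivation.restrictScalars_apply] at this
  rw [this, Derivation.leibniz]
  simp [mul_comm]

lemma pderiv_hermiteFactor_ne {i j : Fin 3} (h : i ≠ j) (n : ℕ) :
    MvPolynomial.pderiv j (hermiteFactor i n) = 0 := by
  have := ((MvPolynomial.pderiv j : Derivation ℝ (MvPolynomial (Fin 3) ℝ) _).restrictScalars ℤ
    ).map_aeval (Polynomial.hermite n) (MvPolynomial.C (1 / Real.sqrt 2) * MvPolynomial.X i)
  simp only [Derivation.restrictScalars_apply] at this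
  rw [hermiteFactor, Derivation.leibniz, this, Derivation.leibniz]
  simp [MvPolynomial.pderiv_X, h]

lemma pderiv_hermiteFactor (i : Fin 3) (n : ℕ) :
    MvPolynomial.pderiv i (hermiteFactor i n) =
      MvPolynomial.C (Real.sqrt (n / 2)) * hermiteFactor i (n - 1) := by
  rw [hermiteFactor, Derivation.leibniz, pderiv_aeval_self]
  cases n with
  | zero => simp
  | succ n =>
    rw [derivative_hermite_succ, hermiteFactor]
    simp only [MvPolynomial.pderiv_C, mul_zero, add_zero, smul_eq_mul, map_mul,
      Nat.add_sub_cancel]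
    have e : Polynomial.aeval (MvPolynomial.C (1 / Real.sqrt 2) * MvPolynomial.X i)
        ((n : Polynomial ℤ) + 1) = (MvPolynomial.C ((n : ℝ) + 1) : MvPolynomial (Fin 3) ℝ) := by
      simp
    rw [e]
    simp only [← mul_assoc, ← map_mul]
    congr 2
    have h1 : (0 : ℝ) < (n.factorial : ℝ) := by positivity
    have h3 := Real.mul_self_sqrt (show (0 : ℝ) ≤ (n : ℝ) + 1 by positivity)
    rw [Nat.factorial_succ]
    push_cast
    rw [Real.sqrt_mul (by positivity), Real.sqrt_div (by positivity)]
    have := Real.sqrt_pos.2 h1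
    have : 0 < Real.sqrt ((n : ℝ) + 1) := Real.sqrt_pos.2 (by positivity)
    generalize Real.sqrt ((n : ℝ) + 1) = s at *
    rw [← h3]
    field_simp

/-- The recursion `y ψ_n / 2 = ∂ψ_n + √((n+1)/2) ψ_{n+1}`, which says that the adjoint of the
derivative raises the degree. -/
lemma half_X_mul_hermiteFactor (i : Fin 3) (n : ℕ) :
    MvPolynomial.C (1 / 2) * MvPolynomial.X i * hermiteFactor i n =
      MvPolynomial.C (Real.sqrt ((n + 1) / 2)) * hermiteFactor i (n + 1) +
        MvPolynomial.pderiv i (hermiteFactor i n) := by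
  rw [hermiteFactor, Derivation.leibniz, pderiv_aeval_self, hermiteFactor,
    Polynomial.hermite_succ]
  simp only [MvPolynomial.pderiv_C, mul_zero, add_zero, smul_eq_mul, map_mul, map_sub,
    Polynomial.aeval_X]
  have e : (Real.sqrt ((n + 1) / 2)) * (1 / Real.sqrt ((n + 1).factorial)) =
      1 / Real.sqrt 2 * (1 / Real.sqrt n.factorial) := by
    have h1 : (0 : ℝ) < (n.factorial : ℝ) := by positivity
    rw [Nat.factorial_succ]
    push_cast
    rw [Real.sqrt_mul (by positivity), Real.sqrt_div (by positivity)]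
    have := Real.sqrt_pos.2 h1
    have : 0 < Real.sqrt ((n : ℝ) + 1) := Real.sqrt_pos.2 (by positivity)
    field_simp
  have e2 : (1 / 2 : ℝ) = 1 / Real.sqrt 2 * (1 / Real.sqrt 2) := by
    have := Real.mul_self_sqrt (show (0 : ℝ) ≤ 2 by norm_num)
    field_simp; nlinarith
  have e' := congrArg (MvPolynomial.C (σ := Fin 3)) e
  have e2' := congrArg (MvPolynomial.C (σ := Fin 3)) e2
  rw [map_mul, map_mul] at e'
  rw [map_mul] at e2'
  rw [e2']
  linear_combination (-(MvPolynomial.C (1 / Real.sqrt 2) * MvPolynomial.X i *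
    Polynomial.aeval (MvPolynomial.C (1 / Real.sqrt 2) * MvPolynomial.X i) (Polynomial.hermite n)
    - Polynomial.aeval (MvPolynomial.C (1 / Real.sqrt 2) * MvPolynomial.X i)
      (Polynomial.derivative (Polynomial.hermite n)))) * e'

lemma hermitePoly_eq (β : Fin 3 → ℕ) : hermitePoly β = ∏ i, hermiteFactor i (β i) := rfl

lemma hermitePoly_update (β : Fin 3 → ℕ) (j : Fin 3) (m : ℕ) :
    hermitePoly (Function.update β j m) =
      hermiteFactor j m * ∏ i ∈ Finset.univ.erase j, hermiteFactor i (β i) := by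
  rw [hermitePoly_eq, ← Finset.mul_prod_erase _ _ (Finset.mem_univ j), Function.update_self]
  congr 1
  refine Finset.prod_congr rfl fun i hi => ?_
  rw [Function.update_of_ne (Finset.ne_of_mem_erase hi)]

lemma pderiv_prod_erase (β : Fin 3 → ℕ) (j : Fin 3) :
    MvPolynomial.pderiv j (∏ i ∈ Finset.univ.erase j, hermiteFactor i (β i)) = 0 := by
  refine Finset.prod_induction _ (fun p => MvPolynomial.pderiv j p = 0) (fun p q hp hq => ?_)
    (by simp) fun i hi => pderiv_hermiteFactor_ne (Finset.ne_of_mem_erase hi) _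
  rw [Derivation.leibniz, hp, hq, smul_zero, smul_zero, add_zero]

/-- `∂ⱼ` lowers the `j`-th index of a Hermite polynomial. -/
lemma pderiv_hermitePoly (β : Fin 3 → ℕ) (j : Fin 3) :
    MvPolynomial.pderiv j (hermitePoly β) =
      Real.sqrt (β j / 2) • hermitePoly (Function.update β j (β j - 1)) := by
  have h := hermitePoly_update β j (β j)
  rw [Function.update_eq_self] at h
  rw [h, hermitePoly_update, Derivation.leibniz, pderiv_prod_erase, pderiv_hermiteFactor,
    MvPolynomial.smul_eq_C_mul]
  simp only [mul_zero, smul_eq_mul, zero_add]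
  ring

/-- `yⱼ/2 - ∂ⱼ` raises the `j`-th index of a Hermite polynomial. -/
lemma dstarP_hermitePoly (β : Fin 3 → ℕ) (j : Fin 3) :
    dstarP j (hermitePoly β) =
      Real.sqrt ((β j + 1) / 2) • hermitePoly (Function.update β j (β j + 1)) := by
  have h := hermitePoly_update β j (β j)
  rw [Function.update_eq_self] at h
  rw [h, hermitePoly_update, dstarP, Derivation.leibniz, pderiv_prod_erase,
    MvPolynomial.smul_eq_C_mul]
  have := half_X_mul_hermiteFactor j (β j)
  simp only [mul_zero, smul_eq_mul, zero_add]
  linear_combination (∏ i ∈ Finset.univ.erase j, hermiteFactor i (β i)) * this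

lemma dstarP_add (i : Fin 3) (p q : MvPolynomial (Fin 3) ℝ) :
    dstarP i (p + q) = dstarP i p + dstarP i q := by
  simp only [dstarP, map_add]; ring

lemma dstarP_smul (i : Fin 3) (a : ℝ) (p : MvPolynomial (Fin 3) ℝ) :
    dstarP i (a • p) = a • dstarP i p := by
  simp only [dstarP, MvPolynomial.smul_eq_C_mul, MvPolynomial.pderiv_C_mul]; ring

/-- The number operator in the `j`-th variable. -/
lemma dstarP_pderiv_hermitePoly (β : Fin 3 → ℕ) (j : Fin 3) :
    dstarP j (MvPolynomial.pderiv j (hermitePoly β)) = ((β j : ℝ) / 2) • hermitePoly β := by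
  rw [pderiv_hermitePoly, dstarP_smul, dstarP_hermitePoly, smul_smul, Function.update_self,
    Function.update_idem]
  rcases Nat.eq_zero_or_pos (β j) with h | h
  · simp [h]
  · have e : β j - 1 + 1 = β j := by omega
    rw [e, Function.update_eq_self]
    congr 1
    have : ((β j - 1 : ℕ) : ℝ) + 1 = β j := by exact_mod_cast e
    rw [this, Real.mul_self_sqrt (by positivity)]

lemma hermitePoly_zero : hermitePoly 0 = 1 := by
  simp [hermitePoly]

/-- The Hermite polynomials span all polynomials. -/
lemma span_hermitePoly : Submodule.span ℝ (Set.range hermitePoly) = ⊤ := by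
  have hX : ∀ (i : Fin 3) (p : MvPolynomial (Fin 3) ℝ),
      p ∈ Submodule.span ℝ (Set.range hermitePoly) →
      p * MvPolynomial.X i ∈ Submodule.span ℝ (Set.range hermitePoly) := by
    intro i p hp
    induction hp using Submodule.span_induction with
    | mem x hx =>
      obtain ⟨β, rfl⟩ := hx
      have h : hermitePoly β * MvPolynomial.X i = (2 : ℝ) • (dstarP i (hermitePoly β)
          + MvPolynomial.pderiv i (hermitePoly β)) := by
        have : (MvPolynomial.C (2 : ℝ) * MvPolynomial.C (1 / 2) : MvPolynomial (Fin 3) ℝ) = 1 := by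
          rw [← map_mul]; norm_num
        rw [MvPolynomial.smul_eq_C_mul, dstarP, sub_add_cancel]
        linear_combination -(MvPolynomial.X i * hermitePoly β) * this
      rw [h, dstarP_hermitePoly, pderiv_hermitePoly]
      exact Submodule.smul_mem _ _ (Submodule.add_mem _
        (Submodule.smul_mem _ _ (Submodule.subset_span ⟨_, rfl⟩))
        (Submodule.smul_mem _ _ (Submodule.subset_span ⟨_, rfl⟩)))
    | zero => simp
    | add x y _ _ hx hy => rw [add_mul]; exact Submodule.add_mem _ hx hy
    | smul a x _ hx => rw [smul_mul_assoc]; exact Submodule.smul_mem _ _ hx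
  rw [eq_top_iff]
  rintro p -
  induction p using MvPolynomial.induction_on with
  | C a =>
    have : (MvPolynomial.C a : MvPolynomial (Fin 3) ℝ) = a • hermitePoly 0 := by
      rw [hermitePoly_zero, MvPolynomial.smul_eq_C_mul, mul_one]
    rw [this]
    exact Submodule.smul_mem _ _ (Submodule.subset_span ⟨_, rfl⟩)
  | add p q hp hq => exact Submodule.add_mem _ hp hq
  | mul_X p i hp => exact hX i p hp

/-- Solutions of the three-term recursion of the normalized Hermite polynomials grow
subexponentially in the degree, locally uniformly in the variable. -/
lemma recursion_bound {M A : ℝ} (hM : 0 ≤ M) (hA : 1 < A) :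
    ∃ C : ℝ, 0 ≤ C ∧ ∀ h : ℕ → ℝ, |h 0| ≤ 1 → |h 1| ≤ 1 + M →
      (∀ n : ℕ, |h (n + 2)| ≤ M / Real.sqrt (n + 2) * |h (n + 1)| + |h n|) →
      ∀ n, |h n| ≤ C * A ^ n := by
  have hA0 : 0 < A := by linarith
  -- once `M / √(n + 2) ≤ A - 1 / A`, the bound `C * A ^ n` is preserved by the recursion
  have hgap : 0 < A - 1 / A := by
    have : 1 / A < 1 := by rw [div_lt_one hA0]; exact hA
    linarith
  have hlim : Tendsto (fun n : ℕ => M / Real.sqrt ((n : ℝ) + 2)) atTop (𝓝 0) := by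
    refine Tendsto.div_atTop tendsto_const_nhds ?_
    exact Real.tendsto_sqrt_atTop.comp
      (tendsto_atTop_add_const_right _ _ tendsto_natCast_atTop_atTop)
  obtain ⟨N, hN⟩ := eventually_atTop.1 (hlim.eventually (gt_mem_nhds hgap))
  refine ⟨(1 + M) ^ (N + 1), by positivity, fun h h0 h1 hr => ?_⟩
  -- a crude geometric bound, used only for the finitely many degrees where the recursion
  -- coefficient is still large
  have hcrude : ∀ n, |h n| ≤ (1 + M) ^ n ∧ |h (n + 1)| ≤ (1 + M) ^ (n + 1) := by
    intro n
    induction n with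
    | zero => simpa using ⟨h0, h1⟩
    | succ n ih =>
      refine ⟨ih.2, (hr n).trans ?_⟩
      have hs : M / Real.sqrt ((n : ℝ) + 2) ≤ M := by
        refine div_le_self hM (Real.one_le_sqrt.2 ?_)
        have : (0 : ℝ) ≤ n := Nat.cast_nonneg n
        linarith
      have hp : (1 + M) ^ n ≤ (1 + M) ^ (n + 1) :=
        pow_le_pow_right₀ (by linarith) (Nat.le_succ n)
      calc M / Real.sqrt (n + 2) * |h (n + 1)| + |h n|
          ≤ M * (1 + M) ^ (n + 1) + (1 + M) ^ (n + 1) :=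
            add_le_add (mul_le_mul hs ih.2 (abs_nonneg _) hM) (ih.1.trans hp)
        _ = (1 + M) ^ (n + 1 + 1) := by ring
  have hsmall : ∀ n ≤ N + 1, |h n| ≤ (1 + M) ^ (N + 1) * A ^ n := by
    intro n hn
    calc |h n| ≤ (1 + M) ^ n := (hcrude n).1
      _ ≤ (1 + M) ^ (N + 1) := pow_le_pow_right₀ (by linarith) hn
      _ ≤ (1 + M) ^ (N + 1) * A ^ n :=
        le_mul_of_one_le_right (by positivity) (one_le_pow₀ hA.le)
  have hall : ∀ n, |h n| ≤ (1 + M) ^ (N + 1) * A ^ n ∧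
      |h (n + 1)| ≤ (1 + M) ^ (N + 1) * A ^ (n + 1) := by
    intro n
    induction n with
    | zero => exact ⟨hsmall 0 (by omega), hsmall 1 (by omega)⟩
    | succ n ih =>
      refine ⟨ih.2, ?_⟩
      by_cases hn : n + 2 ≤ N + 1
      · exact hsmall _ hn
      · have hs := (hN n (by omega)).le
        refine (hr n).trans ?_
        set K := (1 + M) ^ (N + 1)
        have hK : 0 ≤ K := by positivity
        calc M / Real.sqrt (n + 2) * |h (n + 1)| + |h n|
            ≤ (A - 1 / A) * (K * A ^ (n + 1)) + K * A ^ n :=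
              add_le_add (mul_le_mul hs ih.2 (abs_nonneg _) hgap.le) ih.1
          _ = K * A ^ (n + 1 + 1) := by
              field_simp; ring
  exact fun n => (hall n).1

/-- The three-term recursion of the normalized factors. -/
lemma hermiteFactor_recursion (i : Fin 3) (y : E3) (n : ℕ) :
    Real.sqrt (n + 2) * ev (hermiteFactor i (n + 2)) y =
      y i / Real.sqrt 2 * ev (hermiteFactor i (n + 1)) y
        - Real.sqrt (n + 1) * ev (hermiteFactor i n) y := by
  have h := congrArg (fun p => ev p y) (half_X_mul_hermiteFactor i (n + 1))
  rw [pderiv_hermiteFactor] at h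
  simp only [ev_add, ev_mul, ev_C, ev_X, Nat.add_sub_cancel] at h
  push_cast at h
  rw [Real.sqrt_div (by positivity), Real.sqrt_div (by positivity),
    show (n : ℝ) + 1 + 1 = n + 2 by ring] at h
  have h2 := Real.mul_self_sqrt (show (0 : ℝ) ≤ 2 by norm_num)
  have h3 : 0 < Real.sqrt 2 := by positivity
  field_simp at h ⊢
  linear_combination (-(Real.sqrt 2) / 2) * h +
    (y i * ev (hermiteFactor i (n + 1)) y / 2) * h2

lemma exists_hermiteFactor_bound {M A : ℝ} (hM : 0 ≤ M) (hA : 1 < A) :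
    ∃ C : ℝ, 0 ≤ C ∧ ∀ (y : E3), ‖y‖ ≤ M → ∀ (i : Fin 3) (n : ℕ),
      |ev (hermiteFactor i n) y| ≤ C * A ^ n := by
  obtain ⟨C, hC, h⟩ := recursion_bound hM hA
  refine ⟨C, hC, fun y hy i => h _ ?_ ?_ fun n => ?_⟩
  · simp [hermiteFactor, ev]
  · have hyi : |y i| ≤ M := by
      have := PiLp.norm_apply_le y i
      rw [Real.norm_eq_abs] at this
      linarith
    have : |(Real.sqrt 2)⁻¹| ≤ 1 := by
      rw [abs_of_nonneg (by positivity)]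
      exact inv_le_one_of_one_le₀ (Real.one_le_sqrt.2 (by norm_num))
    simp only [hermiteFactor, ev, Nat.factorial_one, Polynomial.hermite_one]
    simp only [Nat.cast_one, Real.sqrt_one, map_mul, Polynomial.aeval_X, MvPolynomial.eval_C,
      MvPolynomial.eval_X, one_div, inv_one, one_mul, abs_mul]
    nlinarith [abs_nonneg (y i), abs_nonneg (Real.sqrt 2)⁻¹]
  · have hyi : |y i| ≤ M := by
      have := PiLp.norm_apply_le y i
      rw [Real.norm_eq_abs] at this
      linarith
    have hrec := hermiteFactor_recursion i y n
    have hp : 0 < Real.sqrt ((n : ℝ) + 2) := by positivity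
    have hle : Real.sqrt ((n : ℝ) + 1) ≤ Real.sqrt ((n : ℝ) + 2) :=
      Real.sqrt_le_sqrt (by linarith)
    have h2 : (1 : ℝ) ≤ Real.sqrt 2 := Real.one_le_sqrt.2 (by norm_num)
    rw [div_mul_eq_mul_div, ← sub_le_iff_le_add, le_div_iff₀ hp]
    have e1 : Real.sqrt ((n : ℝ) + 2) * |ev (hermiteFactor i (n + 2)) y| ≤
        M * |ev (hermiteFactor i (n + 1)) y| + Real.sqrt ((n : ℝ) + 1) *
          |ev (hermiteFactor i n) y| := by
      have e0 : Real.sqrt ((n : ℝ) + 2) * |ev (hermiteFactor i (n + 2)) y| =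
          |Real.sqrt ((n : ℝ) + 2) * ev (hermiteFactor i (n + 2)) y| := by
        rw [abs_mul, abs_of_pos hp]
      rw [e0, hrec]
      refine (abs_sub _ _).trans (add_le_add ?_ ?_)
      · rw [abs_mul, abs_div, abs_of_pos (by positivity : (0 : ℝ) < Real.sqrt 2)]
        exact mul_le_mul_of_nonneg_right ((div_le_self (abs_nonneg _) h2).trans hyi) (abs_nonneg _)
      · rw [abs_mul, abs_of_nonneg (Real.sqrt_nonneg _)]
    nlinarith [abs_nonneg (ev (hermiteFactor i n) y)]

/-- On bounded sets the normalized Hermite polynomials grow more slowly in the degree than any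
exponential `A ^ |β|` with `A > 1`. -/
lemma exists_hermitePoly_bound {M A : ℝ} (hM : 0 ≤ M) (hA : 1 < A) :
    ∃ C : ℝ, 0 ≤ C ∧ ∀ (y : E3), ‖y‖ ≤ M → ∀ β : Fin 3 → ℕ,
      |ev (hermitePoly β) y| ≤ C * A ^ (∑ i, β i) := by
  obtain ⟨C, hC, h⟩ := exists_hermiteFactor_bound hM hA
  refine ⟨C ^ 3, by positivity, fun y hy β => ?_⟩
  have e : ev (hermitePoly β) y = ∏ i, ev (hermiteFactor i (β i)) y := by
    simp only [ev, hermitePoly_eq, map_prod]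
  rw [e, Finset.abs_prod]
  calc ∏ i, |ev (hermiteFactor i (β i)) y| ≤ ∏ i, (C * A ^ β i) :=
        Finset.prod_le_prod (fun _ _ => abs_nonneg _) fun i _ => h y hy i _
    _ = C ^ 3 * A ^ (∑ i, β i) := by
        rw [Finset.prod_mul_distrib, Finset.prod_pow_eq_pow_sum]; simp

end StokesNodal

namespace StokesNodal

/-! ### Orthogonality of the Hermite polynomials -/

/-- The number operator `∂ⱼ* ∂ⱼ` is symmetric. -/
lemma integral_number_op_symm (j : Fin 3) (p q : MvPolynomial (Fin 3) ℝ) :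
    ∫ y, ev (dstarP j (MvPolynomial.pderiv j p)) y * ev q y ∂rhoMeasure =
      ∫ y, ev p y * ev (dstarP j (MvPolynomial.pderiv j q)) y ∂rhoMeasure := by
  rw [← integral_pderiv_mul]
  simp_rw [mul_comm (ev (dstarP j _) _)]
  rw [← integral_pderiv_mul]
  simp_rw [mul_comm]

/-- Hermite polynomials with `βⱼ ≠ γⱼ` have different eigenvalues under `∂ⱼ* ∂ⱼ`, so they are
orthogonal. -/
lemma integral_hermitePoly_mul_of_ne {β γ : Fin 3 → ℕ} (h : β ≠ γ) :
    ∫ y, ev (hermitePoly β) y * ev (hermitePoly γ) y ∂rhoMeasure = 0 := by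
  obtain ⟨j, hj⟩ := Function.ne_iff.1 h
  have := integral_number_op_symm j (hermitePoly β) (hermitePoly γ)
  rw [dstarP_pderiv_hermitePoly, dstarP_pderiv_hermitePoly] at this
  simp only [ev_smul] at this
  have e1 : ∀ y, ((β j : ℝ) / 2) * ev (hermitePoly β) y * ev (hermitePoly γ) y =
    ((β j : ℝ) / 2) * (ev (hermitePoly β) y * ev (hermitePoly γ) y) := fun y => by ring
  have e2 : ∀ y, ev (hermitePoly β) y * (((γ j : ℝ) / 2) * ev (hermitePoly γ) y) =
    ((γ j : ℝ) / 2) * (ev (hermitePoly β) y * ev (hermitePoly γ) y) := fun y => by ring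
  simp_rw [e1, e2, integral_const_mul] at this
  have hne : (β j : ℝ) / 2 - (γ j : ℝ) / 2 ≠ 0 := by
    intro h0
    have : (β j : ℝ) = γ j := by linarith
    exact hj (by exact_mod_cast this)
  exact (mul_eq_zero.1 (by rw [sub_mul, this, sub_self] :
    ((β j : ℝ) / 2 - (γ j : ℝ) / 2) * _ = 0)).resolve_left hne

/-- The total mass `(4π)^{3/2}` of the Gaussian measure; only its positivity matters. -/
noncomputable def gaussMass : ℝ := ∫ _, (1 : ℝ) ∂rhoMeasure

lemma gaussMass_pos : 0 < gaussMass := by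
  have h : gaussMass = rhoMeasure.real Set.univ := by simp [gaussMass]
  rw [h]
  have : rhoMeasure Set.univ ≠ 0 := (isOpen_univ.measure_pos _ Set.univ_nonempty).ne'
  exact ENNReal.toReal_pos this (measure_ne_top _ _)

/-- All `ψ_β^*` have the same norm: raising one index does not change it. -/
lemma integral_hermitePoly_sq (β : Fin 3 → ℕ) :
    ∫ y, ev (hermitePoly β) y * ev (hermitePoly β) y ∂rhoMeasure = gaussMass := by
  induction hn : ∑ i, β i generalizing β with
  | zero =>
    have : β = 0 := by
      ext i
      have := (Finset.sum_eq_zero_iff.1 hn) i (Finset.mem_univ i)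
      simpa using this
    rw [this, hermitePoly_zero]
    simp [ev, gaussMass]
  | succ n ih =>
    obtain ⟨j, hj⟩ : ∃ j, β j ≠ 0 := by
      by_contra! hc
      simp [hc] at hn
    obtain ⟨γ, hγ⟩ : ∃ γ : Fin 3 → ℕ, γ = Function.update β j (β j - 1) := ⟨_, rfl⟩
    have hγj : γ j + 1 = β j := by rw [hγ, Function.update_self]; omega
    have hup : Function.update γ j (γ j + 1) = β := by
      rw [hγj, hγ, Function.update_idem, Function.update_eq_self]
    have hsum : ∑ i, γ i = n := by
      have : ∑ i, β i = ∑ i, γ i + 1 := by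
        rw [← Finset.add_sum_erase _ _ (Finset.mem_univ j),
          ← Finset.add_sum_erase _ γ (Finset.mem_univ j), ← hγj]
        have : ∑ i ∈ Finset.univ.erase j, β i = ∑ i ∈ Finset.univ.erase j, γ i :=
          Finset.sum_congr rfl fun i hi => by
            rw [hγ, Function.update_of_ne (Finset.ne_of_mem_erase hi)]
        rw [this]; ring
      omega
    have h1 : dstarP j (hermitePoly γ) = Real.sqrt (β j / 2) • hermitePoly β := by
      rw [dstarP_hermitePoly, hup]
      congr 3
      exact_mod_cast hγj
    have h2 : MvPolynomial.pderiv j (hermitePoly β) = Real.sqrt (β j / 2) • hermitePoly γ := by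
      rw [pderiv_hermitePoly, ← hγ]
    have h3 := integral_pderiv_mul j (hermitePoly β) (hermitePoly γ)
    rw [h1, h2] at h3
    simp only [ev_smul, mul_assoc, mul_left_comm _ (Real.sqrt (β j / 2)), integral_const_mul] at h3
    rw [ih γ hsum] at h3
    have : Real.sqrt (β j / 2) ≠ 0 := by positivity
    exact (mul_left_cancel₀ this h3).symm

/-! ### Completeness -/

lemma memLp_ev (p : MvPolynomial (Fin 3) ℝ) : MemLp (ev p) 2 rhoMeasure :=
  (expGrowth_ev p).memLp (continuous_ev p)

lemma memLp_exp_norm (c : ℝ) : MemLp (fun y : E3 => Real.exp (c * ‖y‖)) 2 rhoMeasure :=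
  ExpGrowth.memLp ⟨1, c, fun y => by simp⟩ (by fun_prop)

/-- A function in `L²` of the Gaussian measure that is orthogonal to all polynomials vanishes:
the finite measures with densities `f⁺` and `f⁻` have the same characteristic function, by
expanding `exp(i⟨x,t⟩)` into its power series. -/
lemma ae_eq_zero_of_orthogonal_polynomials {f : E3 → ℝ} (hf : MemLp f 2 rhoMeasure)
    (h : ∀ p, ∫ y, f y * ev p y ∂rhoMeasure = 0) : f =ᵐ[rhoMeasure] 0 := by
  have hfi : Integrable f rhoMeasure := hf.integrable (by norm_num)
  have hfe : ∀ c : ℝ, Integrable (fun y => f y * Real.exp (c * ‖y‖)) rhoMeasure := fun c =>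
    hf.integrable_mul (memLp_exp_norm c)
  -- expand the exponential; the powers of `⟨x, t⟩` are polynomials in `x`
  have hchar : ∀ t : E3,
      ∫ x, (f x : ℂ) * Complex.exp (inner ℝ x t * Complex.I) ∂rhoMeasure = 0 := by
    intro t
    have hs := hasSum_integral_of_dominated_convergence (μ := rhoMeasure)
      (F := fun (n : ℕ) x => (f x : ℂ) * ((inner ℝ x t * Complex.I) ^ n / n.factorial))
      (f := fun x => (f x : ℂ) * Complex.exp (inner ℝ x t * Complex.I))
      (fun n x => |f x| * ((‖t‖ * ‖x‖) ^ n / n.factorial))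
      (fun n => by
        refine (Complex.continuous_ofReal.comp_aestronglyMeasurable hf.1).mul ?_
        exact Continuous.aestronglyMeasurable (by fun_prop))
      (fun n => ae_of_all _ fun x => by
        rw [norm_mul, Complex.norm_real, Real.norm_eq_abs, norm_div, norm_pow, norm_mul,
          Complex.norm_I, mul_one, Complex.norm_real, Complex.norm_natCast]
        gcongr
        rw [mul_comm ‖t‖]
        exact norm_inner_le_norm x t)
      (ae_of_all _ fun x => (Real.summable_pow_div_factorial _).mul_left _)
      (by
        have e : ∀ x : E3, ∑' n : ℕ, |f x| * ((‖t‖ * ‖x‖) ^ n / n.factorial) =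
            |f x| * Real.exp (‖t‖ * ‖x‖) := fun x => by
          rw [tsum_mul_left, Real.exp_eq_exp_ℝ, NormedSpace.exp_eq_tsum_div]
        simp_rw [e]
        exact (hfe ‖t‖).norm.congr (ae_of_all _ fun x => by
          simp only [norm_mul, Real.norm_eq_abs, abs_of_pos (Real.exp_pos _)]))
      (ae_of_all _ fun x => by
        refine HasSum.mul_left _ ?_
        rw [Complex.exp_eq_exp_ℂ]
        exact NormedSpace.expSeries_div_hasSum_exp _)
    have hz : ∀ n : ℕ, ∫ x, (f x : ℂ) * ((inner ℝ x t * Complex.I) ^ n / n.factorial) ∂rhoMeasure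
        = 0 := by
      intro n
      have e : ∀ x : E3, (f x : ℂ) * ((inner ℝ x t * Complex.I) ^ n / n.factorial) =
          (Complex.I ^ n / n.factorial) *
            ((f x * ev ((∑ i, MvPolynomial.C (t i) * MvPolynomial.X i) ^ n) x : ℝ) : ℂ) := by
        intro x
        have : ev ((∑ i, MvPolynomial.C (t i) * MvPolynomial.X i) ^ n) x = (inner ℝ x t) ^ n := by
          simp [ev, PiLp.inner_apply]
        rw [this]
        push_cast
        ring
      simp_rw [e]
      rw [integral_const_mul, integral_complex_ofReal, h]
      simp
    simp_rw [hz] at hs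
    exact hs.unique hasSum_zero
  have fin1 : IsFiniteMeasure (rhoMeasure.withDensity fun y => ENNReal.ofReal (f y)) :=
    isFiniteMeasure_withDensity_ofReal hfi.2
  have fin2 : IsFiniteMeasure (rhoMeasure.withDensity fun y => ENNReal.ofReal (-f y)) :=
    isFiniteMeasure_withDensity_ofReal hfi.neg.2
  -- the positive and the negative part of `f` are densities of the same finite measure
  have heq : (rhoMeasure.withDensity fun y => ENNReal.ofReal (f y)) =
      rhoMeasure.withDensity fun y => ENNReal.ofReal (-f y) := by
    refine Measure.ext_of_charFun (funext fun t => ?_)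
    rw [charFun_apply, charFun_apply,
      integral_withDensity_eq_integral_toReal_smul₀ hfi.1.aemeasurable.ennreal_ofReal (by simp),
      integral_withDensity_eq_integral_toReal_smul₀ (f := fun y => ENNReal.ofReal (-f y))
        hfi.1.neg.aemeasurable.ennreal_ofReal (by simp), ← sub_eq_zero, ← integral_sub, ← hchar t]
    · refine integral_congr_ae (ae_of_all _ fun x => ?_)
      simp only [ENNReal.toReal_ofReal']
      rw [← sub_smul, Complex.real_smul]
      congr 2
      rcases le_total 0 (f x) with h0 | h0
      · rw [max_eq_left h0, max_eq_right (by linarith)]; ring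
      · rw [max_eq_right h0, max_eq_left (by linarith)]; ring
    all_goals
      refine Integrable.mono' hfi.norm ?_ (ae_of_all _ fun x => ?_)
    · have h1 := hfi.1.aemeasurable.ennreal_ofReal.ennreal_toReal.aestronglyMeasurable
      have h2 : AEStronglyMeasurable (fun x : E3 => Complex.exp (inner ℝ x t * Complex.I))
        rhoMeasure := Continuous.aestronglyMeasurable (by fun_prop)
      exact h1.smul h2
    · rw [norm_smul, Complex.norm_exp_ofReal_mul_I, mul_one, ENNReal.toReal_ofReal',
        Real.norm_eq_abs, Real.norm_eq_abs, abs_of_nonneg (le_max_right _ _)]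
      exact max_le (le_abs_self _) (abs_nonneg _)
    · have h1 := hfi.1.neg.aemeasurable.ennreal_ofReal.ennreal_toReal.aestronglyMeasurable
      have h2 : AEStronglyMeasurable (fun x : E3 => Complex.exp (inner ℝ x t * Complex.I))
        rhoMeasure := Continuous.aestronglyMeasurable (by fun_prop)
      exact h1.smul h2
    · rw [norm_smul, Complex.norm_exp_ofReal_mul_I, mul_one, ENNReal.toReal_ofReal',
        Real.norm_eq_abs, Real.norm_eq_abs, abs_of_nonneg (le_max_right _ _)]
      exact max_le (neg_le_abs _) (abs_nonneg _)
  rw [withDensity_eq_iff (g := fun y => ENNReal.ofReal (-f y)) hfi.1.aemeasurable.ennreal_ofReal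
    hfi.1.neg.aemeasurable.ennreal_ofReal hfi.lintegral_lt_top.ne] at heq
  filter_upwards [heq] with x hx
  have := congrArg ENNReal.toReal hx
  simp only [ENNReal.toReal_ofReal'] at this
  rcases le_total 0 (f x) with h0 | h0
  · rw [max_eq_left h0, max_eq_right (by linarith)] at this; exact this
  · rw [max_eq_right h0, max_eq_left (by linarith)] at this
    simp only [Pi.zero_apply]; linarith

/-! ### The Hermite expansion of a function in `L²` -/

/-- A Hermite polynomial as an element of `L²`, normalized with respect to `rhoMeasure`. -/
noncomputable def hermiteLp (β : Fin 3 → ℕ) : Lp ℝ 2 rhoMeasure :=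
  (Real.sqrt gaussMass)⁻¹ • (memLp_ev (hermitePoly β)).toLp (ev (hermitePoly β))

lemma inner_toLp {f g : E3 → ℝ} (hf : MemLp f 2 rhoMeasure) (hg : MemLp g 2 rhoMeasure) :
    inner ℝ (hf.toLp f) (hg.toLp g) = ∫ y, f y * g y ∂rhoMeasure := by
  rw [L2.inner_def]
  refine integral_congr_ae ?_
  filter_upwards [hf.coeFn_toLp, hg.coeFn_toLp] with y h1 h2
  rw [h1, h2]
  simp [mul_comm]

lemma orthonormal_hermiteLp : Orthonormal ℝ hermiteLp := by
  rw [orthonormal_iff_ite]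
  intro β γ
  rw [hermiteLp, hermiteLp, inner_smul_left, inner_smul_right, inner_toLp]
  split_ifs with h
  · subst h
    rw [integral_hermitePoly_sq]
    have h1 := Real.mul_self_sqrt gaussMass_pos.le
    have h2 := Real.sqrt_pos.2 gaussMass_pos
    simp only [RCLike.conj_to_real]
    field_simp
    rw [pow_two, h1]
  · rw [integral_hermitePoly_mul_of_ne h]; simp

lemma integral_mul_ev_eq_zero_of_hermitePoly {f : E3 → ℝ} (hf : MemLp f 2 rhoMeasure)
    (h : ∀ β, ∫ y, f y * ev (hermitePoly β) y ∂rhoMeasure = 0) (p : MvPolynomial (Fin 3) ℝ) :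
    ∫ y, f y * ev p y ∂rhoMeasure = 0 := by
  have hp : p ∈ Submodule.span ℝ (Set.range hermitePoly) := by rw [span_hermitePoly]; trivial
  induction hp using Submodule.span_induction with
  | mem x hx => obtain ⟨β, rfl⟩ := hx; exact h β
  | zero => simp [ev_zero]
  | add x y _ _ hx hy =>
    simp_rw [ev_add, mul_add]
    have := integral_add (hf.integrable_mul (memLp_ev x)) (hf.integrable_mul (memLp_ev y))
    simp only [Pi.mul_apply] at this
    rw [this, hx, hy, add_zero]
  | smul a x _ hx =>
    simp_rw [ev_smul, mul_left_comm _ a]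
    rw [integral_const_mul, hx, mul_zero]

/-- The Hilbert basis of normalized Hermite polynomials. -/
noncomputable def hermiteBasis : HilbertBasis (Fin 3 → ℕ) ℝ (Lp ℝ 2 rhoMeasure) :=
  HilbertBasis.mkOfOrthogonalEqBot orthonormal_hermiteLp (by
    rw [Submodule.eq_bot_iff]
    intro F hF
    rw [Submodule.mem_orthogonal] at hF
    have hmem := Lp.memLp F
    have key : (F : E3 → ℝ) =ᵐ[rhoMeasure] 0 := by
      refine ae_eq_zero_of_orthogonal_polynomials hmem
        (integral_mul_ev_eq_zero_of_hermitePoly hmem fun β => ?_)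
      have h1 := hF _ (Submodule.subset_span ⟨β, rfl⟩)
      have h2 : F = hmem.toLp F := (Lp.toLp_coeFn F hmem).symm
      rw [h2, hermiteLp, inner_smul_left, inner_toLp] at h1
      have h3 := (mul_eq_zero.1 h1).resolve_left (by
        have := Real.sqrt_pos.2 gaussMass_pos
        simp only [RCLike.conj_to_real]
        positivity)
      simpa only [mul_comm] using h3
    exact (Lp.eq_zero_iff_ae_eq_zero).2 key)

lemma hermiteBasis_apply (β : Fin 3 → ℕ) : hermiteBasis β = hermiteLp β := by
  rw [hermiteBasis, HilbertBasis.coe_mkOfOrthogonalEqBot]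

/-- The coefficient of `ψ_β^*` in the Hermite expansion of a function. The division by
`gaussMass` is needed because `rhoMeasure` is not normalized. -/
noncomputable def hermiteCoef (f : E3 → ℝ) (β : Fin 3 → ℕ) : ℝ :=
  gaussMass⁻¹ * ∫ y, f y * ev (hermitePoly β) y ∂rhoMeasure

/-- The finite set of multi-indices of degree `k`. -/
def degLevel (k : ℕ) : Finset (Fin 3 → ℕ) := Finset.piAntidiag Finset.univ k

lemma mem_degLevel {k : ℕ} {β : Fin 3 → ℕ} : β ∈ degLevel k ↔ ∑ i, β i = k := by
  simp [degLevel, Finset.mem_piAntidiag]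

/-- The component of degree `k` of the Hermite expansion of a function. -/
noncomputable def levelPoly (f : E3 → ℝ) (k : ℕ) : MvPolynomial (Fin 3) ℝ :=
  ∑ β ∈ degLevel k, hermiteCoef f β • hermitePoly β

lemma levelPoly_mem (f : E3 → ℝ) (k : ℕ) : levelPoly f k ∈ hermiteSpace k :=
  Submodule.sum_mem _ fun β hβ => Submodule.smul_mem _ _
    (Submodule.subset_span ⟨β, mem_degLevel.1 hβ, rfl⟩)

lemma ev_levelPoly (f : E3 → ℝ) (k : ℕ) (y : E3) :
    ev (levelPoly f k) y = ∑ β ∈ degLevel k, hermiteCoef f β * ev (hermitePoly β) y := by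
  simp only [levelPoly, ev_sum, ev_smul]

/-- A polynomial as an element of `L²`. -/
noncomputable def evLp : MvPolynomial (Fin 3) ℝ →ₗ[ℝ] Lp ℝ 2 rhoMeasure where
  toFun p := (memLp_ev p).toLp (ev p)
  map_add' p q := by
    rw [← MemLp.toLp_add]
    congr 1
    ext y
    simp [ev_add]
  map_smul' a p := by
    rw [RingHom.id_apply, ← MemLp.toLp_const_smul]
    congr 1
    ext y
    simp [ev_smul]

lemma repr_smul_hermiteBasis {f : E3 → ℝ} (hf : MemLp f 2 rhoMeasure) (β : Fin 3 → ℕ) :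
    hermiteBasis.repr (hf.toLp f) β • hermiteBasis β =
      evLp (hermiteCoef f β • hermitePoly β) := by
  rw [HilbertBasis.repr_apply_apply, hermiteBasis_apply, hermiteLp, inner_smul_left, inner_toLp,
    smul_smul, hermiteCoef, map_smul]
  congr 1
  have h1 := Real.mul_self_sqrt gaussMass_pos.le
  simp only [RCLike.conj_to_real, mul_comm (ev _ _)]
  rw [mul_right_comm, ← mul_inv, h1]

/-- The Hermite expansion converges in `L²` when it is summed level by level: the finite sets
`{β : |β| < n}` are cofinal among the finite sets of multi-indices. -/
lemma tendsto_sum_toLp {f : E3 → ℝ} (hf : MemLp f 2 rhoMeasure) :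
    Tendsto (fun n : ℕ => evLp (∑ k ∈ Finset.range n, levelPoly f k)) atTop
      (𝓝 (hf.toLp f)) := by
  have h := hermiteBasis.hasSum_repr (hf.toLp f)
  simp_rw [repr_smul_hermiteBasis hf] at h
  have hdisj : ∀ n : ℕ, (↑(Finset.range n) : Set ℕ).PairwiseDisjoint degLevel := by
    intro n k _ l _ hkl
    rw [Function.onFun, Finset.disjoint_left]
    intro β h1 h2
    exact hkl ((mem_degLevel.1 h1).symm.trans (mem_degLevel.1 h2))
  have ht : Tendsto (fun n : ℕ => (Finset.range n).biUnion degLevel) atTop atTop := by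
    refine tendsto_atTop_finset_of_monotone (fun m n hmn => ?_) fun β => ⟨∑ i, β i + 1, ?_⟩
    · exact Finset.biUnion_subset_biUnion_of_subset_left _ (Finset.range_mono hmn)
    · rw [Finset.mem_biUnion]
      exact ⟨_, Finset.mem_range.2 (Nat.lt_succ_self _), mem_degLevel.2 rfl⟩
  refine (h.comp ht).congr fun n => ?_
  simp only [Function.comp_apply]
  rw [Finset.sum_biUnion (hdisj n), map_sum]
  exact Finset.sum_congr rfl fun k _ => by rw [levelPoly, map_sum]

/-- Convergence of the Hermite expansion in `L²`. -/
lemma tendsto_eLpNorm_sub_levelPoly {f : E3 → ℝ} (hf : MemLp f 2 rhoMeasure) :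
    Tendsto (fun n : ℕ => eLpNorm (fun y => f y - ev (∑ k ∈ Finset.range n, levelPoly f k) y) 2
      rhoMeasure) atTop (𝓝 0) := by
  have h := tendsto_sum_toLp hf
  simp only [evLp, LinearMap.coe_mk, AddHom.coe_mk] at h
  rw [Lp.tendsto_Lp_iff_tendsto_eLpNorm''] at h
  refine h.congr fun n => ?_
  rw [← eLpNorm_neg]
  congr 1
  ext y
  simp

lemma exists_hermiteCoef_bound {f : E3 → ℝ} (hf : MemLp f 2 rhoMeasure) :
    ∃ B : ℝ, 0 ≤ B ∧ ∀ β, |hermiteCoef f β| ≤ B := by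
  refine ⟨(Real.sqrt gaussMass)⁻¹ * ‖hf.toLp f‖, by positivity, fun β => ?_⟩
  have h := norm_inner_le_norm (𝕜 := ℝ) (hermiteLp β) (hf.toLp f)
  rw [orthonormal_hermiteLp.1 β, one_mul] at h
  have h1 := Real.mul_self_sqrt gaussMass_pos.le
  have h2 := Real.sqrt_pos.2 gaussMass_pos
  have e : hermiteCoef f β = (Real.sqrt gaussMass)⁻¹ * inner ℝ (hermiteLp β) (hf.toLp f) := by
    rw [hermiteLp, inner_smul_left, inner_toLp, hermiteCoef, RCLike.conj_to_real, ← mul_assoc,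
      ← mul_inv, h1]
    simp only [mul_comm (ev _ _)]
  rw [e, abs_mul, abs_of_pos (by positivity : (0 : ℝ) < (Real.sqrt gaussMass)⁻¹)]
  exact mul_le_mul_of_nonneg_left h (by positivity)

end StokesNodal

namespace StokesNodal

/-! ### Conservation of the Hermite moments -/

lemma pd_comp_smul (i : Fin 3) (g : E3 → ℝ) (c : ℝ) :
    pd i (fun y => g (c • y)) = fun y => c * pd i g (c • y) := by
  ext y
  rw [pd, fderiv_comp_smul]
  simp [pd]

lemma pd_const_mul (i : Fin 3) (c : ℝ) {g : E3 → ℝ} (hg : Differentiable ℝ g) :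
    pd i (fun y => c * g y) = fun y => c * pd i g y := by
  ext y
  rw [pd, fderiv_const_mul (hg y)]
  rfl

/-- Smooth compactly supported cutoff functions that exhaust `ℝ³`, with derivatives bounded
uniformly along the sequence. -/
lemma exists_cutoff : ∃ χ : ℕ → E3 → ℝ, (∀ n, ContDiff ℝ ∞ (χ n)) ∧
    (∀ n, HasCompactSupport (χ n)) ∧ (∀ n y, |χ n y| ≤ 1) ∧
    (∃ K, 0 ≤ K ∧ ∀ n i y, |pd i (χ n) y| ≤ K ∧ |pd i (pd i (χ n)) y| ≤ K) ∧
    ∀ y, ∀ᶠ n in atTop, χ n =ᶠ[𝓝 y] fun _ => 1 := by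
  let φ : ContDiffBump (0 : E3) := ⟨1, 2, one_pos, one_lt_two⟩
  have hφ : ContDiff ℝ ∞ φ := φ.contDiff
  have hc : HasCompactSupport φ := φ.hasCompactSupport
  have hd : ∀ i, ContDiff ℝ ∞ (pd i φ) := fun i => contDiff_pd (by simpa using hφ) i
  have hdd : ∀ i, ContDiff ℝ ∞ (pd i (pd i φ)) := fun i => contDiff_pd (by simpa using hd i) i
  have hcc : ∀ n : ℕ, (0 : ℝ) < 1 / ((n : ℝ) + 1) ∧ 1 / ((n : ℝ) + 1) ≤ 1 := fun n =>
    ⟨by positivity, by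
      rw [div_le_one (by positivity)]
      have : (0 : ℝ) ≤ n := Nat.cast_nonneg n
      linarith⟩
  have hK : ∀ i : Fin 3, ∃ K, ∀ y, |pd i φ y| ≤ K ∧ |pd i (pd i φ) y| ≤ K := by
    intro i
    obtain ⟨K1, h1⟩ := (hasCompactSupport_pd hc i).exists_bound_of_continuous (hd i).continuous
    obtain ⟨K2, h2⟩ := (hasCompactSupport_pd (hasCompactSupport_pd hc i) i
      ).exists_bound_of_continuous (hdd i).continuous
    exact ⟨max K1 K2, fun y => ⟨(h1 y).trans (le_max_left _ _), (h2 y).trans (le_max_right _ _)⟩⟩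
  choose K hK using hK
  have hK0 : ∀ i, 0 ≤ K i := fun i => (abs_nonneg _).trans (hK i 0).1
  have e1 : ∀ (n : ℕ) i, pd i (fun y => φ ((1 / ((n : ℝ) + 1)) • y)) =
      fun y => 1 / ((n : ℝ) + 1) * pd i φ ((1 / ((n : ℝ) + 1)) • y) := fun n i =>
    pd_comp_smul i _ _
  have e2 : ∀ (n : ℕ) i, pd i (pd i (fun y => φ ((1 / ((n : ℝ) + 1)) • y))) =
      fun y => 1 / ((n : ℝ) + 1) * (1 / ((n : ℝ) + 1) *
        pd i (pd i φ) ((1 / ((n : ℝ) + 1)) • y)) := fun n i => by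
    rw [e1, pd_const_mul, pd_comp_smul]
    exact ((hd i).differentiable (by simp)).comp (by fun_prop)
  refine ⟨fun n y => φ ((1 / ((n : ℝ) + 1)) • y), fun n => hφ.comp (by fun_prop), fun n => ?_,
    fun n y => ?_, ⟨∑ i, K i, Finset.sum_nonneg fun i _ => hK0 i, fun n i y => ?_⟩, fun y => ?_⟩
  · exact hc.comp_smul (hcc n).1.ne'
  · rw [abs_of_nonneg φ.nonneg]; exact φ.le_one
  · have hle : K i ≤ ∑ i, K i := Finset.single_le_sum (fun i _ => hK0 i) (Finset.mem_univ i)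
    obtain ⟨p1, p2⟩ := hcc n
    have q1 := (hK i ((1 / ((n : ℝ) + 1)) • y)).1
    have q2 := (hK i ((1 / ((n : ℝ) + 1)) • y)).2
    rw [e2, e1]
    simp only [abs_mul, abs_of_pos p1]
    constructor
    · exact ((mul_le_of_le_one_left (abs_nonneg _) p2).trans q1).trans hle
    · exact ((mul_le_of_le_one_left (by positivity) p2).trans
        ((mul_le_of_le_one_left (abs_nonneg _) p2).trans q2)).trans hle
  · have : ∀ᶠ n : ℕ in atTop, ‖y‖ < (n : ℝ) + 1 :=
      (tendsto_atTop_add_const_right _ _ tendsto_natCast_atTop_atTop).eventually_gt_atTop _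
    filter_upwards [this] with n hn
    have hopen : ∀ᶠ z in 𝓝 y, ‖z‖ < (n : ℝ) + 1 :=
      continuous_norm.continuousAt.eventually_lt_const hn
    filter_upwards [hopen] with z hz
    refine φ.one_of_mem_closedBall ?_
    rw [mem_closedBall_zero_iff, norm_smul, Real.norm_eq_abs, abs_of_pos (hcc n).1]
    have hp : (0 : ℝ) < (n : ℝ) + 1 := by positivity
    change 1 / ((n : ℝ) + 1) * ‖z‖ ≤ 1
    rw [one_div, inv_mul_le_iff₀ hp]
    linarith

lemma dstar_mul {i : Fin 3} {f g : E3 → ℝ} {y : E3} (hf : DifferentiableAt ℝ f y)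
    (hg : DifferentiableAt ℝ g y) :
    dstar i (fun y => f y * g y) y = g y * dstar i f y - f y * pd i g y := by
  rw [dstar, pd_mul hf hg, dstar]; ring

lemma dstar_add {i : Fin 3} {f g : E3 → ℝ} {y : E3} (hf : DifferentiableAt ℝ f y)
    (hg : DifferentiableAt ℝ g y) :
    dstar i (fun y => f y + g y) y = dstar i f y + dstar i g y := by
  rw [dstar, pd_add hf hg, dstar, dstar]; ring

/-- The Leibniz rule for `∂ᵢ* ∂ᵢ`. -/
lemma dstar_pd_mul {i : Fin 3} {f g : E3 → ℝ} (hf : ContDiff ℝ ∞ f) (hg : ContDiff ℝ ∞ g)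
    (y : E3) : dstar i (pd i fun y => f y * g y) y =
      g y * dstar i (pd i f) y + (f y * dstar i (pd i g) y - 2 * (pd i f y * pd i g y)) := by
  have hfd := hf.differentiable (by simp)
  have hgd := hg.differentiable (by simp)
  have hf' : Differentiable ℝ (pd i f) :=
    (contDiff_pd (n := ∞) (by simpa using hf) i).differentiable (by simp)
  have hg' : Differentiable ℝ (pd i g) :=
    (contDiff_pd (n := ∞) (by simpa using hg) i).differentiable (by simp)
  have e : pd i (fun y => f y * g y) = fun y => f y * pd i g y + g y * pd i f y :=
    funext fun y => pd_mul (hfd y) (hgd y)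
  have e2 : (fun y => f y * pd i g y) = fun y => pd i g y * f y := funext fun y => mul_comm _ _
  have e3 : (fun y => g y * pd i f y) = fun y => pd i f y * g y := funext fun y => mul_comm _ _
  rw [e, dstar_add (f := fun y => f y * pd i g y) (g := fun y => g y * pd i f y)
      ((hfd y).mul (hg' y)) ((hgd y).mul (hf' y)), e2, e3,
    dstar_mul (hg' y) (hfd y), dstar_mul (hf' y) (hgd y)]
  ring

lemma abs_coord_le (y : E3) (i : Fin 3) : |y i| ≤ ‖y‖ := by
  have := PiLp.norm_apply_le y i
  rwa [Real.norm_eq_abs] at this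

lemma expGrowth_abs {f : E3 → ℝ} (hf : ExpGrowth f) : ExpGrowth fun y => |f y| := by
  simpa [ExpGrowth] using hf

lemma expGrowth_one_add_norm : ExpGrowth fun y => 1 + ‖y‖ :=
  .of_bound (C := 1) fun y => by rw [abs_of_nonneg (by positivity), one_mul]

/-- Derivative in the parameter of an integral against a compactly supported function. -/
lemma hasDerivAt_integral_mul {a b : ℝ} {f : ℝ → E3 → ℝ} {g : E3 → ℝ}
    (hsm : ContDiffOn ℝ 2 (fun z : ℝ × E3 => f z.1 z.2) (Set.Ioo a b ×ˢ Set.univ))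
    (hg : Continuous g) (hc : HasCompactSupport g) {τ : ℝ} (hτ : τ ∈ Set.Ioo a b) :
    HasDerivAt (fun s => ∫ y, f s y * g y ∂rhoMeasure)
      (∫ y, deriv (fun s => f s y) τ * g y ∂rhoMeasure) τ := by
  have hopen : IsOpen (Set.Ioo a b ×ˢ (Set.univ : Set E3)) := isOpen_Ioo.prod isOpen_univ
  have hder : ∀ s ∈ Set.Ioo a b, ∀ y, HasDerivAt (fun s => f s y)
      (fderiv ℝ (fun z : ℝ × E3 => f z.1 z.2) (s, y) (1, 0)) s := by
    intro s hs y
    have h1 : HasFDerivAt (fun z : ℝ × E3 => f z.1 z.2) _ (s, y) :=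
      ((hsm.contDiffAt (hopen.mem_nhds ⟨hs, trivial⟩)).differentiableAt (by simp)).hasFDerivAt
    have h2 : HasDerivAt (fun s : ℝ => ((s, y) : ℝ × E3)) (1, 0) s :=
      (hasDerivAt_id s).prodMk (hasDerivAt_const s y)
    exact h1.comp_hasDerivAt s h2
  have hcont : ContinuousOn (fun z : ℝ × E3 =>
      fderiv ℝ (fun z : ℝ × E3 => f z.1 z.2) z (1, 0)) (Set.Ioo a b ×ˢ Set.univ) :=
    (hsm.continuousOn_fderiv_of_isOpen hopen (by simp)).clm_apply continuousOn_const
  have hslice : ∀ s ∈ Set.Ioo a b, Continuous (f s) := fun s hs =>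
    (continuousOn_univ.1 ((hsm.continuousOn).comp (f := fun y : E3 => ((s, y) : ℝ × E3))
      (by fun_prop) (fun y _ => ⟨hs, trivial⟩)))
  obtain ⟨δ, hδ, hball⟩ := Metric.nhds_basis_closedBall.mem_iff.1 (isOpen_Ioo.mem_nhds hτ)
  have hcomp : IsCompact (Metric.closedBall τ δ ×ˢ tsupport g) :=
    (isCompact_closedBall τ δ).prod hc
  obtain ⟨B, hB⟩ := hcomp.exists_bound_of_continuousOn
    (hcont.mono (Set.prod_mono hball (Set.subset_univ _)))
  have hderiv : ∀ s ∈ Set.Ioo a b, ∀ y, deriv (fun s => f s y) s =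
      fderiv ℝ (fun z : ℝ × E3 => f z.1 z.2) (s, y) (1, 0) := fun s hs y => (hder s hs y).deriv
  have key := hasDerivAt_integral_of_dominated_loc_of_deriv_le (μ := rhoMeasure) (𝕜 := ℝ)
    (F := fun s y => f s y * g y)
    (F' := fun s y => fderiv ℝ (fun z : ℝ × E3 => f z.1 z.2) (s, y) (1, 0) * g y)
    (x₀ := τ) (s := Metric.closedBall τ δ) (bound := fun y => B * |g y|)
    (Metric.closedBall_mem_nhds τ hδ) ?_ ?_ ?_ ?_ ?_ ?_
  · simp_rw [hderiv τ hτ]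
    exact key.2
  · filter_upwards [isOpen_Ioo.mem_nhds hτ] with s hs
    exact ((hslice s hs).mul hg).aestronglyMeasurable
  · exact ((hslice τ hτ).mul hg).integrable_of_hasCompactSupport hc.mul_left
  · refine Continuous.aestronglyMeasurable (Continuous.mul ?_ hg)
    exact (continuousOn_univ.1 (hcont.comp (f := fun y : E3 => ((τ, y) : ℝ × E3))
      (by fun_prop) (fun y _ => ⟨hτ, trivial⟩)))
  · refine ae_of_all _ fun y s hs => ?_
    rw [norm_mul, Real.norm_eq_abs (g y)]
    by_cases hy : y ∈ tsupport g
    · exact mul_le_mul_of_nonneg_right (hB (s, y) ⟨hs, hy⟩) (abs_nonneg _)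
    · simp [image_eq_zero_of_notMem_tsupport hy]
  · exact ((hg.abs.integrable_of_hasCompactSupport hc.norm)).const_mul B
  · exact ae_of_all _ fun y s hs => (hder s (hball hs) y).mul_const _

/-- Symmetry of `∂ᵢ* ∂ᵢ` when one of the functions is a test function. -/
lemma integral_number_op_mul {f g : E3 → ℝ} (hf : ContDiff ℝ 2 f)
    (hg : ContDiff ℝ 2 g) (hc : HasCompactSupport g) (i : Fin 3) :
    ∫ y, dstar i (pd i f) y * g y ∂rhoMeasure = ∫ y, f y * dstar i (pd i g) y ∂rhoMeasure := by
  have hf' : ContDiff ℝ 1 (pd i f) := contDiff_pd (by simpa [one_add_one_eq_two] using hf) i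
  have hg' : ContDiff ℝ 1 (pd i g) := contDiff_pd (by simpa [one_add_one_eq_two] using hg) i
  rw [integral_dstar_mul_of_hasCompactSupport hf' (hg.of_le (by norm_num)) hc,
    integral_pd_mul_of_hasCompactSupport (hf.of_le (by norm_num)) hg' (hasCompactSupport_pd hc i)]

/-- If `f` solves `∂_τ f = Δf - (1/2) y · ∇f` and grows at most linearly in `y`, then each of its
Hermite moments decays exactly like `exp(-|β|τ/2)`. No bound on the derivatives of `f` is needed,
since after the cutoff they are moved onto the test function. -/
lemma hermite_moment_conservation {a b : ℝ} {f : ℝ → E3 → ℝ}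
    (hsm : ContDiffOn ℝ 2 (fun z : ℝ × E3 => f z.1 z.2) (Set.Ioo a b ×ˢ Set.univ))
    (heq : ∀ τ ∈ Set.Ioo a b, ∀ y, deriv (fun s => f s y) τ = -∑ i, dstar i (pd i (f τ)) y)
    {C : ℝ} (hb : ∀ τ ∈ Set.Ioo a b, ∀ y, |f τ y| ≤ C * (1 + ‖y‖)) (β : Fin 3 → ℕ)
    {s t : ℝ} (hs : s ∈ Set.Ioo a b) (ht : t ∈ Set.Ioo a b) :
    Real.exp ((∑ i, β i : ℕ) * s / 2) * ∫ y, f s y * ev (hermitePoly β) y ∂rhoMeasure =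
      Real.exp ((∑ i, β i : ℕ) * t / 2) * ∫ y, f t y * ev (hermitePoly β) y ∂rhoMeasure := by
  obtain ⟨χ, hχ, hχc, hχ1, ⟨K, hK0, hK⟩, hχlim⟩ := exists_cutoff
  obtain ⟨k, hk⟩ : ∃ k : ℝ, k = (∑ i, β i : ℕ) := ⟨_, rfl⟩
  rw [← hk]
  set v := ev (hermitePoly β) with hv
  have hvs : ContDiff ℝ ∞ v := contDiff_ev _
  have hvg : ExpGrowth v := expGrowth_ev _
  have hvpd : ∀ i, ExpGrowth (pd i v) := fun i => by rw [hv, pd_ev]; exact expGrowth_ev _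
  have hvpdc : ∀ i, Continuous (pd i v) := fun i => by rw [hv, pd_ev]; exact continuous_ev _
  have hN : ∀ y, ∑ i, dstar i (pd i v) y = k / 2 * v y := by
    intro y
    simp_rw [hv, pd_ev, dstar_ev, dstarP_pderiv_hermitePoly, ev_smul]
    rw [← Finset.sum_mul, ← Finset.sum_div, hk]
    push_cast; rfl
  have hopen : IsOpen (Set.Ioo a b ×ˢ (Set.univ : Set E3)) := isOpen_Ioo.prod isOpen_univ
  have hslice : ∀ τ ∈ Set.Ioo a b, ContDiff ℝ 2 (f τ) := fun τ hτ =>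
    contDiffOn_univ.1 (hsm.comp (f := fun y : E3 => ((τ, y) : ℝ × E3))
      (by fun_prop) (fun y _ => ⟨hτ, trivial⟩))
  have hC : 0 ≤ C := by
    have := (abs_nonneg _).trans (hb s hs 0)
    simpa using this
  -- the commutator of the number operator with the cutoff
  let E : ℕ → E3 → ℝ := fun n y =>
    ∑ i, (v y * dstar i (pd i (χ n)) y - 2 * (pd i v y * pd i (χ n) y))
  have hprod : ∀ n, ContDiff ℝ ∞ fun y => v y * χ n y := fun n => hvs.mul (hχ n)
  have hprodc : ∀ n, HasCompactSupport fun y => v y * χ n y := fun n => (hχc n).mul_left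
  have hNE : ∀ n y, ∑ i, dstar i (pd i fun y => v y * χ n y) y =
      k / 2 * (v y * χ n y) + E n y := by
    intro n y
    simp_rw [dstar_pd_mul hvs (hχ n)]
    rw [Finset.sum_add_distrib, ← Finset.mul_sum, hN]
    ring
  have hpdχ : ∀ n i, ContDiff ℝ ∞ (pd i (χ n)) := fun n i => contDiff_pd (by simpa using hχ n) i
  have hEc : ∀ n, Continuous (E n) := fun n => by
    refine continuous_finsetSum _ fun i _ => ?_
    exact (hvs.continuous.mul (contDiff_dstar (n := ∞) (by simpa using hpdχ n i) i).continuous).sub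
      (continuous_const.mul ((hvpdc i).mul (hpdχ n i).continuous))
  have hEcs : ∀ n, HasCompactSupport (E n) := fun n => by
    have e : E n = (∑ i, dstar i (pd i fun y => v y * χ n y)) -
        (fun _ => k / 2) * fun y => v y * χ n y := by
      ext y
      simp only [Pi.sub_apply, Finset.sum_apply, Pi.mul_apply, hNE]
      ring
    rw [e]
    have h1 : HasCompactSupport (∑ i, dstar i (pd i fun y => v y * χ n y)) := by
      rw [Fin.sum_univ_three]
      exact ((hasCompactSupport_dstar (hasCompactSupport_pd (hprodc n) _) _).add
        (hasCompactSupport_dstar (hasCompactSupport_pd (hprodc n) _) _)).add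
        (hasCompactSupport_dstar (hasCompactSupport_pd (hprodc n) _) _)
    exact h1.sub (hprodc n).mul_left
  -- the weight dominating the commutator, uniformly in the cutoff
  let W : E3 → ℝ := fun y => ∑ i, (|v y| * (K * (1 + ‖y‖)) + 2 * (|pd i v y| * K))
  have hEW : ∀ n y, |E n y| ≤ W y := by
    intro n y
    refine (Finset.abs_sum_le_sum_abs _ _).trans (Finset.sum_le_sum fun i _ => ?_)
    obtain ⟨q1, q2⟩ := hK n i y
    have q3 : |dstar i (pd i (χ n)) y| ≤ K * (1 + ‖y‖) := by
      rw [dstar]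
      refine (abs_sub _ _).trans ?_
      have : |y i / 2 * pd i (χ n) y| ≤ ‖y‖ * K := by
        rw [abs_mul]
        refine mul_le_mul ?_ q1 (abs_nonneg _) (norm_nonneg _)
        rw [abs_div, abs_of_pos (by norm_num : (0 : ℝ) < 2)]
        have := abs_coord_le y i
        have := abs_nonneg (y i)
        linarith
      linarith
    refine (abs_sub _ _).trans ?_
    rw [abs_mul, abs_mul, abs_mul, abs_of_pos (by norm_num : (0 : ℝ) < 2)]
    gcongr
  have hWg : ExpGrowth W := by
    have : ∀ i, ExpGrowth fun y => |v y| * (K * (1 + ‖y‖)) + 2 * (|pd i v y| * K) := fun i =>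
      ((expGrowth_abs hvg).mul ((ExpGrowth.const K).mul expGrowth_one_add_norm)).add
        ((ExpGrowth.const 2).mul ((expGrowth_abs (hvpd i)).mul (.const K)))
    simp only [W, Fin.sum_univ_three]
    exact ((this 0).add (this 1)).add (this 2)
  have hWc : Continuous W := by
    refine continuous_finsetSum _ fun i _ => ?_
    have := hvpdc i
    have := hvs.continuous
    fun_prop
  let ε : ℕ → ℝ := fun n => ∫ y, (C * (1 + ‖y‖)) * |E n y| ∂rhoMeasure
  have hdomint : Integrable (fun y => (C * (1 + ‖y‖)) * W y) rhoMeasure :=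
    (((ExpGrowth.const C).mul expGrowth_one_add_norm).mul hWg).integrable
      (Continuous.aestronglyMeasurable (by fun_prop))
  have hεint : ∀ n, Integrable (fun y => (C * (1 + ‖y‖)) * |E n y|) rhoMeasure := fun n =>
    hdomint.mono' (Continuous.aestronglyMeasurable (by have := hEc n; fun_prop))
      (ae_of_all _ fun y => by
        rw [Real.norm_eq_abs, abs_of_nonneg (by positivity)]
        exact mul_le_mul_of_nonneg_left (hEW n y) (by positivity))
  have hε : Tendsto ε atTop (𝓝 0) := by
    have h0 : (0 : ℝ) = ∫ _ : E3, (0 : ℝ) ∂rhoMeasure := by simp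
    rw [h0]
    refine tendsto_integral_of_dominated_convergence _ (fun n => (hεint n).1) hdomint
      (fun n => ae_of_all _ fun y => ?_) (ae_of_all _ fun y => ?_)
    · rw [Real.norm_eq_abs, abs_of_nonneg (by positivity)]
      exact mul_le_mul_of_nonneg_left (hEW n y) (by positivity)
    · refine tendsto_const_nhds.congr' ?_
      filter_upwards [hχlim y] with n hn
      have hpd : ∀ i, pd i (χ n) =ᶠ[𝓝 y] fun _ => 0 := by
        intro i
        filter_upwards [hn.eventuallyEq_nhds] with z hz
        rw [pd, hz.fderiv_eq]
        simp
      have : E n y = 0 := by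
        refine Finset.sum_eq_zero fun i _ => ?_
        have e1 := (hpd i).eq_of_nhds
        have e2 : pd i (pd i (χ n)) y = 0 := by
          rw [pd, (hpd i).fderiv_eq]; simp
        rw [dstar, e1, e2]
        simp
      rw [this]
      simp
  -- the truncated moments; they satisfy the decay equation up to the commutator term
  let G : ℕ → ℝ → ℝ := fun n τ => ∫ y, f τ y * (v y * χ n y) ∂rhoMeasure
  have hGder : ∀ n, ∀ τ ∈ Set.Ioo a b, HasDerivAt (fun τ => Real.exp (k * τ / 2) * G n τ)
      (-(Real.exp (k * τ / 2) * ∫ y, f τ y * E n y ∂rhoMeasure)) τ := by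
    intro n τ hτ
    have h1 : HasDerivAt (G n) _ τ :=
      hasDerivAt_integral_mul hsm (hprod n).continuous (hprodc n) hτ
    have h2 : ∫ y, deriv (fun s => f s y) τ * (v y * χ n y) ∂rhoMeasure =
        -(k / 2 * G n τ) - ∫ y, f τ y * E n y ∂rhoMeasure := by
      have hint : ∀ i, Integrable (fun y => dstar i (pd i (f τ)) y * (v y * χ n y)) rhoMeasure :=
        fun i => by
          have hc1 : ContDiff ℝ 0 (dstar i (pd i (f τ))) :=
            contDiff_dstar (by
              simpa using contDiff_pd (n := 1)
                (by simpa [one_add_one_eq_two] using hslice τ hτ) i) i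
          exact (hc1.continuous.mul (hprod n).continuous).integrable_of_hasCompactSupport
            (hprodc n).mul_left
      have hint2 : ∀ i, Integrable (fun y => f τ y * dstar i (pd i fun y => v y * χ n y) y)
          rhoMeasure := fun i => by
        have hc1 : ContDiff ℝ ∞ (dstar i (pd i fun y => v y * χ n y)) :=
          contDiff_dstar (n := ∞) (by
            simpa using contDiff_pd (n := ∞) (by simpa using hprod n) i) i
        exact ((hslice τ hτ).continuous.mul hc1.continuous).integrable_of_hasCompactSupport
          (hasCompactSupport_dstar (hasCompactSupport_pd (hprodc n) i) i).mul_left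
      simp_rw [heq τ hτ, neg_mul, Finset.sum_mul]
      rw [integral_neg, integral_finsetSum _ fun i _ => hint i]
      simp_rw [integral_number_op_mul (hslice τ hτ)
        (by exact_mod_cast contDiff_infty.1 (hprod n) 2) (hprodc n)]
      rw [← integral_finsetSum _ fun i _ => hint2 i]
      simp_rw [← Finset.mul_sum, hNE, mul_add]
      rw [integral_add]
      · simp_rw [mul_left_comm _ (k / 2)]
        rw [integral_const_mul]
        ring
      · exact ((hslice τ hτ).continuous.mul (continuous_const.mul (hprod n).continuous)
          ).integrable_of_hasCompactSupport ((hprodc n).mul_left).mul_left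
      · exact ((hslice τ hτ).continuous.mul (hEc n)).integrable_of_hasCompactSupport
          (hEcs n).mul_left
    rw [h2] at h1
    have h3 : HasDerivAt (fun τ => Real.exp (k * τ / 2)) (Real.exp (k * τ / 2) * (k / 2)) τ := by
      have := ((hasDerivAt_id τ).const_mul k |>.div_const 2).exp
      simpa using this
    exact (h3.mul h1).congr_deriv (by ring)
  have hGbound : ∀ n, ∀ τ ∈ Set.Ioo a b,
      ‖-(Real.exp (k * τ / 2) * ∫ y, f τ y * E n y ∂rhoMeasure)‖ ≤ Real.exp (k * b / 2) * ε n := by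
    intro n τ hτ
    rw [norm_neg, norm_mul, Real.norm_eq_abs, abs_of_pos (Real.exp_pos _)]
    refine mul_le_mul ?_ ?_ (norm_nonneg _) (Real.exp_pos _).le
    · rw [Real.exp_le_exp]
      have : 0 ≤ k := by rw [hk]; positivity
      have := hτ.2.le
      gcongr
    · refine norm_integral_le_of_norm_le (hεint n) (ae_of_all _ fun y => ?_)
      rw [norm_mul, Real.norm_eq_abs, Real.norm_eq_abs]
      exact mul_le_mul_of_nonneg_right (hb τ hτ y) (abs_nonneg _)
  -- the mean value inequality bounds the drift of the truncated moments by `ε n`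
  have hdiff : ∀ n, ‖Real.exp (k * s / 2) * G n s - Real.exp (k * t / 2) * G n t‖ ≤
      Real.exp (k * b / 2) * ε n * ‖s - t‖ := fun n =>
    (convex_Ioo a b).norm_image_sub_le_of_norm_hasDerivWithin_le
      (fun τ hτ => (hGder n τ hτ).hasDerivWithinAt) (hGbound n) ht hs
  have hGlim : ∀ τ ∈ Set.Ioo a b,
      Tendsto (fun n => G n τ) atTop (𝓝 (∫ y, f τ y * v y ∂rhoMeasure)) := by
    intro τ hτ
    refine tendsto_integral_of_dominated_convergence (fun y => C * (1 + ‖y‖) * |v y|)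
      (fun n => ((hslice τ hτ).continuous.mul (hprod n).continuous).aestronglyMeasurable)
      ((((ExpGrowth.const C).mul expGrowth_one_add_norm).mul (expGrowth_abs hvg)).integrable
        (Continuous.aestronglyMeasurable (by have := hvs.continuous; fun_prop)))
      (fun n => ae_of_all _ fun y => ?_) (ae_of_all _ fun y => ?_)
    · rw [norm_mul, norm_mul, Real.norm_eq_abs, Real.norm_eq_abs, Real.norm_eq_abs]
      refine mul_le_mul (hb τ hτ y) ?_ (by positivity) (by positivity)
      exact mul_le_of_le_one_right (abs_nonneg _) (hχ1 n y)
    · refine tendsto_const_nhds.congr' ?_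
      filter_upwards [hχlim y] with n hn
      rw [hn.eq_of_nhds, mul_one]
  have hlim := (((hGlim s hs).const_mul (Real.exp (k * s / 2))).sub
    ((hGlim t ht).const_mul (Real.exp (k * t / 2)))).norm
  have hlim2 : Tendsto (fun n => Real.exp (k * b / 2) * ε n * ‖s - t‖) atTop (𝓝 0) := by
    simpa using (hε.const_mul (Real.exp (k * b / 2))).mul_const ‖s - t‖
  have := le_of_tendsto_of_tendsto' hlim hlim2 hdiff
  exact sub_eq_zero.1 (norm_le_zero_iff.1 this)

lemma pd_component {v : E3 → E3} (hv : Differentiable ℝ v) (i j : Fin 3) (x : E3) :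
    pd i (fun x => v x j) x = (fderiv ℝ v x (EuclideanSpace.single i 1)) j := by
  have h := ((EuclideanSpace.proj j : E3 →L[ℝ] ℝ).hasFDerivAt (x := v x)).comp x
    (hv x).hasFDerivAt
  have h2 : HasFDerivAt (fun x => v x j) _ x := h
  rw [pd, h2.fderiv]
  rfl

/-- A bounded solenoidal field is weakly solenoidal against polynomials in the Gaussian measure. -/
lemma sum_integral_dstarP_eq_zero {v : E3 → E3} (hv : ContDiff ℝ ∞ v) {M : ℝ}
    (hM : ∀ x, ‖v x‖ ≤ M) (hdiv : ∀ x, divergence v x = 0) (q : MvPolynomial (Fin 3) ℝ) :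
    ∑ i, ∫ y, v y i * ev (dstarP i q) y ∂rhoMeasure = 0 := by
  obtain ⟨χ, hχ, hχc, hχ1, ⟨K, hK0, hK⟩, hχlim⟩ := exists_cutoff
  have hvi : ∀ i, ContDiff ℝ ∞ fun y => v y i := fun i => by fun_prop
  have hqs := contDiff_ev q
  have hprod : ∀ n, ContDiff ℝ ∞ fun y => ev q y * χ n y := fun n => hqs.mul (hχ n)
  have hprodc : ∀ n, HasCompactSupport fun y => ev q y * χ n y := fun n => (hχc n).mul_left
  have hzero : ∀ n, ∑ i, ∫ y, v y i * dstar i (fun y => ev q y * χ n y) y ∂rhoMeasure = 0 := by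
    intro n
    have hint : ∀ i, Integrable (fun y => pd i (fun y => v y i) y * (ev q y * χ n y)) rhoMeasure :=
      fun i => ((contDiff_pd (n := ∞) (by simpa using hvi i) i).continuous.mul
        (hprod n).continuous).integrable_of_hasCompactSupport (hprodc n).mul_left
    have e : ∀ i, ∫ y, v y i * dstar i (fun y => ev q y * χ n y) y ∂rhoMeasure =
        ∫ y, pd i (fun y => v y i) y * (ev q y * χ n y) ∂rhoMeasure := fun i =>
      (integral_pd_mul_of_hasCompactSupport ((hvi i).of_le (by exact_mod_cast le_top))
        ((hprod n).of_le (by exact_mod_cast le_top)) (hprodc n)).symm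
    simp_rw [e]
    rw [← integral_finsetSum _ fun i _ => hint i]
    simp_rw [← Finset.sum_mul]
    have : ∀ y, ∑ i, pd i (fun y => v y i) y = 0 := fun y => by
      rw [← hdiv y, divergence]
      exact Finset.sum_congr rfl fun i _ => pd_component (hv.differentiable (by simp)) i i y
    simp [this]
  have hlim : Tendsto (fun n => ∑ i, ∫ y, v y i * dstar i (fun y => ev q y * χ n y) y ∂rhoMeasure)
      atTop (𝓝 (∑ i, ∫ y, v y i * ev (dstarP i q) y ∂rhoMeasure)) := by
    refine tendsto_finsetSum _ fun i _ => ?_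
    refine tendsto_integral_of_dominated_convergence
      (fun y => M * (|ev (dstarP i q) y| + |ev q y| * K)) (fun n => ?_) ?_
      (fun n => ae_of_all _ fun y => ?_) (ae_of_all _ fun y => ?_)
    · exact ((hvi i).continuous.mul (contDiff_dstar (n := ∞)
        (by simpa using hprod n) i).continuous).aestronglyMeasurable
    · refine ((ExpGrowth.const M).mul ((expGrowth_abs (expGrowth_ev _)).add
        ((expGrowth_abs (expGrowth_ev _)).mul (.const K)))).integrable
        (Continuous.aestronglyMeasurable ?_)
      have := continuous_ev q
      have := continuous_ev (dstarP i q)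
      fun_prop
    · rw [dstar_mul (differentiable_ev q y) ((hχ n).differentiable (by simp) y), dstar_ev, norm_mul]
      have hM0 : 0 ≤ M := (norm_nonneg _).trans (hM 0)
      refine mul_le_mul ((PiLp.norm_apply_le _ i).trans (hM y)) ?_ (norm_nonneg _) hM0
      rw [Real.norm_eq_abs]
      refine (abs_sub _ _).trans ?_
      rw [abs_mul, abs_mul]
      exact add_le_add (mul_le_of_le_one_left (abs_nonneg _) (hχ1 n y))
        (mul_le_mul_of_nonneg_left (hK n i y).1 (abs_nonneg _))
    · refine tendsto_const_nhds.congr' ?_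
      filter_upwards [hχlim y] with n hn
      rw [dstar_mul (differentiable_ev q y) ((hχ n).differentiable (by simp) y), dstar_ev,
        hn.eq_of_nhds, pd, hn.fderiv_eq]
      simp
  simp_rw [hzero] at hlim
  exact tendsto_nhds_unique hlim tendsto_const_nhds

end StokesNodal

namespace StokesNodal

/-! ### The heat equation in self-similar variables -/

lemma fderiv_apply_eq_sum_pd (f : E3 → ℝ) (x y : E3) : fderiv ℝ f x y = ∑ i, y i * pd i f x := by
  have h : y = ∑ i, y i • EuclideanSpace.single i (1 : ℝ) := by
    ext j
    simp [Pi.single_apply]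
  conv_lhs => rw [h, map_sum]
  simp [pd]

/-- The self-similar variables `t = -e^{-τ}`, `x = e^{-τ/2} y` for a scalar function. -/
noncomputable def selfSimilar (U : ℝ → E3 → ℝ) (τ : ℝ) (y : E3) : ℝ :=
  U (-Real.exp (-τ)) (Real.exp (-τ / 2) • y)

lemma exp_neg_half_mul_self (τ : ℝ) : Real.exp (-τ / 2) * Real.exp (-τ / 2) = Real.exp (-τ) := by
  rw [← Real.exp_add]; congr 1; ring

section SelfSimilar

variable {U : ℝ → E3 → ℝ} {T a : ℝ}

lemma mem_time_of_lt (hT : T ≤ -Real.exp (-a)) {τ : ℝ} (hτ : a < τ) :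
    -Real.exp (-τ) ∈ Set.Ioo T 0 := by
  refine ⟨hT.trans_lt ?_, by simpa using Real.exp_pos (-τ)⟩
  rw [neg_lt_neg_iff, Real.exp_lt_exp]
  linarith

lemma contDiffOn_selfSimilar
    (hsm : ContDiffOn ℝ ∞ (fun z : ℝ × E3 => U z.1 z.2) (Set.Ioo T 0 ×ˢ Set.univ))
    (hT : T ≤ -Real.exp (-a)) (b : ℝ) :
    ContDiffOn ℝ 2 (fun z : ℝ × E3 => selfSimilar U z.1 z.2) (Set.Ioo a b ×ˢ Set.univ) := by
  have h : ContDiffOn ℝ 2 (fun z : ℝ × E3 => U z.1 z.2) (Set.Ioo T 0 ×ˢ Set.univ) := by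
    exact_mod_cast contDiffOn_infty.1 hsm 2
  refine h.comp (f := fun z : ℝ × E3 => ((-Real.exp (-z.1), Real.exp (-z.1 / 2) • z.2) : ℝ × E3))
    ?_ fun z hz => ⟨mem_time_of_lt hT hz.1.1, trivial⟩
  refine ContDiff.contDiffOn ?_
  have h1 : ContDiff ℝ 2 fun z : ℝ × E3 => -Real.exp (-z.1) :=
    (Real.contDiff_exp.comp contDiff_fst.neg).neg
  have h2 : ContDiff ℝ 2 fun z : ℝ × E3 => Real.exp (-z.1 / 2) :=
    Real.contDiff_exp.comp (contDiff_fst.neg.div_const 2)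
  exact h1.prodMk (h2.smul contDiff_snd)

/-- In self-similar variables the heat equation becomes `∂_τ f = Δf - (1/2) y · ∇f`. -/
lemma deriv_selfSimilar
    (hsm : ContDiffOn ℝ ∞ (fun z : ℝ × E3 => U z.1 z.2) (Set.Ioo T 0 ×ˢ Set.univ))
    (heat : ∀ t ∈ Set.Ioo T 0, ∀ x, deriv (fun s => U s x) t = ∑ i, pd i (pd i (U t)) x)
    (hT : T ≤ -Real.exp (-a)) {τ : ℝ} (hτ : a < τ) (y : E3) :
    deriv (fun s => selfSimilar U s y) τ = -∑ i, dstar i (pd i (selfSimilar U τ)) y := by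
  have hopen : IsOpen (Set.Ioo T 0 ×ˢ (Set.univ : Set E3)) := isOpen_Ioo.prod isOpen_univ
  have hmem := mem_time_of_lt hT hτ
  obtain ⟨t, ht⟩ : ∃ t, t = -Real.exp (-τ) := ⟨_, rfl⟩
  obtain ⟨r, hr⟩ : ∃ r, r = Real.exp (-τ / 2) := ⟨_, rfl⟩
  have hrt : t = -(r * r) := by rw [ht, hr, exp_neg_half_mul_self]
  rw [← ht] at hmem
  have hslice : ContDiff ℝ ∞ (U t) :=
    contDiffOn_univ.1 (hsm.comp (f := fun y : E3 => ((t, y) : ℝ × E3))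
      (by fun_prop) (fun y _ => ⟨hmem, trivial⟩))
  have hF : ∀ x, HasFDerivAt (fun z : ℝ × E3 => U z.1 z.2)
      (fderiv ℝ (fun z : ℝ × E3 => U z.1 z.2) (t, x)) (t, x) := fun x =>
    ((hsm.contDiffAt (hopen.mem_nhds ⟨hmem, trivial⟩)).differentiableAt (by simp)).hasFDerivAt
  have hFt : ∀ x, fderiv ℝ (fun z : ℝ × E3 => U z.1 z.2) (t, x) (1, 0) =
      ∑ i, pd i (pd i (U t)) x := by
    intro x
    rw [← heat t hmem x]
    have h2 : HasDerivAt (fun s : ℝ => ((s, x) : ℝ × E3)) (1, 0) t :=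
      (hasDerivAt_id t).prodMk (hasDerivAt_const t x)
    exact ((hF x).comp_hasDerivAt t h2).deriv.symm
  have hFx : ∀ x v, fderiv ℝ (fun z : ℝ × E3 => U z.1 z.2) (t, x) (0, v) =
      fderiv ℝ (U t) x v := by
    intro x v
    have h2 : HasFDerivAt (fun x : E3 => ((t, x) : ℝ × E3)) (ContinuousLinearMap.inr ℝ ℝ E3) x :=
      hasFDerivAt_prodMk_right t x
    have h3 : HasFDerivAt (U t) _ x := (hF x).comp x h2
    rw [h3.fderiv]
    simp
  have hcurve : HasDerivAt (fun s : ℝ => ((-Real.exp (-s), Real.exp (-s / 2) • y) : ℝ × E3))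
      (r * r, (-(r / 2)) • y) τ := by
    have h1 : HasDerivAt (fun s : ℝ => -Real.exp (-s)) (r * r) τ := by
      have := ((hasDerivAt_id τ).neg.exp).neg
      refine this.congr_deriv ?_
      rw [hr, exp_neg_half_mul_self]
      simp
    have h2 : HasDerivAt (fun s : ℝ => Real.exp (-s / 2)) (-(r / 2)) τ := by
      have := ((hasDerivAt_id τ).neg.div_const 2).exp
      refine this.congr_deriv ?_
      rw [hr]
      simp
      ring
    exact h1.prodMk (h2.smul_const y)
  have hF' := hF (r • y)
  rw [ht, hr] at hF'
  have hder := hF'.comp_hasDerivAt τ hcurve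
  have hder2 : HasDerivAt (fun s => selfSimilar U s y) _ τ := hder
  rw [hder2.deriv, ← ht, ← hr]
  have hsplit : ((r * r, (-(r / 2)) • y) : ℝ × E3) = (r * r) • (1, 0) + (0, (-(r / 2)) • y) := by
    simp
  rw [hsplit, map_add, map_smul, hFt, hFx, map_smul, fderiv_apply_eq_sum_pd]
  have hself : selfSimilar U τ = fun y => U t (r • y) := by
    ext y; rw [selfSimilar, ht, hr]
  have hUi : ∀ i, Differentiable ℝ (pd i (U t)) := fun i =>
    (contDiff_pd (n := ∞) (by simpa using hslice) i).differentiable (by simp)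
  have hp : ∀ i, pd i (selfSimilar U τ) = fun y => r * pd i (U t) (r • y) := fun i => by
    rw [hself, pd_comp_smul]
  have hpp : ∀ i, pd i (pd i (selfSimilar U τ)) = fun y => r * (r * pd i (pd i (U t)) (r • y)) :=
    fun i => by
      rw [hp, pd_const_mul, pd_comp_smul]
      exact (hUi i).comp (by fun_prop)
  simp only [dstar, hpp]
  simp only [hp]
  simp only [smul_eq_mul, Finset.sum_sub_distrib, Finset.mul_sum, neg_sub]
  rw [sub_eq_add_neg, ← Finset.sum_neg_distrib]
  congr 1 <;> refine Finset.sum_congr rfl fun i _ => by ring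

/-- The Hermite moments of a solution of the heat equation with at most linear growth, in
self-similar variables: the moment of order `k` is a multiple of `e^{-kτ/2}`. -/
lemma selfSimilar_moment
    (hsm : ContDiffOn ℝ ∞ (fun z : ℝ × E3 => U z.1 z.2) (Set.Ioo T 0 ×ˢ Set.univ))
    (heat : ∀ t ∈ Set.Ioo T 0, ∀ x, deriv (fun s => U s x) t = ∑ i, pd i (pd i (U t)) x)
    (hT : T ≤ -Real.exp (-a)) {C : ℝ} (hC : ∀ t ∈ Set.Ioo T 0, ∀ x, |U t x| ≤ C * (1 + ‖x‖))
    (β : Fin 3 → ℕ) {s t : ℝ} (hs : a < s) (ht : a < t) :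
    Real.exp ((∑ i, β i : ℕ) * s / 2) * ∫ y, selfSimilar U s y * ev (hermitePoly β) y ∂rhoMeasure =
      Real.exp ((∑ i, β i : ℕ) * t / 2) *
        ∫ y, selfSimilar U t y * ev (hermitePoly β) y ∂rhoMeasure := by
  refine hermite_moment_conservation (a := a) (b := max s t + 1)
    (C := C * Real.exp (|a| / 2)) (contDiffOn_selfSimilar hsm hT _)
    (fun τ hτ y => deriv_selfSimilar hsm heat hT hτ.1 y) (fun τ hτ y => ?_) β
    ⟨hs, by have := le_max_left s t; linarith⟩ ⟨ht, by have := le_max_right s t; linarith⟩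
  have hm := mem_time_of_lt hT hτ.1
  have hC0 : 0 ≤ C := by
    have := (abs_nonneg _).trans (hC _ hm 0)
    simpa using this
  refine (hC _ hm _).trans ?_
  rw [mul_assoc]
  refine mul_le_mul_of_nonneg_left ?_ hC0
  rw [norm_smul, Real.norm_eq_abs, abs_of_pos (Real.exp_pos _)]
  have h1 : (1 : ℝ) ≤ Real.exp (|a| / 2) := Real.one_le_exp (by positivity)
  have h2 : Real.exp (-τ / 2) ≤ Real.exp (|a| / 2) := by
    rw [Real.exp_le_exp]
    have := neg_le_abs a
    have := hτ.1
    linarith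
  nlinarith [norm_nonneg y]

end SelfSimilar

/-! ### Liouville's theorem for harmonic functions of sublinear growth -/

lemma exists_linear_bound {p : E3 → ℝ} (hp : Continuous p)
    (ho : p =o[Bornology.cobounded E3] fun x => ‖x‖) : ∃ C, 0 ≤ C ∧ ∀ x, |p x| ≤ C * (1 + ‖x‖) := by
  have h1 := ho.bound one_pos
  rw [Metric.cobounded_eq_cocompact] at h1
  obtain ⟨K, hK, hKs⟩ := mem_cocompact.1 h1
  obtain ⟨B, hB⟩ := hK.exists_bound_of_continuousOn hp.continuousOn
  refine ⟨max B 1, le_max_of_le_right zero_le_one, fun x => ?_⟩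
  have hn := norm_nonneg x
  by_cases hx : x ∈ K
  · have := hB x hx
    rw [Real.norm_eq_abs] at this
    have h2 := le_max_left B 1
    have h3 := le_max_right B 1
    nlinarith
  · have : ‖p x‖ ≤ 1 * ‖‖x‖‖ := hKs hx
    rw [norm_norm, Real.norm_eq_abs, one_mul] at this
    have h3 := le_max_right B 1
    nlinarith

/-- A harmonic function with `p(x) = o(|x|)` is constant. Viewed as a stationary solution of the
heat equation, its Hermite moments of positive degree vanish by letting `τ → -∞`. -/
lemma const_of_harmonic_of_isLittleO {p : E3 → ℝ} (hp : ContDiff ℝ ∞ p)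
    (hharm : ∀ x, ∑ i, pd i (pd i p) x = 0)
    (ho : p =o[Bornology.cobounded E3] fun x => ‖x‖) : ∃ c, p = fun _ => c := by
  obtain ⟨C, hC0, hC⟩ := exists_linear_bound hp.continuous ho
  have hpg : ExpGrowth p := .of_bound hC
  have hmom : ∀ β : Fin 3 → ℕ, β ≠ 0 → ∫ y, p y * ev (hermitePoly β) y ∂rhoMeasure = 0 := by
    intro β hβ
    have hk : 1 ≤ ∑ i, β i := by
      by_contra h
      have h0 : ∑ i, β i = 0 := by omega
      refine hβ (funext fun i => ?_)
      simpa using (Finset.sum_eq_zero_iff.1 h0) i (Finset.mem_univ i)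
    have hconst : ∀ τ : ℝ, ∫ y, p y * ev (hermitePoly β) y ∂rhoMeasure =
        Real.exp ((∑ i, β i : ℕ) * τ / 2) *
          ∫ y, p (Real.exp (-τ / 2) • y) * ev (hermitePoly β) y ∂rhoMeasure := by
      intro τ
      have h := selfSimilar_moment (U := fun _ => p) (T := -Real.exp (-(min τ 0 - 1)))
        (a := min τ 0 - 1) (C := C) (hp.comp contDiff_snd).contDiffOn
        (fun t _ x => by simp [hharm]) le_rfl (fun t _ x => hC x) β
        (s := 0) (t := τ) (by have := min_le_right τ 0; linarith)
        (by have := min_le_left τ 0; linarith)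
      simpa [selfSimilar] using h
    -- dilated by `e^{-τ/2}`, a function of sublinear growth is `o(e^{-τ/2})` as `τ → -∞`
    have hlim : Tendsto (fun τ : ℝ => ∫ y, (Real.exp (τ / 2) * p (Real.exp (-τ / 2) • y)) *
        ev (hermitePoly β) y ∂rhoMeasure) atBot (𝓝 (∫ _, 0 ∂rhoMeasure)) := by
      refine tendsto_integral_filter_of_dominated_convergence
        (fun y => C * (1 + ‖y‖) * |ev (hermitePoly β) y|) (Eventually.of_forall fun τ => ?_) ?_ ?_
        (ae_of_all _ fun y => ?_)
      · refine Continuous.aestronglyMeasurable ?_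
        have := hp.continuous
        have := continuous_ev (hermitePoly β)
        fun_prop
      · filter_upwards [eventually_le_atBot 0] with τ hτ
        refine ae_of_all _ fun y => ?_
        rw [norm_mul, Real.norm_eq_abs, Real.norm_eq_abs]
        refine mul_le_mul_of_nonneg_right ?_ (abs_nonneg _)
        rw [abs_mul, abs_of_pos (Real.exp_pos _)]
        have h1 := hC (Real.exp (-τ / 2) • y)
        rw [norm_smul, Real.norm_eq_abs, abs_of_pos (Real.exp_pos _)] at h1
        have h2 : Real.exp (τ / 2) ≤ 1 := Real.exp_le_one_iff.2 (by linarith)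
        have h3 : Real.exp (τ / 2) * Real.exp (-τ / 2) = 1 := by
          rw [← Real.exp_add, ← Real.exp_zero]; congr 1; ring
        calc Real.exp (τ / 2) * |p (Real.exp (-τ / 2) • y)|
            ≤ Real.exp (τ / 2) * (C * (1 + Real.exp (-τ / 2) * ‖y‖)) :=
              mul_le_mul_of_nonneg_left h1 (Real.exp_pos _).le
          _ = C * (Real.exp (τ / 2) + (Real.exp (τ / 2) * Real.exp (-τ / 2)) * ‖y‖) := by ring
          _ ≤ C * (1 + ‖y‖) := by
              rw [h3, one_mul]
              exact mul_le_mul_of_nonneg_left (by linarith) hC0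
      · exact ((((ExpGrowth.const C).mul expGrowth_one_add_norm).mul
          (expGrowth_abs (expGrowth_ev _))).integrable (Continuous.aestronglyMeasurable (by
            have := continuous_ev (hermitePoly β)
            fun_prop)))
      · rw [← zero_mul (ev (hermitePoly β) y)]
        refine Tendsto.mul_const _ ?_
        have hexp : Tendsto (fun τ : ℝ => Real.exp (τ / 2)) atBot (𝓝 0) :=
          Real.tendsto_exp_atBot.comp (tendsto_id.atBot_div_const (by norm_num))
        by_cases hy : y = 0
        · simpa [hy] using hexp.mul_const (p 0)
        · have hcob : Tendsto (fun τ : ℝ => Real.exp (-τ / 2) • y) atBot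
              (Bornology.cobounded E3) := by
            rw [← tendsto_norm_atTop_iff_cobounded]
            simp_rw [norm_smul, Real.norm_eq_abs, abs_of_pos (Real.exp_pos _)]
            refine Tendsto.atTop_mul_const (norm_pos_iff.2 hy) ?_
            exact Real.tendsto_exp_atTop.comp
              (tendsto_neg_atBot_atTop.atTop_div_const (by norm_num))
          have h1 := (ho.comp_tendsto hcob).tendsto_div_nhds_zero
          have h2 := h1.mul_const ‖y‖
          rw [zero_mul] at h2
          refine h2.congr fun τ => ?_
          have hy' := norm_pos_iff.2 hy
          have h3 : Real.exp (τ / 2) = (Real.exp (-τ / 2))⁻¹ := by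
            rw [← Real.exp_neg]; congr 1; ring
          simp only [Function.comp_apply, norm_smul, Real.norm_eq_abs, abs_of_pos (Real.exp_pos _)]
          rw [h3]
          field_simp
    rw [integral_zero] at hlim
    have hlim2 : Tendsto (fun _ : ℝ => ‖∫ y, p y * ev (hermitePoly β) y ∂rhoMeasure‖) atBot
        (𝓝 0) := by
      rw [tendsto_zero_iff_norm_tendsto_zero] at hlim
      refine tendsto_of_tendsto_of_tendsto_of_le_of_le' tendsto_const_nhds hlim
        (Eventually.of_forall fun _ => norm_nonneg _) ?_
      filter_upwards [eventually_le_atBot 0] with τ hτ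
      rw [hconst τ]
      simp_rw [mul_assoc (Real.exp (τ / 2))]
      rw [integral_const_mul, norm_mul, norm_mul]
      refine mul_le_mul_of_nonneg_right ?_ (norm_nonneg _)
      rw [Real.norm_eq_abs, Real.norm_eq_abs, Real.abs_exp, Real.abs_exp, Real.exp_le_exp]
      have : (1 : ℝ) ≤ (∑ i, β i : ℕ) := by exact_mod_cast hk
      nlinarith
    exact norm_eq_zero.1 (tendsto_nhds_unique tendsto_const_nhds hlim2)
  -- `p` minus its Gaussian mean is orthogonal to all Hermite polynomials
  have hpm : MemLp p 2 rhoMeasure := hpg.memLp hp.continuous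
  refine ⟨gaussMass⁻¹ * ∫ y, p y ∂rhoMeasure, ?_⟩
  set c := gaussMass⁻¹ * ∫ y, p y ∂rhoMeasure with hc
  have hgm : MemLp (fun y => p y - c) 2 rhoMeasure := hpm.sub (memLp_const c)
  have hone : ∀ y, ev (hermitePoly 0) y = 1 := fun y => by rw [hermitePoly_zero]; simp [ev]
  have hz := ae_eq_zero_of_orthogonal_polynomials hgm
    (integral_mul_ev_eq_zero_of_hermitePoly hgm fun β => by
      have hsub := integral_sub (hpm.integrable_mul (memLp_ev (hermitePoly β)))
        ((memLp_ev (hermitePoly β)).integrable (by norm_num) |>.const_mul c)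
      simp only [Pi.mul_apply, ← sub_mul] at hsub
      rw [hsub, integral_const_mul]
      by_cases hβ : β = 0
      · have hm : ∫ _, (1 : ℝ) ∂rhoMeasure = gaussMass := rfl
        subst hβ
        simp only [hone, mul_one]
        rw [hm, hc]
        have := gaussMass_pos
        field_simp
        ring
      · have h0 := integral_hermitePoly_mul_of_ne hβ
        simp only [hone, mul_one] at h0
        rw [hmom β hβ, h0]
        ring)
  have hcont : Continuous fun y => p y - c := by have := hp.continuous; fun_prop
  have := (Continuous.ae_eq_iff_eq rhoMeasure hcont continuous_zero).1 hz
  ext y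
  have := congrFun this y
  simp only [Pi.zero_apply] at this
  linarith

end StokesNodal

namespace StokesNodal

/-! ### The velocity solves the heat equation -/

lemma two_le_infty : (2 : WithTop ℕ∞) ≤ ∞ := WithTop.coe_le_coe.2 le_top

lemma pd_pd_comm {f : E3 → ℝ} (hf : ContDiff ℝ ∞ f) (i j : Fin 3) :
    pd i (pd j f) = pd j (pd i f) := by
  ext x
  have hs : IsSymmSndFDerivAt ℝ f x :=
    (hf.contDiffAt).isSymmSndFDerivAt (by simpa using two_le_infty)
  have hd : DifferentiableAt ℝ (fderiv ℝ f) x :=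
    ((hf.fderiv_right (m := ∞) (by simp)).differentiable (by simp)) x
  have h : ∀ i j, pd i (pd j f) x =
      fderiv ℝ (fderiv ℝ f) x (EuclideanSpace.single i 1) (EuclideanSpace.single j 1) := by
    intro i j
    have h1 : HasFDerivAt (pd j f) _ x := hd.hasFDerivAt.clm_apply (hasFDerivAt_const _ x)
    rw [pd, h1.fderiv]
    simp
  rw [h, h, hs]

/-- The time derivative commutes with the space derivatives. -/
lemma pd_deriv_comm {g : ℝ → E3 → ℝ} {S : Set ℝ} (hS : IsOpen S)
    (hg : ContDiffOn ℝ ∞ (fun z : ℝ × E3 => g z.1 z.2) (S ×ˢ Set.univ)) {t : ℝ} (ht : t ∈ S)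
    (i : Fin 3) (x : E3) :
    pd i (fun x => deriv (fun s => g s x) t) x = deriv (fun s => pd i (g s) x) t := by
  have hopen : IsOpen (S ×ˢ (Set.univ : Set E3)) := hS.prod isOpen_univ
  set G : ℝ × E3 → ℝ := fun z => g z.1 z.2 with hG
  have hat : ∀ s ∈ S, ∀ x, ContDiffAt ℝ ∞ G (s, x) := fun s hs x =>
    hg.contDiffAt (hopen.mem_nhds ⟨hs, trivial⟩)
  have hF : ∀ s ∈ S, ∀ x, HasFDerivAt G (fderiv ℝ G (s, x)) (s, x) := fun s hs x =>
    ((hat s hs x).differentiableAt (by simp)).hasFDerivAt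
  have h1 : ∀ s ∈ S, ∀ x, deriv (fun s => g s x) s = fderiv ℝ G (s, x) (1, 0) := by
    intro s hs x
    have h2 : HasDerivAt (fun s : ℝ => ((s, x) : ℝ × E3)) (1, 0) s :=
      (hasDerivAt_id s).prodMk (hasDerivAt_const s x)
    exact ((hF s hs x).comp_hasDerivAt s h2).deriv
  have h2 : ∀ s ∈ S, ∀ x, pd i (g s) x = fderiv ℝ G (s, x) (0, EuclideanSpace.single i 1) := by
    intro s hs x
    have h2 : HasFDerivAt (fun x : E3 => ((s, x) : ℝ × E3)) (ContinuousLinearMap.inr ℝ ℝ E3) x :=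
      hasFDerivAt_prodMk_right s x
    have h3 : HasFDerivAt (g s) _ x := (hF s hs x).comp x h2
    rw [pd, h3.fderiv]
    simp
  have hsymm : IsSymmSndFDerivAt ℝ G (t, x) :=
    (hat t ht x).isSymmSndFDerivAt (by simpa using two_le_infty)
  have hd : HasFDerivAt (fderiv ℝ G) (fderiv ℝ (fderiv ℝ G) (t, x)) (t, x) :=
    (((hat t ht x).fderiv_right (m := ∞) (by simp)).differentiableAt (by simp)).hasFDerivAt
  have hl : pd i (fun x => deriv (fun s => g s x) t) x =
      fderiv ℝ (fderiv ℝ G) (t, x) (0, EuclideanSpace.single i 1) (1, 0) := by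
    have e : (fun x => deriv (fun s => g s x) t) = fun x => fderiv ℝ G (t, x) (1, 0) :=
      funext fun x => h1 t ht x
    have h3 : HasFDerivAt (fun x : E3 => fderiv ℝ G (t, x)) _ x :=
      hd.comp x (hasFDerivAt_prodMk_right t x)
    have h4 := h3.clm_apply (hasFDerivAt_const ((1, 0) : ℝ × E3) x)
    rw [pd, e, h4.fderiv]
    simp
  have hr : deriv (fun s => pd i (g s) x) t =
      fderiv ℝ (fderiv ℝ G) (t, x) (1, 0) (0, EuclideanSpace.single i 1) := by
    have e : (fun s => pd i (g s) x) =ᶠ[𝓝 t]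
        fun s => fderiv ℝ G (s, x) (0, EuclideanSpace.single i 1) := by
      filter_upwards [hS.mem_nhds ht] with s hs
      exact h2 s hs x
    have hc : HasDerivAt (fun s : ℝ => ((s, x) : ℝ × E3)) (1, 0) t :=
      (hasDerivAt_id t).prodMk (hasDerivAt_const t x)
    have h3 : HasDerivAt (fun s : ℝ => fderiv ℝ G (s, x)) _ t := hd.comp_hasDerivAt t hc
    have h4 := h3.clm_apply (hasDerivAt_const t ((0, EuclideanSpace.single i 1) : ℝ × E3))
    rw [e.deriv_eq, h4.deriv]
    simp
  rw [hl, hr, hsymm]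

lemma laplacian_eq_sum_pd {f : E3 → ℝ} (hf : ContDiff ℝ ∞ f) (x : E3) :
    Laplacian.laplacian f x = ∑ i, pd i (pd i f) x := by
  have := congrFun (InnerProductSpace.laplacian_eq_iteratedFDeriv_orthonormalBasis f
    (EuclideanSpace.basisFun (Fin 3) ℝ)) x
  rw [this]
  refine Finset.sum_congr rfl fun i _ => ?_
  have hd : DifferentiableAt ℝ (fderiv ℝ f) x :=
    ((hf.fderiv_right (m := ∞) (by simp)).differentiable (by simp)) x
  have h1 : HasFDerivAt (pd i f) _ x := hd.hasFDerivAt.clm_apply (hasFDerivAt_const _ x)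
  rw [iteratedFDeriv_two_apply, pd, h1.fderiv]
  simp

lemma gradient_apply (f : E3 → ℝ) (x : E3) (i : Fin 3) : gradient f x i = pd i f x := by
  have h : inner ℝ (gradient f x) (EuclideanSpace.single i 1) = pd i f x := by
    rw [gradient, InnerProductSpace.toDual_symm_apply]; rfl
  rw [← h, EuclideanSpace.inner_single_right]
  simp

variable {u₀ : E3 → E3} {u : ℝ → E3 → E3} {p : ℝ → E3 → ℝ}

lemma IsBoundedStokesSolution.component_smooth (hu : IsBoundedStokesSolution u₀ u p) (i : Fin 3) :
    ContDiffOn ℝ ∞ (fun z : ℝ × E3 => u z.1 z.2 i) (Set.Ioo (-1) 0 ×ˢ Set.univ) :=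
  (EuclideanSpace.proj i : E3 →L[ℝ] ℝ).contDiff.comp_contDiffOn hu.smooth_velocity

lemma contDiff_slice {F : Type*} [NormedAddCommGroup F] [NormedSpace ℝ F] {g : ℝ → E3 → F}
    {S : Set ℝ} (hg : ContDiffOn ℝ ∞ (fun z : ℝ × E3 => g z.1 z.2) (S ×ˢ Set.univ)) {t : ℝ}
    (ht : t ∈ S) : ContDiff ℝ ∞ (g t) :=
  contDiffOn_univ.1 (hg.comp (f := fun y : E3 => ((t, y) : ℝ × E3))
    (by fun_prop) (fun _ _ => ⟨ht, trivial⟩))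

lemma IsBoundedStokesSolution.momentum_apply (hu : IsBoundedStokesSolution u₀ u p) {t : ℝ}
    (ht : t ∈ Set.Ioo (-1 : ℝ) 0) (x : E3) (i : Fin 3) :
    deriv (fun s => u s x i) t = -pd i (p t) x + ∑ j, pd j (pd j fun x => u t x i) x := by
  have hopen : IsOpen (Set.Ioo (-1 : ℝ) 0 ×ˢ (Set.univ : Set E3)) := isOpen_Ioo.prod isOpen_univ
  have hut : ContDiff ℝ ∞ (u t) := contDiff_slice hu.smooth_velocity ht
  have hc : HasDerivAt (fun s : ℝ => ((s, x) : ℝ × E3)) (1, 0) t :=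
    (hasDerivAt_id t).prodMk (hasDerivAt_const t x)
  have hd : DifferentiableAt ℝ (fun s => u s x) t :=
    (((hu.smooth_velocity.contDiffAt (hopen.mem_nhds ⟨ht, trivial⟩)).differentiableAt
      (by simp)).hasFDerivAt.comp_hasDerivAt t hc).differentiableAt
  have h1 : HasDerivAt (fun s => u s x i) ((deriv (fun s => u s x) t) i) t :=
    (EuclideanSpace.proj i : E3 →L[ℝ] ℝ).hasFDerivAt.comp_hasDerivAt t hd.hasDerivAt
  rw [h1.deriv, hu.momentum t ht x, PiLp.add_apply, PiLp.neg_apply, gradient_apply]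
  congr 1
  have hlap := (hut.contDiffAt (x := x)).of_le (m := 2) two_le_infty |>.laplacian_CLM_comp_left
    (l := (EuclideanSpace.proj i : E3 →L[ℝ] ℝ))
  have h2 : ContDiff ℝ ∞ fun x => u t x i := by fun_prop
  rw [← laplacian_eq_sum_pd h2]
  exact hlap.symm

lemma pd_sum {κ : Type*} (s : Finset κ) (i : Fin 3) {f : κ → E3 → ℝ}
    (hf : ∀ k, Differentiable ℝ (f k)) (x : E3) :
    pd i (fun x => ∑ k ∈ s, f k x) x = ∑ k ∈ s, pd i (f k) x := by
  rw [pd, fderiv_fun_sum fun k _ => hf k x]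
  simp [pd]

lemma IsBoundedStokesSolution.sum_pd_eq_zero (hu : IsBoundedStokesSolution u₀ u p) {t : ℝ}
    (ht : t ∈ Set.Ioo (-1 : ℝ) 0) (x : E3) : ∑ i, pd i (fun x => u t x i) x = 0 := by
  rw [← hu.incompressible t ht x, divergence]
  exact Finset.sum_congr rfl fun i _ =>
    pd_component ((contDiff_slice hu.smooth_velocity ht).differentiable (by simp)) i i x

/-- The pressure is harmonic: take the divergence of the momentum equation. -/
lemma IsBoundedStokesSolution.pressure_harmonic (hu : IsBoundedStokesSolution u₀ u p) {t : ℝ}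
    (ht : t ∈ Set.Ioo (-1 : ℝ) 0) (x : E3) : ∑ i, pd i (pd i (p t)) x = 0 := by
  have hp : ContDiff ℝ ∞ (p t) := contDiff_slice hu.smooth_pressure ht
  have hui : ∀ i, ContDiff ℝ ∞ fun x => u t x i := fun i =>
    contDiff_slice (g := fun t x => u t x i) (hu.component_smooth i) ht
  have hpd : ∀ {f : E3 → ℝ}, ContDiff ℝ ∞ f → ∀ i, ContDiff ℝ ∞ (pd i f) := fun hf i =>
    contDiff_pd (by simpa using hf) i
  have hdf : ∀ {f : E3 → ℝ}, ContDiff ℝ ∞ f → Differentiable ℝ f := fun hf =>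
    hf.differentiable (by simp)
  have hdiv : ∀ s ∈ Set.Ioo (-1 : ℝ) 0, ∀ x, ∑ i, pd i (fun x => u s x i) x = 0 :=
    fun s hs x => hu.sum_pd_eq_zero hs x
  -- the time derivative of the divergence vanishes
  have htime : ∑ i, pd i (fun x => deriv (fun s => u s x i) t) x = 0 := by
    simp_rw [fun i => pd_deriv_comm (g := fun s x => u s x i) isOpen_Ioo
      (hu.component_smooth i) ht i x]
    have hdiff : ∀ i, DifferentiableAt ℝ (fun s => pd i (fun x => u s x i) x) t := by
      intro i
      have hopen : IsOpen (Set.Ioo (-1 : ℝ) 0 ×ˢ (Set.univ : Set E3)) :=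
        isOpen_Ioo.prod isOpen_univ
      have hat : ∀ s ∈ Set.Ioo (-1 : ℝ) 0,
          ContDiffAt ℝ ∞ (fun z : ℝ × E3 => u z.1 z.2 i) (s, x) :=
        fun s hs => (hu.component_smooth i).contDiffAt (hopen.mem_nhds ⟨hs, trivial⟩)
      have e : (fun s => pd i (fun x => u s x i) x) =ᶠ[𝓝 t] fun s =>
          fderiv ℝ (fun z : ℝ × E3 => u z.1 z.2 i) (s, x) (0, EuclideanSpace.single i 1) := by
        filter_upwards [isOpen_Ioo.mem_nhds ht] with s hs
        have h3 : HasFDerivAt (fun x => u s x i) _ x :=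
          ((hat s hs).differentiableAt (by simp)).hasFDerivAt.comp x
            (hasFDerivAt_prodMk_right s x)
        rw [pd, h3.fderiv]
        simp
      rw [e.differentiableAt_iff]
      have hd := ((hat t ht).fderiv_right (m := ∞) (by simp)).differentiableAt (by simp)
      have hc : DifferentiableAt ℝ (fun s : ℝ => ((s, x) : ℝ × E3)) t := by fun_prop
      exact (DifferentiableAt.comp t hd hc).clm_apply (differentiableAt_const _)
    rw [← deriv_fun_sum fun i _ => hdiff i]
    have e : (fun s => ∑ i, pd i (fun x => u s x i) x) =ᶠ[𝓝 t] fun _ => 0 := by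
      filter_upwards [isOpen_Ioo.mem_nhds ht] with s hs
      exact hdiv s hs x
    rw [e.deriv_eq]
    simp
  -- the Laplacian of a solenoidal field is solenoidal
  have hspace : ∑ i, pd i (fun x => ∑ j, pd j (pd j fun x => u t x i) x) x = 0 := by
    have h1 : ∀ i, pd i (fun x => ∑ j, pd j (pd j fun x => u t x i) x) x =
        ∑ j, pd j (pd j (pd i fun x => u t x i)) x := by
      intro i
      rw [pd_sum _ _ fun j => hdf (hpd (hpd (hui i) j) j)]
      refine Finset.sum_congr rfl fun j _ => ?_
      rw [pd_pd_comm (hpd (hui i) j), pd_pd_comm (hui i)]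
    simp_rw [h1]
    rw [Finset.sum_comm]
    refine Finset.sum_eq_zero fun j _ => ?_
    have h2 : pd j (fun x => ∑ i, pd i (fun x => u t x i) x) =
        fun x => ∑ i, pd j (pd i fun x => u t x i) x :=
      funext fun x => pd_sum _ _ (fun i => hdf (hpd (hui i) i)) x
    rw [← pd_sum _ _ fun i => hdf (hpd (hpd (hui i) i) j), ← h2]
    simp_rw [hdiv t ht]
    rw [funext (pd_const j 0), pd_const]
  have hmom : ∀ i, pd i (fun x => deriv (fun s => u s x i) t) x = -pd i (pd i (p t)) x +
      pd i (fun x => ∑ j, pd j (pd j fun x => u t x i) x) x := by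
    intro i
    simp_rw [fun x => hu.momentum_apply ht x i]
    have hneg : (fun x => -pd i (p t) x) = fun x => (-1 : ℝ) * pd i (p t) x := by ext; ring
    rw [pd_add (f := fun x => -pd i (p t) x), hneg, pd_const_mul _ _ (hdf (hpd hp i))]
    · ring
    · exact (hdf (hpd hp i) x).neg
    · exact DifferentiableAt.fun_sum fun j _ => hdf (hpd (hpd (hui i) j) j) x
  simp_rw [hmom] at htime
  rw [Finset.sum_add_distrib, hspace, Finset.sum_neg_distrib] at htime
  linarith

/-- The pressure is constant in space, so each velocity component solves the heat equation. -/
lemma IsBoundedStokesSolution.heat (hu : IsBoundedStokesSolution u₀ u p) (i : Fin 3) {t : ℝ}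
    (ht : t ∈ Set.Ioo (-1 : ℝ) 0) (x : E3) :
    deriv (fun s => u s x i) t = ∑ j, pd j (pd j fun x => u t x i) x := by
  obtain ⟨c, hc⟩ := const_of_harmonic_of_isLittleO (contDiff_slice hu.smooth_pressure ht)
    (hu.pressure_harmonic ht) (hu.pressure_sublinear t ht)
  rw [hu.momentum_apply ht x i, hc, pd_const]
  ring

/-! ### Hermite coefficients of the rescaled velocity -/

lemma leray_apply (u : ℝ → E3 → E3) (τ : ℝ) (y : E3) (i : Fin 3) :
    leray u τ y i = Real.exp (-τ / 2) * selfSimilar (fun t x => u t x i) τ y := by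
  simp [leray, selfSimilar, Real.exp_half]

lemma neg_exp_mem_Icc {τ : ℝ} (hτ : 0 ≤ τ) : -Real.exp (-τ) ∈ Set.Icc (-1 : ℝ) 0 := by
  constructor
  · rw [neg_le_neg_iff, Real.exp_le_one_iff]; linarith
  · simpa using (Real.exp_pos (-τ)).le

lemma IsBoundedStokesSolution.continuous_leray (hu : IsBoundedStokesSolution u₀ u p) {τ : ℝ}
    (hτ : 0 ≤ τ) : Continuous (leray u τ) := by
  have h : Continuous fun x => u (-Real.exp (-τ)) x :=
    continuousOn_univ.1 (hu.continuous_velocity.comp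
      (f := fun y : E3 => ((-Real.exp (-τ), y) : ℝ × E3)) (by fun_prop)
      (fun _ _ => ⟨neg_exp_mem_Icc hτ, trivial⟩))
  unfold leray
  fun_prop

lemma IsBoundedStokesSolution.continuous_leray_apply (hu : IsBoundedStokesSolution u₀ u p) {τ : ℝ}
    (hτ : 0 ≤ τ) (i : Fin 3) : Continuous fun y => leray u τ y i :=
  (EuclideanSpace.proj i : E3 →L[ℝ] ℝ).continuous.comp (hu.continuous_leray hτ)

lemma IsBoundedStokesSolution.memLp_leray (hu : IsBoundedStokesSolution u₀ u p) {τ : ℝ}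
    (hτ : 0 ≤ τ) : MemLp (leray u τ) 2 rhoMeasure := by
  obtain ⟨M, hM⟩ := hu.bounded
  refine MemLp.of_bound (hu.continuous_leray hτ).aestronglyMeasurable
    (Real.sqrt (Real.exp (-τ)) * M) (ae_of_all _ fun y => ?_)
  rw [leray, norm_smul, Real.norm_eq_abs, abs_of_nonneg (Real.sqrt_nonneg _)]
  exact mul_le_mul_of_nonneg_left (hM _ (neg_exp_mem_Icc hτ) _) (Real.sqrt_nonneg _)

lemma IsBoundedStokesSolution.memLp_leray_apply (hu : IsBoundedStokesSolution u₀ u p) {τ : ℝ}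
    (hτ : 0 ≤ τ) (i : Fin 3) : MemLp (fun y => leray u τ y i) 2 rhoMeasure :=
  (hu.memLp_leray hτ).norm.mono' (hu.continuous_leray_apply hτ i).aestronglyMeasurable
    (ae_of_all _ fun _ => PiLp.norm_apply_le _ i)

/-- The coefficients of the rescaled velocity decay exactly exponentially. -/
lemma IsBoundedStokesSolution.hermiteCoef_leray (hu : IsBoundedStokesSolution u₀ u p) (i : Fin 3)
    (β : Fin 3 → ℕ) {τ : ℝ} (hτ : 0 ≤ τ) :
    hermiteCoef (fun y => leray u τ y i) β =
      Real.exp (-((1 + (∑ j, β j : ℕ)) * τ / 2)) * hermiteCoef (fun y => leray u 0 y i) β := by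
  obtain ⟨M, hM⟩ := hu.bounded
  have hM0 : 0 ≤ M := (norm_nonneg _).trans (hM 0 (by simp) 0)
  have hUM : ∀ t ∈ Set.Icc (-1 : ℝ) 0, ∀ x, |u t x i| ≤ M := fun t ht x =>
    (PiLp.norm_apply_le (u t x) i).trans (hM t ht x)
  let I : ℝ → ℝ := fun τ => ∫ y, selfSimilar (fun t x => u t x i) τ y * ev (hermitePoly β) y
    ∂rhoMeasure
  have hpos : ∀ s t : ℝ, 0 < s → 0 < t → Real.exp ((∑ i, β i : ℕ) * s / 2) * I s =
      Real.exp ((∑ i, β i : ℕ) * t / 2) * I t := fun s t hs ht =>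
    selfSimilar_moment (U := fun t x => u t x i) (T := -1) (a := 0) (C := M)
      (hu.component_smooth i) (fun t ht x => hu.heat i ht x) (by simp)
      (fun t ht x => (hUM t (Set.Ioo_subset_Icc_self ht) x).trans
        (le_mul_of_one_le_right hM0 (by linarith [norm_nonneg x]))) β hs ht
  -- the equation holds only for `τ > 0`; the moments are continuous up to `τ = 0`
  have hcont : ContinuousWithinAt I (Set.Ici 0) 0 := by
    refine tendsto_integral_filter_of_dominated_convergence
      (fun y => M * |ev (hermitePoly β) y|) ?_ ?_ ?_ (ae_of_all _ fun y => ?_)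
    · filter_upwards [self_mem_nhdsWithin] with s hs
      have h1 := hu.continuous_leray_apply hs i
      have h2 : selfSimilar (fun t x => u t x i) s = fun y => Real.exp (s / 2) * leray u s y i := by
        ext y
        rw [leray_apply, ← mul_assoc, ← Real.exp_add]
        ring_nf
        simp
      rw [h2]
      exact ((continuous_const.mul h1).mul (continuous_ev _)).aestronglyMeasurable
    · filter_upwards [self_mem_nhdsWithin] with s hs
      refine ae_of_all _ fun y => ?_
      rw [norm_mul, Real.norm_eq_abs, Real.norm_eq_abs]
      exact mul_le_mul_of_nonneg_right (hUM _ (neg_exp_mem_Icc hs) _) (abs_nonneg _)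
    · exact ((expGrowth_ev _).integrable (continuous_ev _).aestronglyMeasurable).norm.const_mul M
    · refine Tendsto.mul_const _ ?_
      have h1 : ContinuousOn (fun s : ℝ => u (-Real.exp (-s)) (Real.exp (-s / 2) • y))
          (Set.Ici 0) :=
        hu.continuous_velocity.comp
          (f := fun s : ℝ => ((-Real.exp (-s), Real.exp (-s / 2) • y) : ℝ × E3))
          (by fun_prop) (fun s hs => ⟨neg_exp_mem_Icc hs, trivial⟩)
      have h2 := (h1 0 (by simp))
      exact ((EuclideanSpace.proj i : E3 →L[ℝ] ℝ).continuous.tendsto _).comp h2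
  have hzero : ∀ t : ℝ, 0 < t → I 0 = Real.exp ((∑ i, β i : ℕ) * t / 2) * I t := by
    intro t ht
    have h1 : Tendsto (fun s : ℝ => Real.exp ((∑ i, β i : ℕ) * s / 2) * I s) (𝓝[>] 0)
        (𝓝 (Real.exp ((∑ i, β i : ℕ) * 0 / 2) * I 0)) := by
      refine Tendsto.mul ?_ (hcont.mono_left (nhdsWithin_mono _ Set.Ioi_subset_Ici_self))
      have : Continuous fun s : ℝ => Real.exp ((∑ i, β i : ℕ) * s / 2) := by fun_prop
      exact (this.tendsto 0).mono_left nhdsWithin_le_nhds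
    have h2 : Tendsto (fun s : ℝ => Real.exp ((∑ i, β i : ℕ) * s / 2) * I s) (𝓝[>] 0)
        (𝓝 (Real.exp ((∑ i, β i : ℕ) * t / 2) * I t)) := by
      refine tendsto_const_nhds.congr' ?_
      filter_upwards [self_mem_nhdsWithin] with s hs
      exact hpos t s ht hs
    simpa using tendsto_nhds_unique h1 h2
  have hI : ∀ s, hermiteCoef (fun y => leray u s y i) β =
      gaussMass⁻¹ * (Real.exp (-s / 2) * I s) := by
    intro s
    rw [hermiteCoef]
    simp_rw [leray_apply, mul_assoc]
    rw [integral_const_mul]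
  rw [hI, hI]
  rcases hτ.eq_or_lt with rfl | h
  · simp
  · rw [hzero τ h]
    have : Real.exp (-τ / 2) = Real.exp (-((1 + (∑ j, β j : ℕ)) * τ / 2)) *
        Real.exp ((∑ i, β i : ℕ) * τ / 2) := by
      rw [← Real.exp_add]; congr 1; ring
    rw [this]
    simp
    ring

end StokesNodal

namespace StokesNodal

/-! ### Uniqueness of Hermite expansions -/

lemma integrable_ev_mul_ev (p q : MvPolynomial (Fin 3) ℝ) :
    Integrable (fun y => ev p y * ev q y) rhoMeasure :=
  (memLp_ev p).integrable_mul (memLp_ev q)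

lemma inner_evLp (p q : MvPolynomial (Fin 3) ℝ) :
    inner ℝ (evLp p) (evLp q) = ∫ y, ev p y * ev q y ∂rhoMeasure :=
  inner_toLp (memLp_ev p) (memLp_ev q)

lemma evLp_injective : Function.Injective evLp := by
  rw [← LinearMap.ker_eq_bot, LinearMap.ker_eq_bot']
  intro p hp
  have h1 : ev p =ᵐ[rhoMeasure] 0 := (Lp.eq_zero_iff_ae_eq_zero.1 hp).symm.trans
    (MemLp.coeFn_toLp (memLp_ev p)) |>.symm
  have h2 := (Continuous.ae_eq_iff_eq rhoMeasure (continuous_ev p) continuous_zero).1 h1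
  refine ev_injective (h2.trans ?_)
  ext y
  simp [ev]

lemma inner_evLp_eq_zero {k l : ℕ} (hkl : k ≠ l) {p q : MvPolynomial (Fin 3) ℝ}
    (hp : p ∈ hermiteSpace k) (hq : q ∈ hermiteSpace l) : inner ℝ (evLp p) (evLp q) = 0 := by
  induction hp using Submodule.span_induction with
  | mem x hx =>
    obtain ⟨β, hβ, rfl⟩ := hx
    induction hq using Submodule.span_induction with
    | mem x hx =>
      obtain ⟨γ, hγ, rfl⟩ := hx
      rw [inner_evLp]
      refine integral_hermitePoly_mul_of_ne fun h => hkl ?_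
      rw [← show ∑ i, β i = k from hβ, ← show ∑ i, γ i = l from hγ, h]
    | zero => simp
    | add x y _ _ hx hy => rw [map_add, inner_add_right, hx, hy, add_zero]
    | smul a x _ hx => rw [map_smul, inner_smul_right, hx, mul_zero]
  | zero => simp
  | add x y _ _ hx hy => rw [map_add, inner_add_left, hx, hy, add_zero]
  | smul a x _ hx => rw [map_smul, inner_smul_left, hx, mul_zero]

/-- The levels of an `L²` expansion are determined by the function: the difference of two
expansions tends to zero, and its levels are mutually orthogonal. -/
lemma eq_levelPoly_of_tendsto {f : E3 → ℝ} (hf : MemLp f 2 rhoMeasure)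
    {q : ℕ → MvPolynomial (Fin 3) ℝ} (hq : ∀ k, q k ∈ hermiteSpace k)
    (h : Tendsto (fun n : ℕ => eLpNorm (fun y => f y - ev (∑ k ∈ Finset.range n, q k) y) 2
      rhoMeasure) atTop (𝓝 0)) (m : ℕ) : q m = levelPoly f m := by
  have h1 : Tendsto (fun n : ℕ => evLp (∑ k ∈ Finset.range n, q k)) atTop (𝓝 (hf.toLp f)) := by
    simp only [evLp, LinearMap.coe_mk, AddHom.coe_mk]
    rw [Lp.tendsto_Lp_iff_tendsto_eLpNorm'']
    refine h.congr fun n => ?_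
    rw [← eLpNorm_neg]
    congr 1
    ext y
    simp
  have h2 := h1.sub (tendsto_sum_toLp hf)
  simp_rw [← map_sub, ← Finset.sum_sub_distrib, sub_self] at h2
  set r : ℕ → MvPolynomial (Fin 3) ℝ := fun k => q k - levelPoly f k with hr
  have hrm : ∀ k, r k ∈ hermiteSpace k := fun k => Submodule.sub_mem _ (hq k) (levelPoly_mem f k)
  have h3 : Tendsto (fun n : ℕ => inner ℝ (evLp (r m)) (evLp (∑ k ∈ Finset.range n, r k))) atTop
      (𝓝 (inner ℝ (evLp (r m)) 0)) :=
    tendsto_const_nhds.inner h2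
  have h4 : Tendsto (fun n : ℕ => inner ℝ (evLp (r m)) (evLp (∑ k ∈ Finset.range n, r k))) atTop
      (𝓝 (inner ℝ (evLp (r m)) (evLp (r m)))) := by
    refine tendsto_const_nhds.congr' ?_
    filter_upwards [eventually_gt_atTop m] with n hn
    rw [map_sum, inner_sum, Finset.sum_eq_single_of_mem m (Finset.mem_range.2 hn)]
    intro k _ hk
    exact inner_evLp_eq_zero hk.symm (hrm m) (hrm k)
  have h5 := tendsto_nhds_unique h4 h3
  rw [inner_zero_right, inner_self_eq_zero] at h5
  have h6 : r m = 0 := evLp_injective (by rw [h5, map_zero])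
  exact sub_eq_zero.1 h6

/-! ### Locally uniform convergence of Hermite expansions -/

lemma card_degLevel_le (k : ℕ) : (degLevel k).card ≤ (k + 1) ^ 3 := by
  have : degLevel k ⊆ Fintype.piFinset fun _ : Fin 3 => Finset.range (k + 1) := by
    intro β hβ
    rw [Fintype.mem_piFinset]
    intro i
    have h1 := mem_degLevel.1 hβ
    have h2 := Finset.single_le_sum (f := β) (fun i _ => Nat.zero_le _) (Finset.mem_univ i)
    rw [Finset.mem_range]
    omega
  refine (Finset.card_le_card this).trans ?_
  simp

/-- On a ball the levels of an `L²` function grow more slowly than `r ^ k` for every `r > 1`, by a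
summable factor. -/
lemma exists_levelPoly_bound {f : E3 → ℝ} (hf : MemLp f 2 rhoMeasure) {M r : ℝ} (hM : 0 ≤ M)
    (hr : 1 < r) : ∃ B : ℕ → ℝ, Summable B ∧ (∀ k, 0 ≤ B k) ∧ ∀ k y, ‖y‖ ≤ M →
      |ev (levelPoly f k) y| ≤ r ^ k * B k := by
  obtain ⟨D, hD, hD'⟩ := exists_hermiteCoef_bound hf
  have hs : 1 < Real.sqrt r := by rw [Real.lt_sqrt zero_le_one]; simpa using hr
  have hs0 : 0 < Real.sqrt r := by linarith
  obtain ⟨C, hC, hC'⟩ := exists_hermitePoly_bound hM hs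
  refine ⟨fun k => D * C * (((k : ℝ) + 1) ^ 3 * (Real.sqrt r)⁻¹ ^ k), ?_, fun k => by positivity,
    fun k y hy => ?_⟩
  · refine Summable.mul_left _ ?_
    have h1 : Summable fun k : ℕ => ((k : ℝ) ^ 3 * (Real.sqrt r)⁻¹ ^ k) :=
      summable_pow_mul_geometric_of_norm_lt_one 3 (by
        rw [Real.norm_eq_abs, abs_of_pos (by positivity)]
        exact inv_lt_one_of_one_lt₀ hs)
    have h2 := ((summable_nat_add_iff 1).2 h1).mul_right (Real.sqrt r)
    refine h2.congr fun k => ?_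
    push_cast
    rw [pow_succ (Real.sqrt r)⁻¹]
    field_simp
  · rw [ev_levelPoly]
    calc |∑ β ∈ degLevel k, hermiteCoef f β * ev (hermitePoly β) y|
        ≤ ∑ β ∈ degLevel k, |hermiteCoef f β * ev (hermitePoly β) y| :=
          Finset.abs_sum_le_sum_abs _ _
      _ ≤ ∑ β ∈ degLevel k, D * (C * Real.sqrt r ^ k) := by
          refine Finset.sum_le_sum fun β hβ => ?_
          rw [abs_mul]
          have := hC' y hy β
          rw [mem_degLevel.1 hβ] at this
          exact mul_le_mul (hD' β) this (abs_nonneg _) hD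
      _ = (degLevel k).card * (D * (C * Real.sqrt r ^ k)) := by
          rw [Finset.sum_const, nsmul_eq_mul]
      _ ≤ ((k : ℝ) + 1) ^ 3 * (D * (C * Real.sqrt r ^ k)) := by
          refine mul_le_mul_of_nonneg_right ?_ (by positivity)
          exact_mod_cast card_degLevel_le k
      _ = r ^ k * (D * C * (((k : ℝ) + 1) ^ 3 * (Real.sqrt r)⁻¹ ^ k)) := by
          have h2 : r ^ k = Real.sqrt r ^ k * Real.sqrt r ^ k := by
            rw [← mul_pow, Real.mul_self_sqrt (by linarith)]
          have h3 : Real.sqrt r ^ k * (Real.sqrt r)⁻¹ ^ k = 1 := by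
            rw [← mul_pow, mul_inv_cancel₀ hs0.ne', one_pow]
          rw [h2]
          linear_combination (-(D * C * ((k : ℝ) + 1) ^ 3 * Real.sqrt r ^ k)) * h3

/-- If the Hermite expansion of a continuous function is dominated on every ball by a summable
sequence, it converges to the function pointwise and locally uniformly. -/
lemma hasSum_levelPoly {f : E3 → ℝ} (hf : MemLp f 2 rhoMeasure) (hfc : Continuous f)
    (hB : ∀ M : ℝ, 0 ≤ M → ∃ B : ℕ → ℝ, Summable B ∧ ∀ k y, ‖y‖ ≤ M →
      |ev (levelPoly f k) y| ≤ B k) :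
    (∀ y, HasSum (fun k => ev (levelPoly f k) y) (f y)) ∧
      ∀ K : Set E3, IsCompact K → TendstoUniformlyOn
        (fun (n : ℕ) y => ev (∑ k ∈ Finset.range n, levelPoly f k) y) f atTop K := by
  have hunif : ∀ M : ℝ, 0 ≤ M → TendstoUniformlyOn
      (fun (n : ℕ) y => ∑ k ∈ Finset.range n, ev (levelPoly f k) y)
      (fun y => ∑' k, ev (levelPoly f k) y) atTop (Metric.closedBall 0 M) := by
    intro M hM
    obtain ⟨B, hBs, hB'⟩ := hB M hM
    exact tendstoUniformlyOn_tsum_nat hBs fun k y hy => hB' k y (by simpa using hy)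
  have hsum : ∀ y, Summable fun k => ev (levelPoly f k) y := by
    intro y
    obtain ⟨B, hBs, hB'⟩ := hB ‖y‖ (norm_nonneg _)
    exact Summable.of_norm_bounded hBs fun k => hB' k y le_rfl
  have hcont : Continuous fun y => ∑' k, ev (levelPoly f k) y := by
    rw [continuous_iff_continuousAt]
    intro y
    have h1 : ContinuousOn (fun y => ∑' k, ev (levelPoly f k) y) (Metric.closedBall 0 (‖y‖ + 1)) :=
      (hunif (‖y‖ + 1) (by positivity)).continuousOn (Eventually.of_forall fun n =>
        (continuous_finsetSum _ fun k _ => continuous_ev _).continuousOn).frequently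
    refine h1.continuousAt (Filter.mem_of_superset (Metric.ball_mem_nhds y one_pos) ?_)
    intro z hz
    rw [mem_closedBall_zero_iff]
    have : ‖z‖ ≤ ‖y‖ + ‖z - y‖ := by
      have := norm_add_le y (z - y)
      rwa [add_sub_cancel] at this
    have h2 : ‖z - y‖ < 1 := by rwa [mem_ball_iff_norm] at hz
    linarith
  -- a subsequence of the partial sums converges to `f` almost everywhere
  have heq : f = fun y => ∑' k, ev (levelPoly f k) y := by
    refine (Continuous.ae_eq_iff_eq rhoMeasure hfc hcont).1 ?_
    have hm := tendstoInMeasure_of_tendsto_eLpNorm (p := 2) (μ := rhoMeasure)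
      (f := fun (n : ℕ) y => ev (∑ k ∈ Finset.range n, levelPoly f k) y) (g := f) (l := atTop)
      (by norm_num) (fun n => (continuous_ev _).aestronglyMeasurable)
      hfc.aestronglyMeasurable (by
        refine (tendsto_eLpNorm_sub_levelPoly hf).congr fun n => ?_
        rw [← eLpNorm_neg]
        congr 1
        ext y
        simp)
    obtain ⟨ns, hns, hae⟩ := hm.exists_seq_tendsto_ae
    filter_upwards [hae] with y hy
    refine tendsto_nhds_unique hy ?_
    have := (hsum y).hasSum.tendsto_sum_nat.comp hns.tendsto_atTop
    refine this.congr fun n => ?_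
    simp only [Function.comp_apply, ev_sum]
  refine ⟨fun y => ?_, fun K hK => ?_⟩
  · have := (hsum y).hasSum
    rwa [← congrFun heq y] at this
  · obtain ⟨M, hM⟩ := hK.isBounded.subset_closedBall 0
    have h1 := (hunif (max M 0) (le_max_right _ _)).mono
      (hM.trans (Metric.closedBall_subset_closedBall (le_max_left _ _)))
    rw [← heq] at h1
    simpa only [ev_sum] using h1

/-- The leading term of an exponentially weighted series as `τ → ∞`. -/
lemma tendstoUniformlyOn_leading {K : Set E3} {f : ℝ → E3 → ℝ} {g : ℕ → E3 → ℝ} {B : ℕ → ℝ}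
    (hB : Summable B) (hB0 : ∀ j, 0 ≤ B j)
    (hg : ∀ j, ∀ y ∈ K, |g j y| ≤ Real.exp (1 / 2) ^ j * B j)
    (hf : ∀ τ > 0, ∀ y ∈ K,
      HasSum (fun j : ℕ => Real.exp (-((1 + (j : ℝ)) * τ / 2)) * g j y) (f τ y))
    {k : ℕ} (hk : ∀ l < k, ∀ y ∈ K, g l y = 0) :
    TendstoUniformlyOn (fun τ y => Real.exp ((1 + (k : ℝ)) * τ / 2) * f τ y) (g k) atTop K := by
  -- for `j > k` and `τ ≥ 1`, `(k - j) τ / 2 + j / 2 ≤ k / 2 - (τ - 1) / 2`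
  have hlim : Tendsto (fun τ : ℝ => Real.exp ((k : ℝ) / 2) * Real.exp (-((τ - 1) / 2)) *
      ∑' j, B j) atTop (𝓝 0) := by
    have h1 : Tendsto (fun τ : ℝ => Real.exp (-((τ - 1) / 2))) atTop (𝓝 0) :=
      Real.tendsto_exp_neg_atTop_nhds_zero.comp
        ((tendsto_atTop_add_const_right _ (-1) tendsto_id).atTop_div_const (by norm_num))
    simpa using (h1.const_mul (Real.exp ((k : ℝ) / 2))).mul_const (∑' j, B j)
  rw [Metric.tendstoUniformlyOn_iff]
  intro ε hε
  filter_upwards [hlim.eventually (gt_mem_nhds hε), eventually_ge_atTop 1] with τ hτ hτ1 y hy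
  refine lt_of_le_of_lt ?_ hτ
  rw [dist_comm, Real.dist_eq]
  have h1 := (hf τ (by linarith) y hy).mul_left (Real.exp ((1 + (k : ℝ)) * τ / 2))
  have h2 : HasSum (fun j : ℕ => if j = k then g k y else 0) (g k y) := by
    simpa using hasSum_ite_eq k (g k y)
  have h3 := h1.sub h2
  have h4 := hB.hasSum.mul_left (Real.exp ((k : ℝ) / 2) * Real.exp (-((τ - 1) / 2)))
  refine HasSum.norm_le_of_bounded h3 h4 fun j => ?_
  rw [Real.norm_eq_abs]
  have hpos : 0 ≤ Real.exp ((k : ℝ) / 2) * Real.exp (-((τ - 1) / 2)) * B j :=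
    mul_nonneg (by positivity) (hB0 j)
  rcases lt_trichotomy j k with hj | hj | hj
  · rw [hk j hj y hy, if_neg hj.ne]
    simpa using hpos
  · subst hj
    rw [if_pos rfl, ← mul_assoc, ← Real.exp_add]
    simpa using hpos
  · rw [if_neg hj.ne', sub_zero, ← mul_assoc, ← Real.exp_add, abs_mul, Real.abs_exp]
    calc Real.exp ((1 + (k : ℝ)) * τ / 2 + -((1 + (j : ℝ)) * τ / 2)) * |g j y|
        ≤ Real.exp ((1 + (k : ℝ)) * τ / 2 + -((1 + (j : ℝ)) * τ / 2)) *
          (Real.exp (1 / 2) ^ j * B j) :=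
          mul_le_mul_of_nonneg_left (hg j y hy) (Real.exp_pos _).le
      _ = Real.exp ((1 + (k : ℝ)) * τ / 2 + -((1 + (j : ℝ)) * τ / 2) + j * (1 / 2)) * B j := by
          rw [← Real.exp_nat_mul, ← mul_assoc, ← Real.exp_add]
      _ ≤ Real.exp ((k : ℝ) / 2 + -((τ - 1) / 2)) * B j := by
          refine mul_le_mul_of_nonneg_right (Real.exp_le_exp.2 ?_) (hB0 j)
          have : (k : ℝ) + 1 ≤ j := by exact_mod_cast hj
          nlinarith
      _ = _ := by rw [Real.exp_add]

/-! ### The Hermite expansion of the rescaled velocity -/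

section Expansion

variable {u₀ : E3 → E3} {u : ℝ → E3 → E3} {p : ℝ → E3 → ℝ}

/-- The degree-`k` part of the Hermite expansion of the initial velocity. -/
noncomputable def initialLevel (u : ℝ → E3 → E3) (k : ℕ) : Fin 3 → MvPolynomial (Fin 3) ℝ :=
  fun i => levelPoly (fun y => leray u 0 y i) k

lemma IsBoundedStokesSolution.levelPoly_leray (hu : IsBoundedStokesSolution u₀ u p) {τ : ℝ}
    (hτ : 0 ≤ τ) (i : Fin 3) (k : ℕ) :
    levelPoly (fun y => leray u τ y i) k =
      Real.exp (-((1 + (k : ℝ)) * τ / 2)) • initialLevel u k i := by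
  rw [initialLevel, levelPoly, levelPoly, Finset.smul_sum]
  refine Finset.sum_congr rfl fun β hβ => ?_
  rw [hu.hermiteCoef_leray i β hτ, mem_degLevel.1 hβ, smul_smul]

lemma IsBoundedStokesSolution.leray_zero (hu : IsBoundedStokesSolution u₀ u p) :
    leray u 0 = u₀ := by
  ext y
  simp [leray, hu.initial]

/-- Projecting a solenoidal field onto the Hermite polynomials of degree `k` keeps it solenoidal,
since the divergence has the raising operators as its adjoint. -/
lemma IsBoundedStokesSolution.initialLevel_mem (hu : IsBoundedStokesSolution u₀ u p) (k : ℕ) :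
    initialLevel u k ∈ solenoidalSpace k := by
  refine ⟨fun i _ => levelPoly_mem _ k, ?_⟩
  rw [SetLike.mem_coe, LinearMap.mem_ker]
  have hdiv : polyDiv (initialLevel u k) = ∑ i, MvPolynomial.pderiv i (initialLevel u k i) := by
    simp [polyDiv]
  obtain ⟨M, hM⟩ := hu.data_bounded
  have hcoef : ∀ (i : Fin 3) γ, ∫ y, ev (initialLevel u k i) y * ev (hermitePoly γ) y ∂rhoMeasure =
      if ∑ j, γ j = k then ∫ y, leray u 0 y i * ev (hermitePoly γ) y ∂rhoMeasure else 0 := by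
    intro i γ
    have e : ∀ y, ev (initialLevel u k i) y * ev (hermitePoly γ) y =
        ∑ β ∈ degLevel k, hermiteCoef (fun y => leray u 0 y i) β *
          (ev (hermitePoly β) y * ev (hermitePoly γ) y) := by
      intro y
      rw [initialLevel, ev_levelPoly, Finset.sum_mul]
      exact Finset.sum_congr rfl fun β _ => by ring
    simp_rw [e]
    rw [integral_finsetSum _ fun β _ =>
      (integrable_ev_mul_ev (hermitePoly β) (hermitePoly γ)).const_mul _]
    simp_rw [integral_const_mul]
    split_ifs with h
    · rw [Finset.sum_eq_single_of_mem γ (mem_degLevel.2 h), integral_hermitePoly_sq, hermiteCoef]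
      · have := gaussMass_pos
        field_simp
      · intro β _ hβ
        rw [integral_hermitePoly_mul_of_ne hβ, mul_zero]
    · refine Finset.sum_eq_zero fun β hβ => ?_
      rw [integral_hermitePoly_mul_of_ne, mul_zero]
      rintro rfl
      exact h (mem_degLevel.1 hβ)
  have hzero : ∀ γ,
      ∫ y, ev (polyDiv (initialLevel u k)) y * ev (hermitePoly γ) y ∂rhoMeasure = 0 := by
    intro γ
    simp_rw [hdiv, ev_sum, Finset.sum_mul]
    rw [integral_finsetSum _ fun i _ => integrable_ev_mul_ev _ _]
    simp_rw [integral_pderiv_mul, dstarP_hermitePoly, ev_smul, mul_left_comm _ (Real.sqrt _),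
      integral_const_mul, hcoef]
    have hdeg : ∀ i, ∑ j, Function.update γ i (γ i + 1) j = ∑ j, γ j + 1 := by
      intro i
      rw [Finset.sum_update_of_mem (Finset.mem_univ i),
        ← Finset.add_sum_erase _ γ (Finset.mem_univ i), Finset.sdiff_singleton_eq_erase]
      ring
    simp_rw [hdeg]
    by_cases h : ∑ j, γ j + 1 = k
    · simp_rw [if_pos h]
      have := sum_integral_dstarP_eq_zero hu.data_smooth hM hu.data_div (hermitePoly γ)
      simp_rw [dstarP_hermitePoly, ev_smul, mul_left_comm _ (Real.sqrt _),
        integral_const_mul] at this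
      rwa [hu.leray_zero]
    · simp [h]
  have h0 : ∫ y, ev (polyDiv (initialLevel u k)) y * ev (polyDiv (initialLevel u k)) y
      ∂rhoMeasure = 0 := integral_mul_ev_eq_zero_of_hermitePoly (memLp_ev _) hzero _
  rw [← inner_evLp, inner_self_eq_zero] at h0
  exact evLp_injective (by rw [h0, map_zero])

lemma IsBoundedStokesSolution.exists_initialLevel_bound (hu : IsBoundedStokesSolution u₀ u p)
    (i : Fin 3) {M r : ℝ} (hM : 0 ≤ M) (hr : 1 < r) : ∃ B : ℕ → ℝ, Summable B ∧ (∀ k, 0 ≤ B k) ∧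
      ∀ k y, ‖y‖ ≤ M → |ev (initialLevel u k i) y| ≤ r ^ k * B k :=
  exists_levelPoly_bound (hu.memLp_leray_apply le_rfl i) hM hr

/-- For `τ > 0` the factor `e^{-kτ/2}` makes the expansion converge locally uniformly. -/
lemma IsBoundedStokesSolution.hasSum_leray (hu : IsBoundedStokesSolution u₀ u p) (i : Fin 3)
    {τ : ℝ} (hτ : 0 < τ) :
    (∀ y, HasSum (fun k : ℕ => Real.exp (-((1 + (k : ℝ)) * τ / 2)) * ev (initialLevel u k i) y)
      (leray u τ y i)) ∧
    ∀ K : Set E3, IsCompact K → TendstoUniformlyOn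
      (fun (n : ℕ) y => ev (∑ k ∈ Finset.range n, levelPoly (fun y => leray u τ y i) k) y)
      (fun y => leray u τ y i) atTop K := by
  have h := hasSum_levelPoly (hu.memLp_leray_apply hτ.le i) (hu.continuous_leray_apply hτ.le i) (by
    intro M hM
    obtain ⟨B, hB, hB0, hB'⟩ := hu.exists_initialLevel_bound i hM
      (Real.one_lt_exp_iff.2 (half_pos hτ))
    refine ⟨B, hB, fun k y hy => ?_⟩
    rw [hu.levelPoly_leray hτ.le, ev_smul, abs_mul, Real.abs_exp]
    calc Real.exp (-((1 + (k : ℝ)) * τ / 2)) * |ev (initialLevel u k i) y|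
        ≤ Real.exp (-((1 + (k : ℝ)) * τ / 2)) * (Real.exp (τ / 2) ^ k * B k) :=
          mul_le_mul_of_nonneg_left (hB' k y hy) (Real.exp_pos _).le
      _ = Real.exp (-(τ / 2)) * B k := by
          rw [← Real.exp_nat_mul, ← mul_assoc, ← Real.exp_add]
          congr 2
          ring
      _ ≤ B k := mul_le_of_le_one_left (hB0 k) (Real.exp_le_one_iff.2 (by linarith)))
  refine ⟨fun y => ?_, h.2⟩
  simpa only [hu.levelPoly_leray hτ.le, ev_smul] using h.1 y

/-- The first nonvanishing level of a component of the velocity gives its asymptotics. -/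
lemma IsBoundedStokesSolution.tendsto_component (hu : IsBoundedStokesSolution u₀ u p) (i : Fin 3)
    {k : ℕ} (hk : ∀ l < k, initialLevel u l i = 0) {K : Set E3} (hK : IsCompact K) :
    TendstoUniformlyOn (fun (τ : ℝ) y => Real.exp ((1 + (k : ℝ)) * τ / 2) * leray u τ y i)
      (fun y => ev (initialLevel u k i) y) atTop K := by
  obtain ⟨M, hM⟩ := hK.isBounded.subset_closedBall 0
  obtain ⟨B, hB, hB0, hB'⟩ := hu.exists_initialLevel_bound i (le_max_right M 0)
    (Real.one_lt_exp_iff.2 (by norm_num : (0 : ℝ) < 1 / 2))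
  refine tendstoUniformlyOn_leading (g := fun j y => ev (initialLevel u j i) y) hB hB0
    (fun j y hy => hB' j y ?_) (fun τ hτ y _ => (hu.hasSum_leray i hτ).1 y)
    (fun l hl y _ => by rw [hk l hl, ev_zero])
  exact (mem_closedBall_zero_iff.1 (hM hy)).trans (le_max_left _ _)

/-- The level of degree zero is the constant `u(0,0)`, because the rescaled velocity converges
to it after multiplication by `e^{τ/2}`. -/
lemma IsBoundedStokesSolution.initialLevel_zero (hu : IsBoundedStokesSolution u₀ u p) {i : Fin 3}
    (h0 : u 0 0 i = 0) : initialLevel u 0 i = 0 := by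
  refine ev_injective (funext fun y => ?_)
  rw [ev_zero]
  have h1 := (hu.tendsto_component i (k := 0) (by simp) (isCompact_singleton (x := y))
    ).tendsto_at (Set.mem_singleton y)
  have h2 : Tendsto (fun τ : ℝ => Real.exp ((1 + ((0 : ℕ) : ℝ)) * τ / 2) * leray u τ y i) atTop
      (𝓝 (u 0 0 i)) := by
    have hc : ContinuousWithinAt (fun z : ℝ × E3 => u z.1 z.2) (Set.Icc (-1) 0 ×ˢ Set.univ)
        (0, 0) := hu.continuous_velocity (0, 0) ⟨by simp, trivial⟩
    have hcurve : Tendsto (fun τ : ℝ => ((-Real.exp (-τ), Real.exp (-τ / 2) • y) : ℝ × E3)) atTop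
        (𝓝[Set.Icc (-1) 0 ×ˢ Set.univ] (0, 0)) := by
      rw [tendsto_nhdsWithin_iff]
      constructor
      · have e1 : Tendsto (fun τ : ℝ => -Real.exp (-τ)) atTop (𝓝 0) := by
          simpa using Real.tendsto_exp_neg_atTop_nhds_zero.neg
        have e2 : Tendsto (fun τ : ℝ => Real.exp (-τ / 2)) atTop (𝓝 0) := by
          refine Real.tendsto_exp_atBot.comp (Tendsto.atBot_div_const (by norm_num) ?_)
          exact tendsto_neg_atTop_atBot
        have e3 := e2.smul_const y
        rw [zero_smul] at e3
        exact e1.prodMk_nhds e3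
      · filter_upwards [eventually_ge_atTop 0] with τ hτ
        exact ⟨neg_exp_mem_Icc hτ, trivial⟩
    have h3 := ((EuclideanSpace.proj i : E3 →L[ℝ] ℝ).continuous.tendsto _).comp
      (hc.tendsto.comp hcurve)
    refine h3.congr fun τ => ?_
    rw [leray_apply, ← mul_assoc, ← Real.exp_add]
    have : (1 + ((0 : ℕ) : ℝ)) * τ / 2 + -τ / 2 = 0 := by push_cast; ring
    rw [this, Real.exp_zero, one_mul]
    rfl
  rw [h0] at h2
  exact tendsto_nhds_unique h1 h2

/-- A velocity component whose Hermite expansion vanishes is identically zero. -/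
lemma IsBoundedStokesSolution.component_eq_zero (hu : IsBoundedStokesSolution u₀ u p) {i : Fin 3}
    (h : ∀ k, initialLevel u k i = 0) : ∀ t ∈ Set.Icc (-1 : ℝ) 0, ∀ x, u t x i = 0 := by
  have hopen : ∀ t ∈ Set.Ioo (-1 : ℝ) 0, ∀ x, u t x i = 0 := by
    intro t ht x
    have hpos : 0 < -t := by linarith [ht.2]
    obtain ⟨τ, hτ⟩ : ∃ τ, τ = -Real.log (-t) := ⟨_, rfl⟩
    have hexp : Real.exp (-τ) = -t := by rw [hτ, neg_neg, Real.exp_log hpos]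
    have hτ0 : 0 < τ := by
      rw [hτ, neg_pos]
      exact Real.log_neg hpos (by linarith [ht.1])
    have h1 := (hu.hasSum_leray i hτ0).1 ((Real.exp (-τ / 2))⁻¹ • x)
    simp only [h, ev_zero, mul_zero] at h1
    have h2 := h1.unique hasSum_zero
    rw [leray_apply, selfSimilar, hexp, smul_smul, mul_inv_cancel₀ (Real.exp_pos _).ne', one_smul,
      neg_neg] at h2
    exact (mul_eq_zero.1 h2).resolve_left (Real.exp_pos _).ne'
  intro t ht x
  have hc : ContinuousOn (fun s => u s x i) (Set.Icc (-1) 0) :=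
    (EuclideanSpace.proj i : E3 →L[ℝ] ℝ).continuous.comp_continuousOn
      (hu.continuous_velocity.comp (f := fun s : ℝ => ((s, x) : ℝ × E3)) (by fun_prop)
        (fun s hs => ⟨hs, trivial⟩))
  have : Set.EqOn (fun s => u s x i) (fun _ => 0) (Set.Icc (-1) 0) :=
    Set.EqOn.of_subset_closure (s := Set.Ioo (-1) 0) (fun s hs => hopen s hs x) hc
      continuousOn_const Set.Ioo_subset_Icc_self (by rw [closure_Ioo (by norm_num)])
  exact this ht

/-! ### Coefficients with respect to the given bases -/

variable {ι : ℕ → Type*} [∀ k, Fintype (ι k)]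
  (b : ∀ k, Module.Basis (ι k) ℝ (solenoidalSpace k))

lemma levelPart_eq_coe (d : (Σ k, ι k) → ℝ) (k : ℕ) :
    levelPart b d k = ((∑ j, d ⟨k, j⟩ • b k j : solenoidalSpace k) :
      Fin 3 → MvPolynomial (Fin 3) ℝ) := by
  simp [levelPart]

lemma levelPart_mem (d : (Σ k, ι k) → ℝ) (k : ℕ) (i : Fin 3) :
    levelPart b d k i ∈ hermiteSpace k := by
  rw [levelPart_eq_coe]
  exact (Submodule.coe_mem _ : _ ∈ solenoidalSpace k).1 i trivial

lemma levelPart_injective {d d' : (Σ k, ι k) → ℝ} (h : ∀ k, levelPart b d k = levelPart b d' k) :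
    d = d' := by
  ext ⟨k, j⟩
  have h1 := h k
  rw [levelPart_eq_coe, levelPart_eq_coe, Subtype.coe_inj] at h1
  have h2 := congrArg (fun v => (b k).repr v j) h1
  simpa only [(b k).repr_sum_self] using h2

lemma partialSum_apply (d : (Σ k, ι k) → ℝ) (n : ℕ) (y : E3) (i : Fin 3) :
    partialSum b d n y i = ev (∑ k ∈ Finset.range n, levelPart b d k i) y := by
  rw [partialSum, ev_sum, WithLp.ofLp_sum, Finset.sum_apply]
  rfl

lemma norm_le_sum_abs (v : E3) : ‖v‖ ≤ ∑ i, |v i| := by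
  have h : v = ∑ i, v i • EuclideanSpace.single i (1 : ℝ) := by
    ext j
    simp [Pi.single_apply]
  conv_lhs => rw [h]
  refine (norm_sum_le _ _).trans (Finset.sum_le_sum fun i _ => ?_)
  rw [norm_smul]
  simp

/-- Coefficients with respect to the bases represent a field exactly when their degree-`k` parts
are the componentwise Hermite projections of the field. -/
lemma isHermiteExpansion_iff {v : E3 → E3} (hv : MemLp v 2 rhoMeasure)
    (hvi : ∀ i, MemLp (fun y => v y i) 2 rhoMeasure) (d : (Σ k, ι k) → ℝ) :
    IsHermiteExpansion b v d ↔ ∀ k i, levelPart b d k i = levelPoly (fun y => v y i) k := by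
  have hsub : ∀ n y i, (v y - partialSum b d n y) i =
      v y i - ev (∑ k ∈ Finset.range n, levelPart b d k i) y := fun n y i => by
    rw [PiLp.sub_apply, partialSum_apply]
  constructor
  · rintro ⟨-, h⟩ k i
    refine eq_levelPoly_of_tendsto (q := fun k => levelPart b d k i) (hvi i)
      (fun k => levelPart_mem b d k i) ?_ k
    refine tendsto_of_tendsto_of_tendsto_of_le_of_le tendsto_const_nhds h (fun _ => zero_le) ?_
    intro n
    refine eLpNorm_mono fun y => ?_
    rw [← hsub]
    exact PiLp.norm_apply_le _ i
  · intro h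
    refine ⟨hv, ?_⟩
    have h1 : Tendsto (fun n : ℕ => ∑ i, eLpNorm (fun y => v y i -
        ev (∑ k ∈ Finset.range n, levelPart b d k i) y) 2 rhoMeasure) atTop
        (𝓝 (∑ _i : Fin 3, 0)) := by
      refine tendsto_finsetSum _ fun i _ => ?_
      simp_rw [h]
      exact tendsto_eLpNorm_sub_levelPoly (hvi i)
    rw [Finset.sum_const_zero] at h1
    refine tendsto_of_tendsto_of_tendsto_of_le_of_le tendsto_const_nhds h1 (fun _ => zero_le) ?_
    intro n
    have hm : ∀ i, AEStronglyMeasurable (fun y => |v y i -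
        ev (∑ k ∈ Finset.range n, levelPart b d k i) y|) rhoMeasure := fun i =>
      ((hvi i).1.sub (continuous_ev _).aestronglyMeasurable).norm
    calc eLpNorm (fun y => v y - partialSum b d n y) 2 rhoMeasure
        ≤ eLpNorm (∑ i, fun y => |v y i - ev (∑ k ∈ Finset.range n, levelPart b d k i) y|) 2
          rhoMeasure := by
          refine eLpNorm_mono_real fun y => ?_
          rw [Finset.sum_apply]
          simp_rw [← hsub]
          exact norm_le_sum_abs _
      _ ≤ ∑ i, eLpNorm (fun y => |v y i - ev (∑ k ∈ Finset.range n, levelPart b d k i) y|) 2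
          rhoMeasure := eLpNorm_sum_le (fun i _ => hm i) (by norm_num)
      _ = _ := Finset.sum_congr rfl fun i _ => by
          simpa only [Real.norm_eq_abs] using eLpNorm_norm (fun y => v y i -
            ev (∑ k ∈ Finset.range n, levelPart b d k i) y)

lemma tendstoUniformlyOn_of_apply {κ : Type*} {l : Filter κ} {F : κ → E3 → E3} {g : E3 → E3}
    {K : Set E3} (h : ∀ i, TendstoUniformlyOn (fun n y => F n y i) (fun y => g y i) l K) :
    TendstoUniformlyOn F g l K := by
  rw [Metric.tendstoUniformlyOn_iff]
  intro ε hε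
  have h1 : ∀ i, ∀ᶠ n in l, ∀ y ∈ K, dist (g y i) (F n y i) < ε / 3 := fun i =>
    Metric.tendstoUniformlyOn_iff.1 (h i) (ε / 3) (by positivity)
  filter_upwards [h1 0, h1 1, h1 2] with n h0 h1 h2 y hy
  rw [dist_eq_norm]
  refine (norm_le_sum_abs _).trans_lt ?_
  rw [Fin.sum_univ_three]
  have e0 := h0 y hy
  have e1 := h1 y hy
  have e2 := h2 y hy
  rw [Real.dist_eq] at e0 e1 e2
  simp only [PiLp.sub_apply]
  linarith

end Expansion

end StokesNodal

namespace StokesNodal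

/-! ### Sign changes of Hermite polynomials at their zeros -/

/-- Elements of `Φ_k^*` are eigenfunctions of `-Δ + ½ y · ∇` with eigenvalue `k/2`. -/
lemma sum_dstarP_pderiv_of_mem {k : ℕ} {q : MvPolynomial (Fin 3) ℝ} (hq : q ∈ hermiteSpace k) :
    ∑ i, dstarP i (MvPolynomial.pderiv i q) = ((k : ℝ) / 2) • q := by
  induction hq using Submodule.span_induction with
  | mem x hx =>
    obtain ⟨β, hβ, rfl⟩ := hx
    simp_rw [dstarP_pderiv_hermitePoly]
    rw [← Finset.sum_smul, ← Finset.sum_div, ← show ∑ i, β i = k from hβ]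
    push_cast
    rfl
  | zero => simp [dstarP]
  | add x y _ _ hx hy =>
    simp_rw [map_add, dstarP_add]
    rw [Finset.sum_add_distrib, hx, hy, smul_add]
  | smul a x _ hx =>
    have h : ∀ i, dstarP i (MvPolynomial.pderiv i (a • x)) =
        a • dstarP i (MvPolynomial.pderiv i x) := fun i => by rw [Derivation.map_smul, dstarP_smul]
    simp_rw [h]
    rw [← Finset.smul_sum, hx, smul_comm]

/-- Translation of a polynomial: `shift a q (y) = q (a + y)`. -/
noncomputable def shift (a : E3) (q : MvPolynomial (Fin 3) ℝ) : MvPolynomial (Fin 3) ℝ :=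
  MvPolynomial.aeval (fun i => MvPolynomial.X i + MvPolynomial.C (a i)) q

lemma ev_shift (a : E3) (q : MvPolynomial (Fin 3) ℝ) (y : E3) :
    ev (shift a q) y = ev q (a + y) := by
  induction q using MvPolynomial.induction_on with
  | C c => simp [shift, ev]
  | add p q hp hq =>
    rw [shift, map_add, ev_add, ev_add, ← hp, ← hq]; rfl
  | mul_X p i hp =>
    rw [shift, map_mul, ev_mul, ev_mul, ← hp, MvPolynomial.aeval_X, ev_add, ev_X, ev_C, ev_X,
      PiLp.add_apply, add_comm (y i)]
    rfl

lemma pderiv_shift (a : E3) (q : MvPolynomial (Fin 3) ℝ) (i : Fin 3) :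
    MvPolynomial.pderiv i (shift a q) = shift a (MvPolynomial.pderiv i q) := by
  refine ev_injective (funext fun y => ?_)
  rw [ev_shift, ← pd_ev, ← pd_ev, pd, pd, funext (ev_shift a q)]
  rw [fderiv_comp_add_left]

/-- The eigenvalue equation of a Hermite polynomial, recentred at the point `a`. -/
lemma laplacian_shift {k : ℕ} {q : MvPolynomial (Fin 3) ℝ} (hq : q ∈ hermiteSpace k) (a : E3) :
    ∑ i, MvPolynomial.pderiv i (MvPolynomial.pderiv i (shift a q)) =
      ∑ i, (MvPolynomial.C (1 / 2) * (MvPolynomial.X i * MvPolynomial.pderiv i (shift a q)) +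
        MvPolynomial.C (a i / 2) * MvPolynomial.pderiv i (shift a q)) -
        MvPolynomial.C ((k : ℝ) / 2) * shift a q := by
  refine ev_injective (funext fun y => ?_)
  have h := congrArg (fun p => ev p (a + y)) (sum_dstarP_pderiv_of_mem hq)
  have hneg : ∀ p r : MvPolynomial (Fin 3) ℝ, ∀ y, ev (p - r) y = ev p y - ev r y := fun p r y => by
    simp [ev]
  simp only [ev_sum, dstarP, hneg, ev_mul, ev_C, ev_X, ev_smul, Finset.sum_sub_distrib,
    PiLp.add_apply] at h
  simp only [ev_sum, hneg, ev_add, ev_mul, ev_C, ev_X, pderiv_shift, ev_shift]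
  rw [sub_eq_iff_eq_add] at h
  rw [eq_sub_iff_add_eq, add_comm, ← h]
  exact Finset.sum_congr rfl fun i _ => by ring

lemma coeff_eq_zero_of_homogeneousComponent {Q : MvPolynomial (Fin 3) ℝ} {m : ℕ}
    (h : ∀ j < m, MvPolynomial.homogeneousComponent j Q = 0) {d : Fin 3 →₀ ℕ} (hd : d.degree < m) :
    MvPolynomial.coeff d Q = 0 := by
  have := congrArg (MvPolynomial.coeff d) (h _ hd)
  rwa [MvPolynomial.coeff_homogeneousComponent, if_pos rfl, MvPolynomial.coeff_zero] at this

/-- The lowest-order homogeneous part of a recentred Hermite polynomial is harmonic, because the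
drift and the eigenvalue only contribute at higher order. -/
lemma laplacian_homogeneousComponent {k : ℕ} {q : MvPolynomial (Fin 3) ℝ}
    (hq : q ∈ hermiteSpace k) (a : E3) {m : ℕ}
    (h : ∀ j < m, MvPolynomial.homogeneousComponent j (shift a q) = 0) :
    ∑ i, MvPolynomial.pderiv i (MvPolynomial.pderiv i
      (MvPolynomial.homogeneousComponent m (shift a q))) = 0 := by
  set Q := shift a q with hQ
  have hlow : ∀ d : Fin 3 →₀ ℕ, d.degree < m → MvPolynomial.coeff d Q = 0 := fun d hd =>
    coeff_eq_zero_of_homogeneousComponent h hd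
  have hlow' : ∀ (i : Fin 3) (d : Fin 3 →₀ ℕ), d.degree + 1 < m →
      MvPolynomial.coeff d (MvPolynomial.pderiv i Q) = 0 := by
    intro i d hd
    rw [MvPolynomial.coeff_pderiv, hlow, zero_mul]
    rw [map_add, Finsupp.degree_single]
    exact hd
  ext d
  rw [MvPolynomial.coeff_zero, MvPolynomial.coeff_sum]
  by_cases hd : d.degree + 2 = m
  · have h1 : ∀ i, MvPolynomial.coeff d (MvPolynomial.pderiv i (MvPolynomial.pderiv i
        (MvPolynomial.homogeneousComponent m Q))) =
        MvPolynomial.coeff d (MvPolynomial.pderiv i (MvPolynomial.pderiv i Q)) := by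
      intro i
      simp only [MvPolynomial.coeff_pderiv, MvPolynomial.coeff_homogeneousComponent, map_add,
        Finsupp.degree_single]
      rw [if_pos (by omega)]
    simp_rw [h1]
    rw [← MvPolynomial.coeff_sum, laplacian_shift hq a, MvPolynomial.coeff_sub,
      MvPolynomial.coeff_C_mul, hlow d (by omega), mul_zero, sub_zero, MvPolynomial.coeff_sum]
    refine Finset.sum_eq_zero fun i _ => ?_
    rw [MvPolynomial.coeff_add, MvPolynomial.coeff_C_mul, MvPolynomial.coeff_C_mul,
      hlow' i d (by omega), mul_zero, add_zero, MvPolynomial.coeff_X_mul']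
    split_ifs with hi
    · have hdi : (d - Finsupp.single i 1).degree + 1 = d.degree := by
        have : d - Finsupp.single i 1 + Finsupp.single i 1 = d := by
          refine tsub_add_cancel_of_le ?_
          rw [Finsupp.single_le_iff]
          exact Nat.one_le_iff_ne_zero.2 (Finsupp.mem_support_iff.1 hi)
        conv_rhs => rw [← this]
        rw [map_add, Finsupp.degree_single]
      rw [hlow' i _ (by omega), mul_zero]
    · rw [mul_zero]
  · refine Finset.sum_eq_zero fun i _ => ?_
    simp only [MvPolynomial.coeff_pderiv, MvPolynomial.coeff_homogeneousComponent, map_add,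
      Finsupp.degree_single]
    rw [if_neg (by omega), zero_mul, zero_mul]

/-- A harmonic homogeneous polynomial of positive degree has Gaussian mean zero, by Euler's
identity. -/
lemma integral_harmonic_homogeneous {h : MvPolynomial (Fin 3) ℝ} {m : ℕ} (hm : m ≠ 0)
    (hh : h.IsHomogeneous m)
    (hharm : ∑ i, MvPolynomial.pderiv i (MvPolynomial.pderiv i h) = 0) :
    ∫ y, ev h y ∂rhoMeasure = 0 := by
  have h1 : ∑ i, dstarP i (MvPolynomial.pderiv i h) = MvPolynomial.C ((m : ℝ) / 2) * h := by
    simp only [dstarP, Finset.sum_sub_distrib, hharm, sub_zero, mul_assoc]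
    rw [← Finset.mul_sum, hh.sum_X_mul_pderiv, nsmul_eq_mul, ← mul_assoc]
    congr 1
    rw [← map_natCast (MvPolynomial.C (R := ℝ) (σ := Fin 3)), ← map_mul]
    congr 1
    ring
  have h2 : ∀ i, ∫ y, ev (dstarP i (MvPolynomial.pderiv i h)) y ∂rhoMeasure = 0 := by
    intro i
    have := integral_pderiv_mul i 1 (MvPolynomial.pderiv i h)
    have hone : ∀ y, ev 1 y = 1 := fun y => by simp [ev]
    rw [MvPolynomial.pderiv_one] at this
    simp only [ev_zero, zero_mul, hone, one_mul, integral_zero] at this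
    exact this.symm
  have h3 : ∫ y, ev (∑ i, dstarP i (MvPolynomial.pderiv i h)) y ∂rhoMeasure = 0 := by
    simp_rw [ev_sum]
    rw [integral_finsetSum _ fun i _ => integrable_ev _]
    simp [h2]
  rw [h1] at h3
  simp only [ev_mul, ev_C] at h3
  rw [integral_const_mul] at h3
  exact (mul_eq_zero.1 h3).resolve_left (by positivity)

lemma exists_pos_of_integral_eq_zero {h : MvPolynomial (Fin 3) ℝ} (hne : h ≠ 0)
    (hint : ∫ y, ev h y ∂rhoMeasure = 0) : ∃ y, 0 < ev h y := by
  by_contra! hc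
  have h1 : ∫ y, (-ev h) y ∂rhoMeasure = 0 := by
    simp only [Pi.neg_apply]
    rw [integral_neg, hint, neg_zero]
  rw [integral_eq_zero_iff_of_nonneg (fun y => by simpa using hc y) (integrable_ev h).neg] at h1
  have h2 := (Continuous.ae_eq_iff_eq rhoMeasure (continuous_ev h).neg continuous_zero).1 h1
  refine hne (ev_injective (funext fun y => ?_))
  have := congrFun h2 y
  simp only [Pi.zero_apply, Pi.neg_apply] at this
  rw [ev_zero]
  linarith

lemma ev_homogeneousComponent_smul (Q : MvPolynomial (Fin 3) ℝ) (n : ℕ) (s : ℝ) (y : E3) :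
    ev (MvPolynomial.homogeneousComponent n Q) (s • y) =
      s ^ n * ev (MvPolynomial.homogeneousComponent n Q) y := by
  rw [ev, ev, MvPolynomial.eval_eq', MvPolynomial.eval_eq', Finset.mul_sum]
  refine Finset.sum_congr rfl fun d hd => ?_
  have hdeg : d.degree = n := by
    by_contra hne
    rw [MvPolynomial.mem_support_iff, MvPolynomial.coeff_homogeneousComponent, if_neg hne] at hd
    exact hd rfl
  have : ∏ i, (s • y) i ^ d i = s ^ n * ∏ i, y i ^ d i := by
    simp only [PiLp.smul_apply, smul_eq_mul, mul_pow]
    rw [Finset.prod_mul_distrib, Finset.prod_pow_eq_pow_sum, ← hdeg, Finsupp.degree_eq_sum]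
  rw [this]
  ring

/-- Along a ray, a polynomial has the sign of its lowest homogeneous part near the origin. -/
lemma eventually_pos_of_homogeneousComponent {Q : MvPolynomial (Fin 3) ℝ} {m : ℕ}
    (h : ∀ j < m, MvPolynomial.homogeneousComponent j Q = 0) {y : E3}
    (hy : 0 < ev (MvPolynomial.homogeneousComponent m Q) y) :
    ∀ᶠ s in 𝓝[>] (0 : ℝ), 0 < ev Q (s • y) := by
  let N := max (Q.totalDegree + 1) (m + 1)
  have hsum : Q = ∑ j ∈ Finset.range N, MvPolynomial.homogeneousComponent j Q := by
    conv_lhs => rw [← MvPolynomial.sum_homogeneousComponent Q]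
    refine Finset.sum_subset (Finset.range_mono (le_max_left _ _)) fun j _ hj => ?_
    refine MvPolynomial.homogeneousComponent_eq_zero _ _ ?_
    rw [Finset.mem_range] at hj
    omega
  let φ : ℝ → ℝ := fun s => ∑ j ∈ Finset.range N,
    s ^ (j - m) * ev (MvPolynomial.homogeneousComponent j Q) y
  have hφ : Continuous φ := by fun_prop
  have hφ0 : φ 0 = ev (MvPolynomial.homogeneousComponent m Q) y := by
    have hmem : m ∈ Finset.range N := Finset.mem_range.2 (lt_max_of_lt_right (Nat.lt_succ_self m))
    refine (Finset.sum_eq_single_of_mem m hmem fun j _ hj => ?_).trans (by simp)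
    rcases lt_or_gt_of_ne hj with hlt | hlt
    · rw [h j hlt, ev_zero, mul_zero]
    · rw [zero_pow (by omega), zero_mul]
  have hev : ∀ s, ev Q (s • y) = s ^ m * φ s := by
    intro s
    conv_lhs => rw [hsum]
    rw [ev_sum, Finset.mul_sum]
    refine Finset.sum_congr rfl fun j _ => ?_
    rw [ev_homogeneousComponent_smul]
    rcases lt_or_ge j m with hlt | hge
    · rw [h j hlt]; simp [ev_zero]
    · rw [← mul_assoc, ← pow_add, Nat.add_sub_cancel' hge]
  have hpos : ∀ᶠ s in 𝓝[>] (0 : ℝ), 0 < φ s := by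
    have : Tendsto φ (𝓝[>] 0) (𝓝 (φ 0)) := (hφ.tendsto 0).mono_left nhdsWithin_le_nhds
    exact this.eventually (lt_mem_nhds (by rw [hφ0]; exact hy))
  filter_upwards [hpos, self_mem_nhdsWithin] with s hs hs0
  rw [hev]
  exact mul_pos (pow_pos hs0 m) hs

/-- A nonzero element of a Hermite space takes positive values arbitrarily close to each of its
zeros. Applied to the polynomial and its negative, this says that it changes sign there. -/
lemma exists_pos_near_zero {k : ℕ} {q : MvPolynomial (Fin 3) ℝ} (hq : q ∈ hermiteSpace k)
    (hne : q ≠ 0) {a : E3} (ha : ev q a = 0) {r : ℝ} (hr : 0 < r) :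
    ∃ y ∈ Metric.ball a r, 0 < ev q y := by
  set Q := shift a q with hQ
  have hex : ∃ m, MvPolynomial.homogeneousComponent m Q ≠ 0 := by
    by_contra! hall
    have h0 : Q = 0 := by
      rw [← MvPolynomial.sum_homogeneousComponent Q]
      exact Finset.sum_eq_zero fun j _ => hall j
    refine hne (ev_injective (funext fun y => ?_))
    have := ev_shift a q (y - a)
    rw [← hQ, h0, add_sub_cancel] at this
    rw [← this, ev_zero, ev_zero]
  classical
  set m := Nat.find hex with hm
  have hm1 : MvPolynomial.homogeneousComponent m Q ≠ 0 := Nat.find_spec hex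
  have hlow : ∀ j < m, MvPolynomial.homogeneousComponent j Q = 0 := fun j hj => by
    simpa using Nat.find_min hex hj
  -- the part of degree zero is the value at `a`
  have hm0 : m ≠ 0 := by
    intro h0
    rw [h0] at hm1
    refine hm1 ?_
    have e : ev Q 0 = MvPolynomial.coeff 0 Q := by
      rw [← MvPolynomial.constantCoeff_eq, ← MvPolynomial.eval_zero]; rfl
    rw [MvPolynomial.homogeneousComponent_zero, ← e, hQ, ev_shift, add_zero, ha, map_zero]
  obtain ⟨y, hy⟩ := exists_pos_of_integral_eq_zero hm1 (integral_harmonic_homogeneous hm0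
    (MvPolynomial.homogeneousComponent_isHomogeneous m Q)
    (laplacian_homogeneousComponent hq a hlow))
  have h1 := eventually_pos_of_homogeneousComponent hlow hy
  have h2 : ∀ᶠ s in 𝓝[>] (0 : ℝ), a + s • y ∈ Metric.ball a r := by
    have hc : Tendsto (fun s : ℝ => a + s • y) (𝓝[>] 0) (𝓝 (a + (0 : ℝ) • y)) :=
      (Continuous.tendsto (by fun_prop) 0).mono_left nhdsWithin_le_nhds
    rw [zero_smul, add_zero] at hc
    exact hc.eventually (Metric.ball_mem_nhds a hr)
  obtain ⟨s, hs1, hs2⟩ := (h1.and h2).exists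
  exact ⟨a + s • y, hs2, by rwa [← ev_shift]⟩

/-! ### Convergence of nodal sets -/

/-- Nodal sets converge under locally uniform convergence, up to positive scalar factors, if the
limit changes sign at each of its zeros. -/
lemma locallyHausdorffTendsto_nodalSet {F : ℝ → E3 → ℝ} {g : E3 → ℝ} {A : ℝ → ℝ}
    (hF : ∀ᶠ τ in atTop, Continuous (F τ)) (hg : Continuous g) (hA : ∀ τ, 0 < A τ)
    (hlim : ∀ K : Set E3, IsCompact K →
      TendstoUniformlyOn (fun τ y => A τ * F τ y) g atTop K)
    (hpos : ∀ a, g a = 0 → ∀ r > 0, ∃ y ∈ Metric.ball a r, 0 < g y)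
    (hneg : ∀ a, g a = 0 → ∀ r > 0, ∃ y ∈ Metric.ball a r, g y < 0) :
    LocallyHausdorffTendsto (fun τ => nodalSet (F τ)) (nodalSet g) := by
  intro K hK ε hε
  refine Eventually.and ?_ ?_
  -- away from its zero set, `|g|` has a positive minimum on `K`
  · have hK' : IsCompact (K \ Metric.thickening ε (nodalSet g)) :=
      hK.diff Metric.isOpen_thickening
    rcases (K \ Metric.thickening ε (nodalSet g)).eq_empty_or_nonempty with hemp | hnon
    · refine Eventually.of_forall fun τ y hy => ?_
      by_contra hc
      exact (Set.eq_empty_iff_forall_notMem.1 hemp y) ⟨hy.2, hc⟩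
    · obtain ⟨y₀, hy₀, hmin⟩ := hK'.exists_isMinOn hnon hg.abs.continuousOn
      have hδ : 0 < |g y₀| := by
        refine abs_pos.2 fun h0 => hy₀.2 ?_
        exact Metric.self_subset_thickening hε _ h0
      filter_upwards [Metric.tendstoUniformlyOn_iff.1 (hlim K hK) _ hδ] with τ hτ y hy
      by_contra hc
      have h1 := hτ y hy.2
      have h2 : |g y₀| ≤ |g y| := hmin ⟨hy.2, hc⟩
      have h3 : F τ y = 0 := hy.1
      rw [h3, mul_zero, Real.dist_eq, sub_zero] at h1
      linarith
  -- near a zero of `g`, eventually `F τ` has both signs, hence a zero; compactness makes this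
  -- uniform
  · have hclosed : IsClosed (nodalSet g) := isClosed_eq hg continuous_const
    refine (hK.inter_left hclosed).induction_on (p := fun s => ∀ᶠ τ in atTop,
      s ⊆ Metric.thickening ε (nodalSet (F τ))) ?_ ?_ ?_ ?_
    · exact Eventually.of_forall fun τ => Set.empty_subset _
    · intro s t hst ht
      filter_upwards [ht] with τ hτ using hst.trans hτ
    · intro s t hs ht
      filter_upwards [hs, ht] with τ h1 h2 using Set.union_subset h1 h2
    · intro a ha
      obtain ⟨y₁, hy₁, h₁⟩ := hpos a ha.1 (ε / 2) (by positivity)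
      obtain ⟨y₂, hy₂, h₂⟩ := hneg a ha.1 (ε / 2) (by positivity)
      refine ⟨Metric.ball a (ε / 2), mem_nhdsWithin_of_mem_nhds
        (Metric.ball_mem_nhds a (by positivity)), ?_⟩
      have t₁ := (hlim {y₁} isCompact_singleton).tendsto_at (Set.mem_singleton y₁)
      have t₂ := (hlim {y₂} isCompact_singleton).tendsto_at (Set.mem_singleton y₂)
      filter_upwards [t₁.eventually (lt_mem_nhds h₁), t₂.eventually (gt_mem_nhds h₂), hF]
        with τ e₁ e₂ hc y hy
      have p₁ : 0 < F τ y₁ := pos_of_mul_pos_right e₁ (hA τ).le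
      have p₂ : F τ y₂ < 0 := by
        by_contra! hcon
        exact absurd (mul_nonneg (hA τ).le hcon) (not_le.2 e₂)
      obtain ⟨z, hz, hz0⟩ := (convex_ball a (ε / 2)).isPreconnected.intermediate_value hy₂ hy₁
        hc.continuousOn ⟨p₂.le, p₁.le⟩
      rw [Metric.mem_thickening_iff]
      refine ⟨z, hz0, ?_⟩
      rw [Metric.mem_ball] at hy hz
      calc dist y z ≤ dist y a + dist z a := dist_triangle_right _ _ _
        _ < ε / 2 + ε / 2 := add_lt_add hy hz
        _ = ε := by ring

end StokesNodal

theorem mainTheorem1 {ι : ℕ → Type*} [∀ k, Fintype (ι k)]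
    (b : ∀ k, Module.Basis (ι k) ℝ (StokesNodal.solenoidalSpace k))
    (u₀ : StokesNodal.E3 → StokesNodal.E3) (u : ℝ → StokesNodal.E3 → StokesNodal.E3)
    (p : ℝ → StokesNodal.E3 → ℝ) (hu : StokesNodal.IsBoundedStokesSolution u₀ u p) :
    ∃ c : ℝ → (Σ k, ι k) → ℝ,
      -- `c τ` are the coefficients of the expansion of the rescaled velocity
      (∀ τ : ℝ, 0 ≤ τ → ∀ d : (Σ k, ι k) → ℝ,
        StokesNodal.IsHermiteExpansion b (StokesNodal.leray u τ) d ↔ d = c τ) ∧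
      -- for positive times the expansion also converges uniformly on compact sets
      (∀ τ : ℝ, 0 < τ → ∀ K : Set StokesNodal.E3, IsCompact K →
        TendstoUniformlyOn (fun n => StokesNodal.partialSum b (c τ) n)
          (StokesNodal.leray u τ) atTop K) ∧
      -- the diagonal system and its solution
      (∀ β : Σ k, ι k, ∀ τ : ℝ, 0 ≤ τ →
        HasDerivWithinAt (fun s => c s β) ((-(β.1 : ℝ) / 2 - 1 / 2) * c τ β) (Set.Ici 0) τ) ∧
      (∀ β : Σ k, ι k, ∀ τ : ℝ, 0 ≤ τ →
        c τ β = c 0 β * Real.exp (-((1 + (β.1 : ℝ)) * τ / 2))) ∧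
      -- asymptotics of the velocity field at a zero
      (u 0 0 = 0 → (∀ t ∈ Set.Icc (-1 : ℝ) 0, ∀ x, u t x = 0) ∨
        ∃ k : ℕ, 1 ≤ k ∧ StokesNodal.levelPart b (c 0) k ≠ 0 ∧
          (∀ l < k, StokesNodal.levelPart b (c 0) l = 0) ∧
          ∀ K : Set StokesNodal.E3, IsCompact K →
            TendstoUniformlyOn
              (fun (τ : ℝ) y => Real.exp ((1 + (k : ℝ)) * τ / 2) • StokesNodal.leray u τ y)
              (StokesNodal.polyField (StokesNodal.levelPart b (c 0) k)) atTop K) ∧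
      -- asymptotics and nodal sets of each velocity component at its zero
      (∀ i : Fin 3, u 0 0 i = 0 → (∀ t ∈ Set.Icc (-1 : ℝ) 0, ∀ x, u t x i = 0) ∨
        ∃ k : ℕ, 1 ≤ k ∧ StokesNodal.levelPart b (c 0) k i ≠ 0 ∧
          (∀ l < k, StokesNodal.levelPart b (c 0) l i = 0) ∧
          (∀ K : Set StokesNodal.E3, IsCompact K →
            TendstoUniformlyOn
              (fun (τ : ℝ) y => Real.exp ((1 + (k : ℝ)) * τ / 2) * StokesNodal.leray u τ y i)
              (fun y => StokesNodal.polyField (StokesNodal.levelPart b (c 0) k) y i) atTop K) ∧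
          StokesNodal.LocallyHausdorffTendsto
            (fun τ => StokesNodal.nodalSet (fun y => StokesNodal.leray u τ y i))
            (StokesNodal.nodalSet
              (fun y => StokesNodal.polyField (StokesNodal.levelPart b (c 0) k) y i))) := by
  classical
  let w := StokesNodal.initialLevel u
  -- the coordinates of the initial level `w k`, times the exact decay factor
  let c : ℝ → (Σ k, ι k) → ℝ := fun τ β => Real.exp (-((1 + (β.1 : ℝ)) * τ / 2)) *
    (b β.1).repr ⟨w β.1, hu.initialLevel_mem β.1⟩ β.2
  have hc : ∀ τ k, StokesNodal.levelPart b (c τ) k =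
      Real.exp (-((1 + (k : ℝ)) * τ / 2)) • w k := by
    intro τ k
    rw [StokesNodal.levelPart_eq_coe]
    simp only [c, mul_smul, ← Finset.smul_sum]
    exact congrArg (fun v : StokesNodal.solenoidalSpace k =>
      Real.exp (-((1 + (k : ℝ)) * τ / 2)) • (v : Fin 3 → MvPolynomial (Fin 3) ℝ))
      ((b k).sum_repr ⟨w k, hu.initialLevel_mem k⟩)
  have hc0 : ∀ k, StokesNodal.levelPart b (c 0) k = w k := fun k => by simp [hc]
  have hlevel : ∀ τ, 0 ≤ τ → ∀ k i, StokesNodal.levelPart b (c τ) k i =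
      StokesNodal.levelPoly (fun y => StokesNodal.leray u τ y i) k := fun τ hτ k i => by
    rw [hc, hu.levelPoly_leray hτ]; rfl
  have hiff : ∀ τ, 0 ≤ τ → ∀ d, StokesNodal.IsHermiteExpansion b (StokesNodal.leray u τ) d ↔
      ∀ k i, StokesNodal.levelPart b d k i =
        StokesNodal.levelPoly (fun y => StokesNodal.leray u τ y i) k := fun τ hτ d =>
    StokesNodal.isHermiteExpansion_iff b (hu.memLp_leray hτ) (hu.memLp_leray_apply hτ) d
  refine ⟨c, fun τ hτ d => ?_, fun τ hτ K hK => ?_, fun β τ _ => ?_, fun β τ _ => ?_,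
    fun h0 => ?_, fun i h0 => ?_⟩
  · rw [hiff τ hτ]
    constructor
    · intro h
      refine StokesNodal.levelPart_injective b fun k => funext fun i => ?_
      rw [h, hlevel τ hτ]
    · rintro rfl
      exact hlevel τ hτ
  · refine StokesNodal.tendstoUniformlyOn_of_apply fun i => ?_
    simp_rw [StokesNodal.partialSum_apply, hlevel τ hτ.le]
    exact (hu.hasSum_leray i hτ).2 K hK
  · have h1 : HasDerivAt (fun s : ℝ => -((1 + (β.1 : ℝ)) * s / 2)) (-(β.1 : ℝ) / 2 - 1 / 2) τ := by
      have := (((hasDerivAt_id τ).const_mul (1 + (β.1 : ℝ))).div_const 2).neg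
      exact this.congr_deriv (by ring)
    exact ((h1.exp.mul_const _).congr_deriv (by simp only [c]; ring)).hasDerivWithinAt
  · simp only [c]
    simp
    ring
  · by_cases hz : ∀ k, w k = 0
    · left
      intro t ht x
      ext i
      exact hu.component_eq_zero (fun k => congrFun (hz k) i) t ht x
    · right
      push Not at hz
      have hlow : ∀ l < Nat.find hz, w l = 0 := fun l hl => by simpa using Nat.find_min hz hl
      refine ⟨Nat.find hz, Nat.one_le_iff_ne_zero.2 fun hk => Nat.find_spec hz ?_, ?_, ?_, ?_⟩
      · rw [hk]
        exact funext fun i => hu.initialLevel_zero (by rw [h0]; rfl)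
      · rw [hc0]; exact Nat.find_spec hz
      · intro l hl
        rw [hc0, hlow l hl]
      · intro K hK
        refine StokesNodal.tendstoUniformlyOn_of_apply fun i => ?_
        rw [hc0]
        exact hu.tendsto_component i (fun l hl => congrFun (hlow l hl) i) hK
  · by_cases hz : ∀ k, w k i = 0
    · exact Or.inl (hu.component_eq_zero hz)
    · right
      push Not at hz
      have hlow : ∀ l < Nat.find hz, w l i = 0 := fun l hl => by simpa using Nat.find_min hz hl
      have hlim : ∀ K : Set StokesNodal.E3, IsCompact K → TendstoUniformlyOn
          (fun (τ : ℝ) y => Real.exp ((1 + ((Nat.find hz : ℕ) : ℝ)) * τ / 2) *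
            StokesNodal.leray u τ y i)
          (StokesNodal.ev (w (Nat.find hz) i)) atTop K := fun K hK =>
        hu.tendsto_component i hlow hK
      have hmem : w (Nat.find hz) i ∈ StokesNodal.hermiteSpace (Nat.find hz) :=
        (hu.initialLevel_mem _).1 i trivial
      refine ⟨Nat.find hz, Nat.one_le_iff_ne_zero.2 fun hk => Nat.find_spec hz ?_, ?_, ?_, ?_, ?_⟩
      · rw [hk]
        exact hu.initialLevel_zero h0
      · rw [hc0]; exact Nat.find_spec hz
      · intro l hl
        rw [hc0, hlow l hl]
      · rw [hc0]; exact hlim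
      · rw [hc0]
        refine StokesNodal.locallyHausdorffTendsto_nodalSet
          (g := StokesNodal.ev (w (Nat.find hz) i)) ?_ (StokesNodal.continuous_ev _)
          (fun τ => Real.exp_pos _) hlim (fun a ha r hr => ?_) (fun a ha r hr => ?_)
        · filter_upwards [eventually_ge_atTop 0] with τ hτ
          exact hu.continuous_leray_apply hτ i
        · exact StokesNodal.exists_pos_near_zero hmem (Nat.find_spec hz) ha hr
        · have hneg : ∀ y, StokesNodal.ev (-w (Nat.find hz) i) y =
              -StokesNodal.ev (w (Nat.find hz) i) y := fun y => by simp [StokesNodal.ev]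
          obtain ⟨y, hy, hy'⟩ := StokesNodal.exists_pos_near_zero (Submodule.neg_mem _ hmem)
            (neg_ne_zero.2 (Nat.find_spec hz)) (a := a) (by rw [hneg, ha, neg_zero]) hr
          exact ⟨y, hy, by rw [hneg] at hy'; linarith⟩
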